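/- Let $V$ be a finite-dimensional real inner product space, $\Phi\subset V$ a finite reduced root system (not necessarily crystallographic or spanning) with simple system $\Delta$ and positive system $\Phi^+$, and let $W$ be the finite reflection group generated by the reflections $s_\gamma$, $\gamma\in\Phi$. Let $S=\mathrm{Sym}(V)$ be the polynomial ring with $S^1=V$, let $S_W=S/I$ be the coinvariant ring of $W$, where $I$ is the ideal generated by the $W$-invariants of positive degree, and for $\Theta\subseteq\Delta$ let $W_\Theta=\langle s_\alpha\mid\alpha\in\Theta\rangle$ and let $R=S_W^{W_\Theta}\subseteq S_W$ be the graded subring of $W_\Theta$-invariants, with top degree $r$ (so $R=\bigoplus_{i=0}^r R^i$, $R^r\neq 0$). Let $\bar\rho\in R^1$ be the class of $\frac12\sum_{\gamma\in\Phi^+\setminus\Phi_\Theta^+}\gamma$, where $\Phi_\Theta^+=\Phi^+\cap\mathrm{span}_{\mathbb R}\,\Theta$. An element $l\in R^1$ is a Lefschetz element if $l^{r-2i}\colon R^i\to R^{r-i}$ is an isomorphism for $0\le i\le\lfloor r/2\rfloor$; $R$ has the strong Lefschetz property if it has a Lefschetz element; $R$ has the weak Lefschetz property if the multiplication $\bar\rho\colon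 R^i\to R^{i+1}$ is injective for $0\le i<\lfloor r/2\rfloor$. Lemma. Suppose that $W$ is of type $E_8$ (resp. $H_4$), that is, the reflections in the elements of $\Delta$ have the Coxeter matrix of that type. Then there is $\Theta\subset\Delta$ with $W_\Theta$ of type $E_7$ (resp. $H_3$), and for every such $\Theta$ the ring $S_W^{W_\Theta}$ has the strong Lefschetz property if and only if it has the weak Lefschetz property; moreover $\bar\rho$ is a Lefschetz element of $S_W^{W_\Theta}$ if and only if $S_W^{W_\Theta}$ has the weak Lefschetz property. -/

import Mathlib

open scoped NNReal

noncomputable section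

/-! ### Lefschetz properties of graded algebras -/

section Lefschetz

variable {A : Type*} [CommRing A] [Algebra ℝ A]

/-- `r` is the top degree of the graded algebra `A = ⨁ 𝒜 i`: `𝒜 r ≠ 0` and `𝒜 i = 0` for `i > r`. -/
def IsTopDegree (𝒜 : ℕ → Submodule ℝ A) (r : ℕ) : Prop :=
  𝒜 r ≠ ⊥ ∧ ∀ i, r < i → 𝒜 i = ⊥

/-- `l` is a (strong) Lefschetz element: with `r` the top degree, `l` has degree one and
`l ^ (r - 2 i) : 𝒜 i → 𝒜 (r - i)` is an isomorphism for `0 ≤ i ≤ ⌊r / 2⌋`. -/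
def IsLefschetzElement (𝒜 : ℕ → Submodule ℝ A) (l : A) : Prop :=
  ∃ r, IsTopDegree 𝒜 r ∧ l ∈ 𝒜 1 ∧
    ∀ i, i ≤ r / 2 → Set.BijOn (fun x => l ^ (r - 2 * i) * x) (𝒜 i) (𝒜 (r - i))

/-- The strong Lefschetz property: there is a Lefschetz element. -/
def HasStrongLefschetz (𝒜 : ℕ → Submodule ℝ A) : Prop :=
  ∃ l, IsLefschetzElement 𝒜 l

/-- The weak Lefschetz property with respect to `l`: with `r` the top degree, `l` has degree one and
multiplication by `l` is an injection `𝒜 i → 𝒜 (i + 1)` for `0 ≤ i < ⌊r / 2⌋`. -/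
def HasWeakLefschetz (𝒜 : ℕ → Submodule ℝ A) (l : A) : Prop :=
  ∃ r, IsTopDegree 𝒜 r ∧ l ∈ 𝒜 1 ∧
    ∀ i, i < r / 2 →
      Set.MapsTo (fun x => l * x) (𝒜 i) (𝒜 (i + 1)) ∧ Set.InjOn (fun x => l * x) (𝒜 i)

end Lefschetz

/-! ### Coinvariant rings -/

section Coinvariants

variable {V : Type*} [NormedAddCommGroup V] [InnerProductSpace ℝ V]

/-- The degree `i` part of `Sym(V)`: the span of the `i`-fold products of elements of `V`. -/
def symDeg (V : Type*) [NormedAddCommGroup V] [InnerProductSpace ℝ V] (i : ℕ) :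
    Submodule ℝ (SymmetricAlgebra ℝ V) :=
  LinearMap.range (SymmetricAlgebra.ι ℝ V) ^ i

/-- The action of an orthogonal transformation `w` on `Sym(V)` by algebra homomorphisms. -/
def symAct (w : V ≃ₗᵢ[ℝ] V) : SymmetricAlgebra ℝ V →ₐ[ℝ] SymmetricAlgebra ℝ V :=
  SymmetricAlgebra.lift (SymmetricAlgebra.ι ℝ V ∘ₗ w.toLinearEquiv.toLinearMap)

theorem symAct_ι (w : V ≃ₗᵢ[ℝ] V) (v : V) :
    symAct w (SymmetricAlgebra.ι ℝ V v) = SymmetricAlgebra.ι ℝ V (w v) := by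
  simp [symAct]

/-- The ideal of `Sym(V)` generated by the `G`-invariants of positive degree. -/
def coinvIdeal (G : Subgroup (V ≃ₗᵢ[ℝ] V)) : Ideal (SymmetricAlgebra ℝ V) :=
  Ideal.span {f | (∀ w ∈ G, symAct w f = f) ∧ ∃ i, 0 < i ∧ f ∈ symDeg V i}

/-- The coinvariant ring `S_G` of `G`. -/
abbrev CoinvRing (G : Subgroup (V ≃ₗᵢ[ℝ] V)) : Type _ :=
  SymmetricAlgebra ℝ V ⧸ coinvIdeal G

theorem coinvIdeal_le_comap (G : Subgroup (V ≃ₗᵢ[ℝ] V)) (w : G) :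
    coinvIdeal G ≤ (coinvIdeal G).comap (symAct (w : V ≃ₗᵢ[ℝ] V)) := by
  refine Ideal.span_le.2 fun f hf => ?_
  change symAct (w : V ≃ₗᵢ[ℝ] V) f ∈ coinvIdeal G
  rw [hf.1 w w.2]
  exact Ideal.subset_span hf

/-- The action of `G` on its coinvariant ring. -/
def coinvAct (G : Subgroup (V ≃ₗᵢ[ℝ] V)) (w : G) : CoinvRing G →ₐ[ℝ] CoinvRing G :=
  Ideal.quotientMapₐ (coinvIdeal G) (symAct (w : V ≃ₗᵢ[ℝ] V)) (coinvIdeal_le_comap G w)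

/-- For a subgroup `H` of `G`, the subring of `H`-invariants of the coinvariant ring of `G`. -/
def relCoinvRing (G H : Subgroup (V ≃ₗᵢ[ℝ] V)) : Subalgebra ℝ (CoinvRing G) where
  carrier := {x | ∀ w : G, (w : V ≃ₗᵢ[ℝ] V) ∈ H → coinvAct G w x = x}
  mul_mem' hx hy w hw := by rw [map_mul, hx w hw, hy w hw]
  add_mem' hx hy w hw := by rw [map_add, hx w hw, hy w hw]
  algebraMap_mem' c w _ := AlgHom.commutes _ c

/-- The degree `i` part of the ring of relative coinvariants: the elements of it that are the class
of a homogeneous polynomial of degree `i`. -/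
def relCoinvDeg (G H : Subgroup (V ≃ₗᵢ[ℝ] V)) (i : ℕ) : Submodule ℝ (relCoinvRing G H) :=
  ((symDeg V i).map (Ideal.Quotient.mkₐ ℝ (coinvIdeal G)).toLinearMap).comap
    (relCoinvRing G H).val.toLinearMap

end Coinvariants

/-! ### Root systems and finite reflection groups -/

variable {V : Type*} [NormedAddCommGroup V] [InnerProductSpace ℝ V]

/-- The orthogonal reflection `s_γ` that fixes the hyperplane orthogonal to `γ`. -/
def rootRefl (γ : V) : V ≃ₗᵢ[ℝ] V := (ℝ ∙ γ)ᗮ.reflection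

theorem rootRefl_apply (γ x : V) :
    rootRefl γ x = x - (2 * inner ℝ x γ / inner ℝ γ γ) • γ := by
  rw [rootRefl, Submodule.reflection_orthogonal_apply, Submodule.reflection_singleton_apply,
    real_inner_self_eq_norm_sq, real_inner_comm x γ, mul_div_assoc, mul_smul, ← ofNat_smul_eq_nsmul ℝ]
  simp

/-- A finite reduced (not necessarily crystallographic, not necessarily spanning) root system
in `V`, together with a simple system `Δ`: a linearly independent set of roots such that each root
or its negative is a combination of `Δ` with nonnegative real coefficients. -/
structure BasedRootSystem (V : Type*) [NormedAddCommGroup V] [InnerProductSpace ℝ V] where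
  roots : Set V
  simple : Set V
  finite_roots : roots.Finite
  zero_notMem : (0 : V) ∉ roots
  rootRefl_mem : ∀ α ∈ roots, ∀ β ∈ roots, rootRefl α β ∈ roots
  reduced : ∀ α ∈ roots, ∀ c : ℝ, c • α ∈ roots → c = 1 ∨ c = -1
  simple_subset : simple ⊆ roots
  linearIndepOn_simple : LinearIndepOn ℝ id simple
  pos_or_neg : ∀ β ∈ roots,
    β ∈ Submodule.span ℝ≥0 simple ∨ -β ∈ Submodule.span ℝ≥0 simple

/-- The group generated by the reflections in the elements of a set of vectors. -/
def reflGroup (X : Set V) : Subgroup (V ≃ₗᵢ[ℝ] V) :=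
  Subgroup.closure (rootRefl '' X)

/-- A set `Θ` of simple roots has type `M`, for a Coxeter matrix `M`, if it can be indexed
such that the product of the reflections `s_i` and `s_j` has order `M i j`. -/
def HasCoxeterType {B : Type*} (M : CoxeterMatrix B) (Θ : Set V) : Prop :=
  ∃ e : B ≃ Θ, ∀ i j, orderOf (rootRefl (e i : V) * rootRefl (e j : V)) = M i j

namespace BasedRootSystem

variable (R : BasedRootSystem V)

/-- The finite reflection group `W`. -/
def group : Subgroup (V ≃ₗᵢ[ℝ] V) := reflGroup R.roots

/-- The positive roots. -/
def posRoots : Set V := {β ∈ R.roots | β ∈ Submodule.span ℝ≥0 R.simple}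

/-- For a set `Θ` of simple roots, the positive roots of `R` that are not roots of the
root system `Φ ∩ span Θ` of the parabolic subgroup `W_Θ`. -/
def relPosRoots (Θ : Set V) : Set V := {β ∈ R.posRoots | β ∉ Submodule.span ℝ Θ}

/-- Half the sum of the positive roots of `R` that are not roots of `W_Θ`, a vector of `V`. -/
def relRhoVec (Θ : Set V) : V := (1 / 2 : ℝ) • ∑ᶠ γ ∈ R.relPosRoots Θ, γ

theorem exists_coord {δ : V} (hδ : δ ∈ R.simple) :
    ∃ φ : V →ₗ[ℝ] ℝ, φ δ = 1 ∧ ∀ ε ∈ R.simple, ε ≠ δ → φ ε = 0 := by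
  have hli : LinearIndependent ℝ (fun x : R.simple => (x : V)) := R.linearIndepOn_simple
  let b := Module.Basis.span hli
  obtain ⟨φ, hφ⟩ := (b.coord ⟨δ, hδ⟩).exists_extend
  have key : ∀ ε (hε : ε ∈ R.simple), φ ε = b.coord ⟨δ, hδ⟩ (b ⟨ε, hε⟩) := fun ε hε => by
    rw [← hφ]
    simp [b, Module.Basis.span_apply]
  refine ⟨φ, ?_, fun ε hε hne => ?_⟩
  · simp [key δ hδ]
  · rw [key ε hε, Module.Basis.coord_apply, Module.Basis.repr_self]
    exact Finsupp.single_eq_of_ne fun h => hne (congrArg Subtype.val h).symm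

theorem coord_nonneg {δ : V} {φ : V →ₗ[ℝ] ℝ} (h1 : φ δ = 1)
    (h0 : ∀ ε ∈ R.simple, ε ≠ δ → φ ε = 0) {x : V} (hx : x ∈ Submodule.span ℝ≥0 R.simple) :
    0 ≤ φ x := by
  induction hx using Submodule.span_induction with
  | mem x hx =>
    by_cases h : x = δ
    · rw [h, h1]; exact zero_le_one
    · rw [h0 x hx h]
  | zero => simp
  | add x y _ _ hx hy => rw [map_add]; exact add_nonneg hx hy
  | smul c x _ hx =>
    rw [NNReal.smul_def, map_smul]
    exact mul_nonneg c.2 hx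

/-- If a sum of two nonnegative combinations of simple roots lies in the span of `Θ`,
so does each summand. -/
theorem mem_span_of_add {Θ : Set V} (hΘ : Θ ⊆ R.simple) {x y : V}
    (hx : x ∈ Submodule.span ℝ≥0 R.simple) (hy : y ∈ Submodule.span ℝ≥0 R.simple)
    (hxy : x + y ∈ Submodule.span ℝ Θ) : x ∈ Submodule.span ℝ Θ := by
  have key : ∀ δ ∈ R.simple, δ ∉ Θ → ∀ φ : V →ₗ[ℝ] ℝ, φ δ = 1 →
      (∀ ε ∈ R.simple, ε ≠ δ → φ ε = 0) → φ x = 0 := by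
    intro δ _ hδΘ φ h1 h0
    have hz : φ (x + y) = 0 := by
      have : Submodule.span ℝ Θ ≤ LinearMap.ker φ :=
        Submodule.span_le.2 fun ε hε => h0 ε (hΘ hε) (fun h => hδΘ (h ▸ hε))
      exact this hxy
    have := R.coord_nonneg h1 h0 hx
    have := R.coord_nonneg h1 h0 hy
    rw [map_add] at hz
    linarith
  clear hxy hy
  induction hx using Submodule.span_induction with
  | mem x hx =>
    by_contra hc
    have hxΘ : x ∉ Θ := fun h => hc (Submodule.subset_span h)
    obtain ⟨φ, h1, h0⟩ := R.exists_coord hx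
    have := key x hx hxΘ φ h1 h0
    rw [h1] at this
    exact one_ne_zero this
  | zero => exact Submodule.zero_mem _
  | add a b ha hb iha ihb =>
    refine Submodule.add_mem _ (iha ?_) (ihb ?_) <;>
    · intro δ hδ hδΘ φ h1 h0
      have h := key δ hδ hδΘ φ h1 h0
      have := R.coord_nonneg h1 h0 ha
      have := R.coord_nonneg h1 h0 hb
      rw [map_add] at h
      linarith
  | smul c a ha iha =>
    rw [NNReal.smul_def]
    by_cases hc : (c : ℝ) = 0
    · rw [hc, zero_smul]; exact Submodule.zero_mem _
    · refine Submodule.smul_mem _ _ (iha ?_)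
      intro δ hδ hδΘ φ h1 h0
      have h := key δ hδ hδΘ φ h1 h0
      rw [NNReal.smul_def, map_smul, smul_eq_mul] at h
      exact (mul_eq_zero.1 h).resolve_left hc

theorem rootRefl_mem_relPosRoots {Θ : Set V} (hΘ : Θ ⊆ R.simple) {α β : V} (hα : α ∈ Θ)
    (hβ : β ∈ R.relPosRoots Θ) : rootRefl α β ∈ R.relPosRoots Θ := by
  have hαs : α ∈ Submodule.span ℝ Θ := Submodule.subset_span hα
  have hroot := R.rootRefl_mem α (R.simple_subset (hΘ hα)) β hβ.1.1
  refine ⟨⟨hroot, (R.pos_or_neg _ hroot).resolve_right fun hneg => hβ.2 ?_⟩, fun h => hβ.2 ?_⟩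
  · refine R.mem_span_of_add hΘ hβ.1.2 hneg ?_
    rw [rootRefl_apply, neg_sub, add_sub_cancel]
    exact Submodule.smul_mem _ _ hαs
  · rw [rootRefl_apply] at h
    simpa using Submodule.add_mem _ h (Submodule.smul_mem _ (2 * inner ℝ β α / inner ℝ α α) hαs)

theorem rootRefl_relRhoVec {Θ : Set V} (hΘ : Θ ⊆ R.simple) {α : V} (hα : α ∈ Θ) :
    rootRefl α (R.relRhoVec Θ) = R.relRhoVec Θ := by
  have hfin : (R.relPosRoots Θ).Finite := R.finite_roots.subset fun x hx => hx.1.1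
  have hinv : ∀ x : V, rootRefl α (rootRefl α x) = x := fun x =>
    Submodule.reflection_reflection _ x
  rw [relRhoVec, map_smul]
  congr 1
  change (rootRefl α).toLinearEquiv.toAddMonoidHom _ = _
  rw [AddMonoidHom.map_finsum_mem _ _ hfin]
  refine finsum_mem_eq_of_bijOn (rootRefl α) ⟨fun x hx => R.rootRefl_mem_relPosRoots hΘ hα hx,
    (rootRefl α).injective.injOn, fun x hx => ⟨_, R.rootRefl_mem_relPosRoots hΘ hα hx, hinv x⟩⟩ ?_
  intro x _
  rfl

theorem apply_relRhoVec {Θ : Set V} (hΘ : Θ ⊆ R.simple) {w : V ≃ₗᵢ[ℝ] V}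
    (hw : w ∈ reflGroup Θ) : w (R.relRhoVec Θ) = R.relRhoVec Θ := by
  induction hw using Subgroup.closure_induction with
  | mem w hw =>
    obtain ⟨α, hα, rfl⟩ := hw
    exact R.rootRefl_relRhoVec hΘ hα
  | one => rfl
  | mul a b _ _ ha hb =>
    change a (b _) = _
    rw [hb, ha]
  | inv a _ ha =>
    conv_lhs => rw [← ha]
    exact a.symm_apply_apply _

/-- For a set `Θ` of simple roots, the ring `S_W^{W_Θ}` of relative coinvariants. -/
abbrev RelCoinv (Θ : Set V) : Subalgebra ℝ (CoinvRing R.group) :=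
  relCoinvRing R.group (reflGroup Θ)

/-- The grading of `S_W^{W_Θ}`. -/
abbrev relDeg (Θ : Set V) : ℕ → Submodule ℝ (R.RelCoinv Θ) :=
  relCoinvDeg R.group (reflGroup Θ)

/-- The class in `S_W^{W_Θ}` of half the sum of the positive roots that are not roots of `W_Θ`. -/
def relRho {Θ : Set V} (hΘ : Θ ⊆ R.simple) : R.RelCoinv Θ :=
  ⟨Ideal.Quotient.mk (coinvIdeal R.group) (SymmetricAlgebra.ι ℝ V (R.relRhoVec Θ)), fun w hw => by
    change Ideal.Quotient.mk _ (symAct (w : V ≃ₗᵢ[ℝ] V) _) = _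
    rw [symAct_ι, R.apply_relRhoVec hΘ hw]⟩

end BasedRootSystem

end

/-!
The ring `R = S_W^{W_Θ}` is identified with a space of functions on the roots, on which
multiplication by `ρ̄` is explicit enough for the middle degrees to be controlled by hand.

*The coinvariant ring.* For `w ∈ W` let `∂_w` be the composite of the divided differences
`∂_α f = (f - s_α f) / α` along a reduced word of `w`; it does not depend on the word
(`ddWord_eq_ite`). The functionals `f ↦ (∂_w f)(0)` kill the ideal of the invariants of positive
degree. They separate the homogeneous parts of the quotient (`mem_coinvIdeal_iff`) and are linearly
independent (`range_dualMap`), so they are coordinates on `S_W`, with `w` in degree the length of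
`w`. Multiplication by a linear form is given in these coordinates by the Chevalley formula
(`ddGroup_ι_mul`), a sum over the positive roots whose reflection shortens `w` by one.

*Functions on the roots.* In the two cases all roots have the same length and form one orbit `W θ`,
where `θ` is a dominant root whose stabilizer is `W_Θ` (`IsDominantRoot`). The `W_Θ`-invariants are
the elements whose coordinates vanish outside the minimal coset representatives of `W / W_Θ`, and
these correspond to the roots. Thus `R^i` is the space of functions on the roots of level `i`, the
level of `a` being the number of positive roots `γ` with `⟨a, γ⟩ < 0` (`relDegEquiv`). As `R^1` is
spanned by the class of `θ`, and `ρ̄` is a positive multiple of it, only this class matters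
(`IsDominantRoot.exists_eq_smul_relRho`, `IsDominantRoot.exists_relRhoVec_eq`).

*The middle degrees.* The levels of `a` and `-a` add up to a constant odd number `r = 2 m + 1`, and
the roots of level `m` are exactly the simple roots (`IsDominantRoot.exists_middle`). For the
pairing `∑ a, g a * h (-a)` multiplication by `ρ̄` is self-adjoint (`rootPair_mul_comm`), and the
quadratic form `x ↦ ⟨x, ρ̄ x⟩` on `R^m` is positive definite: it is at least a positive multiple of
`|∑ |x_α| α|²`, the sum running over the simple roots (`eq_zero_of_rootPair_nonpos`). Hence
`ρ̄ : R^m → R^{m+1}` is bijective without any hypothesis. If `ρ̄` is injective below degree `m` and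
`ρ̄^{r-2i} x = 0` with `x ∈ R^i`, then `y = ρ̄^{m-i} x` satisfies `⟨y, ρ̄ y⟩ = 0`, so that `y = 0` and
`x = 0`; since `R^i` and `R^{r-i}` have the same dimension, the weak Lefschetz property makes `ρ̄` a
Lefschetz element. The converse implications are formal.

*The types `E₈` and `H₄`.* The orders of the products of simple reflections determine the angles
between the simple roots, and, the diagrams being connected with odd labels on the edges, all
roots are conjugate (`hasCartanMatrix_cartanOf`). The root `θ` is reached from the simple roots by an
explicit chain of reflections, in coordinates over `ℤ`, or over `ℤ[φ]` with `φ` the golden ratio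
(`comb_highestE₈_mem`, `comb_dominantH₄_mem`). The diagrams `E₇` and `H₃` embed in `E₈` and `H₄` only
as the complement of one end vertex (`E₈_embedding`, `H₄_embedding`), and this is the vertex whose
simple root is not orthogonal to `θ`.
-/

noncomputable section

variable {V : Type*} [NormedAddCommGroup V] [InnerProductSpace ℝ V]

/-! ### Reflections -/

theorem rootRefl_self (γ : V) : rootRefl γ γ = -γ :=
  Submodule.reflection_orthogonalComplement_singleton_eq_neg γ

theorem rootRefl_rootRefl (γ x : V) : rootRefl γ (rootRefl γ x) = x :=
  Submodule.reflection_reflection _ x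

theorem rootRefl_mul_self (γ : V) : rootRefl γ * rootRefl γ = 1 := by
  ext x
  exact rootRefl_rootRefl γ x

theorem rootRefl_inv (γ : V) : (rootRefl γ)⁻¹ = rootRefl γ :=
  inv_eq_of_mul_eq_one_left (rootRefl_mul_self γ)

theorem inner_rootRefl (γ x y : V) : inner ℝ (rootRefl γ x) y = inner ℝ x (rootRefl γ y) := by
  rw [← (rootRefl γ).inner_map_map x (rootRefl γ y), rootRefl_rootRefl]

theorem rootRefl_map (w : V ≃ₗᵢ[ℝ] V) (γ : V) : rootRefl (w γ) = w * rootRefl γ * w⁻¹ := by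
  ext x
  obtain ⟨y, rfl⟩ := w.surjective x
  have : (w * rootRefl γ * w⁻¹) (w y) = w (rootRefl γ y) := by
    change w (rootRefl γ (w.symm (w y))) = _
    rw [w.symm_apply_apply]
  rw [this, rootRefl_apply, rootRefl_apply, map_sub, map_smul, w.inner_map_map, w.inner_map_map]

theorem rootRefl_neg (γ : V) : rootRefl (-γ) = rootRefl γ := by
  ext x
  simp only [rootRefl_apply, inner_neg_right, inner_neg_left, neg_neg, mul_neg, neg_div, neg_smul,
    smul_neg]

theorem rootRefl_eq_self {γ x : V} (h : inner ℝ x γ = 0) : rootRefl γ x = x := by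
  simp [rootRefl_apply, h]

/-- The product of the reflections in the members of a list of vectors. -/
def prodRefl (L : List V) : V ≃ₗᵢ[ℝ] V := (L.map rootRefl).prod

@[simp] theorem prodRefl_nil : prodRefl ([] : List V) = 1 := rfl

@[simp] theorem prodRefl_cons (α : V) (L : List V) :
    prodRefl (α :: L) = rootRefl α * prodRefl L := by simp [prodRefl]

@[simp] theorem prodRefl_append (L L' : List V) :
    prodRefl (L ++ L') = prodRefl L * prodRefl L' := by simp [prodRefl]

theorem exists_word {X : Set V} {w : V ≃ₗᵢ[ℝ] V} (hw : w ∈ reflGroup X) :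
    ∃ L : List V, (∀ α ∈ L, α ∈ X) ∧ prodRefl L = w := by
  induction hw using Subgroup.closure_induction with
  | mem w hw =>
    obtain ⟨α, hα, rfl⟩ := hw
    exact ⟨[α], by simpa using hα, by simp⟩
  | one => exact ⟨[], by simp, rfl⟩
  | mul a b _ _ ha hb =>
    obtain ⟨L, hL, rfl⟩ := ha
    obtain ⟨L', hL', rfl⟩ := hb
    refine ⟨L ++ L', fun α hα => ?_, by simp⟩
    rcases List.mem_append.1 hα with h | h
    exacts [hL _ h, hL' _ h]
  | inv a _ ha =>
    obtain ⟨L, hL, rfl⟩ := ha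
    refine ⟨L.reverse, fun α hα => hL α (by simpa using hα), ?_⟩
    simp [prodRefl, List.prod_inv_reverse, Function.comp_def, rootRefl_inv]

theorem prodRefl_mem {X : Set V} {L : List V} (hL : ∀ α ∈ L, α ∈ X) :
    prodRefl L ∈ reflGroup X := by
  refine Subgroup.list_prod_mem _ fun w hw => ?_
  obtain ⟨α, hα, rfl⟩ := List.mem_map.1 hw
  exact Subgroup.subset_closure ⟨α, hL α hα, rfl⟩

theorem rootRefl_mem_reflGroup {X : Set V} {α : V} (hα : α ∈ X) : rootRefl α ∈ reflGroup X :=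
  Subgroup.subset_closure ⟨α, hα, rfl⟩

namespace BasedRootSystem

variable {R : BasedRootSystem V}

/-! ### Positive roots -/

theorem ne_zero {β : V} (hβ : β ∈ R.roots) : β ≠ 0 := fun h => R.zero_notMem (h ▸ hβ)

theorem inner_self_pos {β : V} (hβ : β ∈ R.roots) : 0 < inner ℝ β β :=
  real_inner_self_pos.2 (ne_zero hβ)

theorem neg_mem_roots {β : V} (hβ : β ∈ R.roots) : -β ∈ R.roots :=
  rootRefl_self β ▸ R.rootRefl_mem β hβ β hβ

theorem simple_mem_posRoots {α : V} (hα : α ∈ R.simple) : α ∈ R.posRoots :=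
  ⟨R.simple_subset hα, Submodule.subset_span hα⟩

theorem mem_posRoots_or {β : V} (hβ : β ∈ R.roots) : β ∈ R.posRoots ∨ -β ∈ R.posRoots :=
  (R.pos_or_neg β hβ).imp (⟨hβ, ·⟩) (⟨neg_mem_roots hβ, ·⟩)

theorem neg_notMem_posRoots {β : V} (hβ : β ∈ R.posRoots) : -β ∉ R.posRoots := fun h => by
  have := R.mem_span_of_add (Θ := ∅) (Set.empty_subset _) hβ.2 h.2 (by simp)
  rw [Submodule.span_empty, Submodule.mem_bot] at this
  exact ne_zero hβ.1 this

theorem neg_mem_posRoots_iff {β : V} (hβ : β ∈ R.roots) : -β ∈ R.posRoots ↔ β ∉ R.posRoots :=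
  ⟨fun h h' => neg_notMem_posRoots h' h, fun h => (mem_posRoots_or hβ).resolve_left h⟩

/-- A simple reflection permutes the positive roots other than its own. -/
theorem rootRefl_mem_posRoots {α β : V} (hα : α ∈ R.simple) (hβ : β ∈ R.posRoots) (hne : β ≠ α) :
    rootRefl α β ∈ R.posRoots := by
  have hroot := R.rootRefl_mem α (R.simple_subset hα) β hβ.1
  by_contra h
  have hneg := (neg_mem_posRoots_iff hroot).2 h
  have hs : β ∈ Submodule.span ℝ {α} := by
    refine R.mem_span_of_add (Set.singleton_subset_iff.2 hα) hβ.2 hneg.2 ?_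
    rw [rootRefl_apply, neg_sub, add_sub_cancel]
    exact Submodule.smul_mem _ _ (Submodule.mem_span_singleton_self α)
  obtain ⟨c, rfl⟩ := Submodule.mem_span_singleton.1 hs
  rcases R.reduced α (R.simple_subset hα) c hβ.1 with rfl | rfl
  · exact hne (one_smul _ _)
  · rw [neg_one_smul] at hβ
    exact neg_notMem_posRoots (simple_mem_posRoots hα) hβ

variable (R) in
/-- The positive roots as a finite set. -/
def posFinset : Finset V := (R.finite_roots.subset fun _ h => h.1 : R.posRoots.Finite).toFinset

@[simp] theorem mem_posFinset {β : V} : β ∈ R.posFinset ↔ β ∈ R.posRoots := by simp [posFinset]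

theorem card_filter_rootRefl {α : V} (hα : α ∈ R.simple) (P : V → Prop) [DecidablePred P] :
    (R.posFinset.filter fun β => P (rootRefl α β)).card + (if P α then 1 else 0) =
      (R.posFinset.filter P).card + (if P (-α) then 1 else 0) := by
  classical
  have hmem : α ∈ R.posFinset := mem_posFinset.2 (simple_mem_posRoots hα)
  have key : ((R.posFinset.erase α).filter fun β => P (rootRefl α β)).card =
      ((R.posFinset.erase α).filter P).card := by
    have maps : ∀ β ∈ R.posFinset.erase α, rootRefl α β ∈ R.posFinset.erase α := by
      intro β hβ
      rw [Finset.mem_erase, mem_posFinset] at hβ ⊢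
      refine ⟨fun h => ?_, rootRefl_mem_posRoots hα hβ.2 hβ.1⟩
      have : β = -α := by rw [← rootRefl_rootRefl α β, h, rootRefl_self]
      exact neg_notMem_posRoots (simple_mem_posRoots hα) (this ▸ hβ.2)
    refine Finset.card_nbij' (rootRefl α) (rootRefl α) ?_ ?_ ?_ ?_
    · intro β hβ
      simp only [Finset.coe_filter, Set.mem_ofPred_eq] at hβ ⊢
      exact ⟨maps β hβ.1, hβ.2⟩
    · intro β hβ
      simp only [Finset.coe_filter, Set.mem_ofPred_eq] at hβ ⊢
      exact ⟨maps β hβ.1, by rw [rootRefl_rootRefl]; exact hβ.2⟩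
    · intro β _; exact rootRefl_rootRefl α β
    · intro β _; exact rootRefl_rootRefl α β
  rw [← Finset.insert_erase hmem, Finset.filter_insert, Finset.filter_insert, rootRefl_self]
  split_ifs <;> simp [key]

theorem exists_simple_inner_pos {β : V} (hβ : β ∈ R.posRoots) : ∃ α ∈ R.simple, 0 < inner ℝ β α := by
  by_contra! h
  have : ∀ x ∈ Submodule.span ℝ≥0 R.simple, inner ℝ β x ≤ 0 := by
    intro x hx
    induction hx using Submodule.span_induction with
    | mem x hx => exact h x hx
    | zero => simp
    | add x y _ _ hx hy => rw [inner_add_right]; linarith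
    | smul c x _ hx =>
      rw [NNReal.smul_def, inner_smul_right]
      exact mul_nonpos_of_nonneg_of_nonpos c.2 hx
  exact (inner_self_pos hβ.1).not_ge (this β hβ.2)

/-! ### Length of a group element and level of a vector -/

open Classical in
variable (R) in
/-- The length of `w`: the number of positive roots that `w` makes negative. -/
def len (w : V ≃ₗᵢ[ℝ] V) : ℕ := (R.posFinset.filter fun β => w β ∉ R.posRoots).card

open Classical in
variable (R) in
/-- The level of a vector: the number of positive roots having negative inner product with it.
It is zero on dominant vectors, and grows along an orbit away from its dominant member. -/
def lev (a : V) : ℕ := (R.posFinset.filter fun γ => inner ℝ a γ < 0).card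

open Classical in
theorem lev_rootRefl {α a : V} (hα : α ∈ R.simple) (h : 0 < inner ℝ a α) :
    R.lev (rootRefl α a) = R.lev a + 1 := by
  have := card_filter_rootRefl hα fun γ => inner ℝ a γ < 0
  simp only [inner_neg_right, h.not_gt, Left.neg_neg_iff, h, if_true, if_false, add_zero] at this
  simpa only [lev, inner_rootRefl] using this

theorem lev_le (a : V) : R.lev a ≤ R.posFinset.card := Finset.card_filter_le _ _

/-- Every positive root is lowered to a simple root by simple reflections, each of which raises
the level by one. -/
theorem posRoots_induction {P : V → Prop} (simple : ∀ α ∈ R.simple, P α)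
    (step : ∀ β ∈ R.posRoots, ∀ α ∈ R.simple, rootRefl α β ∈ R.posRoots →
      R.lev (rootRefl α β) = R.lev β + 1 → P (rootRefl α β) → P β) :
    ∀ β ∈ R.posRoots, P β := by
  suffices ∀ n β, β ∈ R.posRoots → R.posFinset.card - R.lev β = n → P β from
    fun β hβ => this _ β hβ rfl
  intro n
  induction n using Nat.strong_induction_on with
  | _ n ih =>
    intro β hβ hn
    obtain ⟨α, hα, hpos⟩ := exists_simple_inner_pos hβ
    by_cases hne : β = α
    · exact hne ▸ simple α hα
    · have hl := lev_rootRefl hα hpos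
      have hm := rootRefl_mem_posRoots hα hβ hne
      have := R.lev_le (rootRefl α β)
      exact step β hβ α hα hm hl (ih _ (by omega) _ hm rfl)

theorem exists_simple_conj {β : V} (hβ : β ∈ R.roots) :
    ∃ α ∈ R.simple, ∃ u ∈ reflGroup R.simple, u α = β := by
  have pos : ∀ β ∈ R.posRoots, ∃ α ∈ R.simple, ∃ u ∈ reflGroup R.simple, u α = β := by
    refine posRoots_induction (fun α hα => ⟨α, hα, 1, one_mem _, rfl⟩) ?_
    rintro β - α hα - - ⟨α', hα', u, hu, h⟩
    refine ⟨α', hα', rootRefl α * u, mul_mem (rootRefl_mem_reflGroup hα) hu, ?_⟩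
    change rootRefl α (u α') = β
    rw [h, rootRefl_rootRefl]
  rcases mem_posRoots_or hβ with h | h
  · exact pos β h
  · obtain ⟨α, hα, u, hu, h⟩ := pos _ h
    refine ⟨α, hα, u * rootRefl α, mul_mem hu (rootRefl_mem_reflGroup hα), ?_⟩
    change u (rootRefl α α) = β
    rw [rootRefl_self, map_neg, h, neg_neg]

variable (R) in
theorem group_eq : R.group = reflGroup R.simple := by
  refine le_antisymm ((Subgroup.closure_le _).2 ?_)
    (Subgroup.closure_mono (Set.image_mono R.simple_subset))
  rintro _ ⟨β, hβ, rfl⟩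
  obtain ⟨α, hα, u, hu, rfl⟩ := exists_simple_conj hβ
  rw [rootRefl_map]
  exact mul_mem (mul_mem hu (rootRefl_mem_reflGroup hα)) (inv_mem hu)

theorem rootRefl_mem_group {α : V} (hα : α ∈ R.simple) : rootRefl α ∈ R.group :=
  R.group_eq ▸ rootRefl_mem_reflGroup hα

theorem rootRefl_mem_group_of_mem_posRoots {β : V} (hβ : β ∈ R.posRoots) :
    rootRefl β ∈ R.group := rootRefl_mem_reflGroup hβ.1

theorem prodRefl_mem_group {L : List V} (hL : ∀ α ∈ L, α ∈ R.simple) : prodRefl L ∈ R.group :=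
  R.group_eq ▸ prodRefl_mem hL

theorem map_mem_roots {w : V ≃ₗᵢ[ℝ] V} (hw : w ∈ R.group) {β : V} (hβ : β ∈ R.roots) :
    w β ∈ R.roots := by
  obtain ⟨L, hL, rfl⟩ := exists_word hw
  clear hw
  induction L with
  | nil => exact hβ
  | cons α L ih =>
    rw [List.forall_mem_cons] at hL
    rw [prodRefl_cons]
    exact R.rootRefl_mem α hL.1 _ (ih hL.2)

open Classical in
theorem len_mul_rootRefl {w : V ≃ₗᵢ[ℝ] V} {α : V} (hα : α ∈ R.simple)
    (h : w α ∈ R.posRoots) : R.len (w * rootRefl α) = R.len w + 1 := by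
  have := card_filter_rootRefl hα fun β => w β ∉ R.posRoots
  rw [map_neg, if_neg (not_not.2 h), if_pos (neg_notMem_posRoots h),
    add_zero] at this
  exact this

theorem len_mul_rootRefl_of_notMem {w : V ≃ₗᵢ[ℝ] V} (hw : w ∈ R.group) {α : V}
    (hα : α ∈ R.simple) (h : w α ∉ R.posRoots) : R.len (w * rootRefl α) + 1 = R.len w := by
  rw [← len_mul_rootRefl hα, mul_assoc, rootRefl_mul_self,
    mul_one]
  change w (rootRefl α α) ∈ _
  rw [rootRefl_self, map_neg]
  exact (neg_mem_posRoots_iff (map_mem_roots hw (R.simple_subset hα))).2 h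

open Classical in
theorem len_eq_zero {w : V ≃ₗᵢ[ℝ] V} (h : ∀ β ∈ R.posRoots, w β ∈ R.posRoots) : R.len w = 0 :=
  Finset.card_eq_zero.2 (Finset.filter_eq_empty_iff.2 fun β hβ =>
    not_not.2 (h β (mem_posFinset.1 hβ)))

theorem len_one : R.len 1 = 0 := len_eq_zero fun _ h => h

theorem len_inv {w : V ≃ₗᵢ[ℝ] V} (hw : w ∈ R.group) : R.len w⁻¹ = R.len w := by
  have key : ∀ u : V ≃ₗᵢ[ℝ] V, u ∈ R.group → ∀ β ∈ R.posRoots, u β ∉ R.posRoots →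
      -(u β) ∈ R.posRoots ∧ u⁻¹ (-(u β)) ∉ R.posRoots := by
    intro u hu β hβ hn
    refine ⟨(neg_mem_posRoots_iff (map_mem_roots hu hβ.1)).2 hn, ?_⟩
    rw [map_neg]
    change -(u.symm (u β)) ∉ _
    rw [u.symm_apply_apply]
    exact neg_notMem_posRoots hβ
  refine Finset.card_nbij' (fun β => -(w⁻¹ β)) (fun β => -(w β)) ?_ ?_ ?_ ?_
  · intro β hβ
    simp only [Finset.coe_filter, Set.mem_ofPred_eq, mem_posFinset] at hβ ⊢
    simpa using key w⁻¹ (inv_mem hw) β hβ.1 hβ.2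
  · intro β hβ
    simp only [Finset.coe_filter, Set.mem_ofPred_eq, mem_posFinset] at hβ ⊢
    exact key w hw β hβ.1 hβ.2
  · intro β _
    change -(w (-(w.symm β))) = β
    simp
  · intro β _
    change -(w.symm (-(w β))) = β
    simp

/-- The exchange condition: if the product of a word makes the positive root `β` negative, then
multiplying it by `s_β` deletes a letter. -/
theorem exchange {L : List V} (hL : ∀ α ∈ L, α ∈ R.simple) {β : V} (hβ : β ∈ R.posRoots)
    (h : prodRefl L β ∉ R.posRoots) :
    ∃ L' : List V, (∀ α ∈ L', α ∈ R.simple) ∧ L'.length + 1 = L.length ∧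
      prodRefl L' = prodRefl L * rootRefl β := by
  induction L with
  | nil => exact absurd hβ h
  | cons α L ih =>
    rw [List.forall_mem_cons] at hL
    by_cases hb : prodRefl L β ∈ R.posRoots
    · have : prodRefl L β = α := by
        by_contra hne
        exact h (by rw [prodRefl_cons]; exact rootRefl_mem_posRoots hL.1 hb hne)
      refine ⟨L, hL.2, rfl, ?_⟩
      rw [prodRefl_cons, ← this, rootRefl_map]
      simp [mul_assoc, rootRefl_mul_self]
    · obtain ⟨L', h1, h2, h3⟩ := ih hL.2 hb
      exact ⟨α :: L', List.forall_mem_cons.2 ⟨hL.1, h1⟩, by simp [h2],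
        by rw [prodRefl_cons, prodRefl_cons, h3, mul_assoc]⟩

theorem eq_one_of_len_eq_zero {w : V ≃ₗᵢ[ℝ] V} (hw : w ∈ R.group) (h : R.len w = 0) : w = 1 := by
  rw [group_eq] at hw
  obtain ⟨L, hL, rfl⟩ := exists_word hw
  clear hw
  suffices ∀ n, ∀ L : List V, L.length = n → (∀ α ∈ L, α ∈ R.simple) → R.len (prodRefl L) = 0 →
      prodRefl L = 1 from this _ L rfl hL h
  intro n
  induction n using Nat.strong_induction_on with
  | _ n ih =>
    intro L hn hL h
    rcases List.eq_nil_or_concat L with rfl | ⟨L', α, rfl⟩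
    · rfl
    · have hL' : ∀ β ∈ L', β ∈ R.simple := fun β hβ => hL β (by simp [hβ])
      have hα : α ∈ R.simple := hL α (by simp)
      simp only [List.concat_eq_append, prodRefl_append, prodRefl_cons, prodRefl_nil, mul_one,
        List.length_append, List.length_cons, List.length_nil] at h hn ⊢
      by_cases hp : prodRefl L' α ∈ R.posRoots
      · rw [len_mul_rootRefl hα hp] at h
        omega
      · obtain ⟨L'', h1, h2, h3⟩ := exchange hL' (simple_mem_posRoots hα) hp
        rw [← h3] at h ⊢
        exact ih _ (by omega) L'' rfl h1 h

theorem exists_simple_notMem {w : V ≃ₗᵢ[ℝ] V} (hw : w ∈ R.group) (h : R.len w ≠ 0) :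
    ∃ α ∈ R.simple, w α ∉ R.posRoots := by
  by_contra! hc
  have : ∀ x ∈ Submodule.span ℝ≥0 R.simple, w x ∈ Submodule.span ℝ≥0 R.simple := by
    intro x hx
    induction hx using Submodule.span_induction with
    | mem x hx => exact (hc x hx).2
    | zero => simp
    | add x y _ _ hx hy => rw [map_add]; exact add_mem hx hy
    | smul c x _ hx =>
      rw [NNReal.smul_def, map_smul, ← NNReal.smul_def]
      exact Submodule.smul_mem _ c hx
  exact h (len_eq_zero fun β hβ => ⟨map_mem_roots hw hβ.1, this β hβ.2⟩)

/-- Multiplying on the left by a simple reflection adds a letter, unless it undoes a descent. -/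
theorem len_rootRefl_mul {w : V ≃ₗᵢ[ℝ] V} (hw : w ∈ R.group) {α : V} (hα : α ∈ R.simple)
    (h : w⁻¹ α ∈ R.posRoots) : R.len (rootRefl α * w) = R.len w + 1 := by
  rw [← len_inv (mul_mem (rootRefl_mem_group hα) hw), mul_inv_rev, rootRefl_inv,
    len_mul_rootRefl hα h, len_inv hw]

theorem len_rootRefl_mul_of_notMem {w : V ≃ₗᵢ[ℝ] V} (hw : w ∈ R.group) {α : V}
    (hα : α ∈ R.simple) (h : w⁻¹ α ∉ R.posRoots) : R.len (rootRefl α * w) + 1 = R.len w := by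
  rw [← len_inv (mul_mem (rootRefl_mem_group hα) hw), mul_inv_rev, rootRefl_inv,
    len_mul_rootRefl_of_notMem (inv_mem hw) hα h, len_inv hw]

variable (R) in
/-- A reduced word: a list of simple roots as short as the length of its product allows. -/
def IsReduced (L : List V) : Prop :=
  (∀ α ∈ L, α ∈ R.simple) ∧ R.len (prodRefl L) = L.length

theorem exists_reduced {w : V ≃ₗᵢ[ℝ] V} (hw : w ∈ R.group) :
    ∃ L : List V, R.IsReduced L ∧ prodRefl L = w := by
  generalize hn : R.len w = n
  induction n generalizing w with
  | zero =>
    refine ⟨[], ⟨by simp, ?_⟩, (eq_one_of_len_eq_zero hw hn).symm⟩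
    rw [prodRefl_nil, len_one]; rfl
  | succ n ih =>
    obtain ⟨α, hα, hneg⟩ := exists_simple_notMem hw (by omega)
    have hl := len_mul_rootRefl_of_notMem hw hα hneg
    obtain ⟨L, ⟨hL, hlen⟩, h⟩ := ih (mul_mem hw (rootRefl_mem_group hα)) (by omega)
    have hp : prodRefl (L ++ [α]) = w := by simp [h, mul_assoc, rootRefl_mul_self]
    refine ⟨L ++ [α], ⟨?_, ?_⟩, hp⟩
    · intro β hβ
      rcases List.mem_append.1 hβ with hβ | hβ
      · exact hL β hβ
      · rw [List.mem_singleton.1 hβ]; exact hα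
    · rw [hp, hn, List.length_append, ← hlen, h, List.length_singleton]; omega

theorem len_prodRefl_le {L : List V} (hL : ∀ α ∈ L, α ∈ R.simple) :
    R.len (prodRefl L) ≤ L.length := by
  induction L using List.reverseRecOn with
  | nil => simp [len_one]
  | append_singleton L α ih =>
    have hL' : ∀ β ∈ L, β ∈ R.simple := fun β hβ => hL β (by simp [hβ])
    have hα : α ∈ R.simple := hL α (by simp)
    have := ih hL'
    simp only [prodRefl_append, prodRefl_cons, prodRefl_nil, mul_one, List.length_append,
      List.length_singleton]
    by_cases hp : prodRefl L α ∈ R.posRoots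
    · rw [len_mul_rootRefl hα hp]; omega
    · have := len_mul_rootRefl_of_notMem (prodRefl_mem_group hL') hα hp; omega

theorem len_mul_rootRefl_lt {w : V ≃ₗᵢ[ℝ] V} (hw : w ∈ R.group) {β : V} (hβ : β ∈ R.posRoots)
    (h : w β ∉ R.posRoots) : R.len (w * rootRefl β) < R.len w := by
  obtain ⟨L, ⟨hL, hlen⟩, rfl⟩ := exists_reduced hw
  obtain ⟨L', h1, h2, h3⟩ := exchange hL hβ h
  rw [← h3]
  have := len_prodRefl_le h1
  omega

theorem isReduced_tail {α : V} {L : List V} (h : R.IsReduced (α :: L)) : R.IsReduced L := by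
  have hL := List.forall_mem_cons.1 h.1
  refine ⟨hL.2, le_antisymm (len_prodRefl_le hL.2) ?_⟩
  have hL' := prodRefl_mem_group hL.2
  have h2 := h.2
  rw [prodRefl_cons, List.length_cons] at h2
  by_cases hp : (prodRefl L)⁻¹ α ∈ R.posRoots
  · have := len_rootRefl_mul hL' hL.1 hp; omega
  · have := len_rootRefl_mul_of_notMem hL' hL.1 hp; omega

/-- In a reduced word, each letter, moved past the letters to its right, gives a positive root. -/
theorem inv_mem_posRoots_of_isReduced {α : V} {L : List V} (h : R.IsReduced (α :: L)) :
    (prodRefl L)⁻¹ α ∈ R.posRoots := by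
  have hL := List.forall_mem_cons.1 h.1
  have h2 := h.2
  rw [prodRefl_cons, List.length_cons, ← (isReduced_tail h).2] at h2
  by_contra hp
  have := len_rootRefl_mul_of_notMem (prodRefl_mem_group hL.2) hL.1 hp
  omega

theorem eq_one_of_fix_roots {w : V ≃ₗᵢ[ℝ] V} (hw : w ∈ R.group) (h : ∀ β ∈ R.roots, w β = β) :
    w = 1 :=
  eq_one_of_len_eq_zero hw (len_eq_zero fun β hβ => (h β hβ.1).symm ▸ hβ)

instance finite_group : Finite R.group := by
  have : Finite R.roots := R.finite_roots
  refine Finite.of_injective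
    (fun (w : R.group) (β : R.roots) => (⟨(w : V ≃ₗᵢ[ℝ] V) β, map_mem_roots w.2 β.2⟩ : R.roots)) ?_
  intro w u h
  have key : ((u⁻¹ * w : R.group) : V ≃ₗᵢ[ℝ] V) = 1 := by
    refine eq_one_of_fix_roots (u⁻¹ * w).2 fun β hβ => ?_
    have := congrArg Subtype.val (congrFun h ⟨β, hβ⟩)
    change (u : V ≃ₗᵢ[ℝ] V).symm ((w : V ≃ₗᵢ[ℝ] V) β) = β
    rw [LinearIsometryEquiv.symm_apply_eq]
    exact this
  exact (inv_mul_eq_one.1 (Subtype.ext key)).symm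

end BasedRootSystem

/-! ### The symmetric algebra -/

open SymmetricAlgebra in
theorem symAct_mul (u w : V ≃ₗᵢ[ℝ] V) (f : SymmetricAlgebra ℝ V) :
    symAct (u * w) f = symAct u (symAct w f) := by
  have : symAct (u * w) = (symAct u).comp (symAct w) := by
    apply algHom_ext
    ext v
    change symAct (u * w) (ι ℝ V v) = symAct u (symAct w (ι ℝ V v))
    rw [symAct_ι, symAct_ι, symAct_ι]
    rfl
  rw [this]
  rfl

theorem symAct_one (f : SymmetricAlgebra ℝ V) : symAct (1 : V ≃ₗᵢ[ℝ] V) f = f := by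
  have : symAct (1 : V ≃ₗᵢ[ℝ] V) = AlgHom.id ℝ _ := by
    apply SymmetricAlgebra.algHom_ext
    ext v
    exact symAct_ι 1 v
  rw [this]
  rfl

theorem mem_symDeg_zero {f : SymmetricAlgebra ℝ V} :
    f ∈ symDeg V 0 ↔ ∃ c : ℝ, algebraMap ℝ _ c = f := by
  rw [symDeg, pow_zero, Submodule.mem_one]

theorem ι_mem_symDeg (v : V) : SymmetricAlgebra.ι ℝ V v ∈ symDeg V 1 := by
  rw [symDeg, pow_one]
  exact ⟨v, rfl⟩

theorem mul_mem_symDeg {m n : ℕ} {f g : SymmetricAlgebra ℝ V} (hf : f ∈ symDeg V m)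
    (hg : g ∈ symDeg V n) : f * g ∈ symDeg V (m + n) := by
  rw [symDeg, pow_add]
  exact Submodule.mul_mem_mul hf hg

@[elab_as_elim]
theorem symDeg_succ_induction {n : ℕ} {P : SymmetricAlgebra ℝ V → Prop} {f : SymmetricAlgebra ℝ V}
    (hf : f ∈ symDeg V (n + 1)) (mul : ∀ v, ∀ g ∈ symDeg V n, P (SymmetricAlgebra.ι ℝ V v * g))
    (add : ∀ f g, P f → P g → P (f + g)) : P f := by
  rw [symDeg, pow_succ'] at hf
  refine Submodule.mul_induction_on hf ?_ add
  rintro _ ⟨v, rfl⟩ g hg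
  exact mul v g hg

theorem symAct_mem_symDeg (w : V ≃ₗᵢ[ℝ] V) {n : ℕ} {f : SymmetricAlgebra ℝ V}
    (hf : f ∈ symDeg V n) : symAct w f ∈ symDeg V n := by
  induction n generalizing f with
  | zero =>
    obtain ⟨c, rfl⟩ := mem_symDeg_zero.1 hf
    rw [AlgHom.commutes]
    exact hf
  | succ n ih =>
    refine symDeg_succ_induction hf (fun v g hg => ?_) (fun f g hf hg => ?_)
    · rw [map_mul, symAct_ι, add_comm]
      exact mul_mem_symDeg (ι_mem_symDeg _) (ih hg)
    · rw [map_add]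
      exact add_mem hf hg

variable (V) in
theorem iSup_symDeg : ⨆ n, symDeg V n = ⊤ := by
  rw [eq_top_iff]
  rintro f -
  have hmul : ∀ f ∈ ⨆ n, symDeg V n, ∀ g ∈ ⨆ n, symDeg V n, f * g ∈ ⨆ n, symDeg V n := by
    intro f hf g hg
    have := Submodule.mul_mem_mul hf hg
    rw [Submodule.iSup_mul] at this
    simp_rw [Submodule.mul_iSup] at this
    refine (iSup_le fun m => iSup_le fun n => ?_ : _ ≤ ⨆ n, symDeg V n) this
    rw [symDeg, symDeg, ← pow_add]
    exact le_iSup (symDeg V) (m + n)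
  induction f using SymmetricAlgebra.induction with
  | algebraMap r => exact Submodule.mem_iSup_of_mem 0 (mem_symDeg_zero.2 ⟨r, rfl⟩)
  | ι v => exact Submodule.mem_iSup_of_mem 1 (ι_mem_symDeg v)
  | mul f g hf hg => exact hmul f hf g hg
  | add f g hf hg => exact add_mem hf hg

theorem ι_ne_zero {v : V} (hv : v ≠ 0) : SymmetricAlgebra.ι ℝ V v ≠ 0 := by
  intro h
  have : SymmetricAlgebra.lift (innerₗ V v) (SymmetricAlgebra.ι ℝ V v) = inner ℝ v v := by simp
  rw [h, map_zero] at this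
  exact hv (inner_self_eq_zero.1 this.symm)

/-- The constant term of an element of `Sym(V)`. -/
abbrev constTerm : SymmetricAlgebra ℝ V →ₐ[ℝ] ℝ := SymmetricAlgebra.algebraMapInv

theorem constTerm_of_mem {n : ℕ} {f : SymmetricAlgebra ℝ V} (hn : n ≠ 0) (hf : f ∈ symDeg V n) :
    constTerm f = 0 := by
  obtain ⟨n, rfl⟩ := Nat.exists_eq_succ_of_ne_zero hn
  refine symDeg_succ_induction hf (fun v g hg => ?_) (fun f g hf hg => ?_)
  · rw [map_mul, SymmetricAlgebra.algebraMapInv_ι, zero_mul]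
  · rw [map_add, hf, hg, add_zero]

/-! ### Divided differences -/

/-- The pairing `⟨v, γ^∨⟩` of a vector with the coroot of `γ`. -/
def coPair (v γ : V) : ℝ := 2 * inner ℝ v γ / inner ℝ γ γ

theorem coPair_map (w : V ≃ₗᵢ[ℝ] V) (v γ : V) : coPair (w v) (w γ) = coPair v γ := by
  simp [coPair]

theorem exists_dd (γ : V) (f : SymmetricAlgebra ℝ V) :
    ∃ g, SymmetricAlgebra.ι ℝ V γ * g = f - symAct (rootRefl γ) f := by
  induction f using SymmetricAlgebra.induction with
  | algebraMap r => exact ⟨0, by simp⟩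
  | ι v =>
    refine ⟨algebraMap ℝ _ (coPair v γ), ?_⟩
    rw [symAct_ι, ← map_sub, rootRefl_apply, sub_sub_cancel, map_smul, mul_comm, Algebra.smul_def,
      coPair]
  | mul f g hf hg =>
    obtain ⟨f', hf'⟩ := hf
    obtain ⟨g', hg'⟩ := hg
    refine ⟨f' * g + symAct (rootRefl γ) f * g', ?_⟩
    rw [map_mul]
    linear_combination g * hf' + symAct (rootRefl γ) f * hg'
  | add f g hf hg =>
    obtain ⟨f', hf'⟩ := hf
    obtain ⟨g', hg'⟩ := hg
    exact ⟨f' + g', by rw [map_add]; linear_combination hf' + hg'⟩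

open Classical in
/-- The divided difference operator `f ↦ (f - s_γ f) / γ` on `Sym(V)`; it is zero when `γ = 0`. -/
def dd (γ : V) : SymmetricAlgebra ℝ V →ₗ[ℝ] SymmetricAlgebra ℝ V :=
  if h : γ = 0 then 0 else
  { toFun := fun f => (exists_dd γ f).choose
    map_add' := fun f g => by
      refine mul_left_cancel₀ (ι_ne_zero h) ?_
      rw [mul_add, (exists_dd γ _).choose_spec, (exists_dd γ _).choose_spec,
        (exists_dd γ _).choose_spec, map_add]
      ring
    map_smul' := fun c f => by
      refine mul_left_cancel₀ (ι_ne_zero h) ?_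
      rw [RingHom.id_apply, mul_smul_comm, (exists_dd γ _).choose_spec,
        (exists_dd γ _).choose_spec, map_smul, smul_sub] }

theorem ι_mul_dd (γ : V) (f : SymmetricAlgebra ℝ V) :
    SymmetricAlgebra.ι ℝ V γ * dd γ f = f - symAct (rootRefl γ) f := by
  by_cases h : γ = 0
  · have : rootRefl (0 : V) = 1 := by
      ext x
      simp [rootRefl_apply]
    rw [h, this, symAct_one]
    simp
  · rw [dd, dif_neg h]
    exact (exists_dd γ f).choose_spec

theorem dd_eq {γ : V} (h : γ ≠ 0) {f g : SymmetricAlgebra ℝ V}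
    (hg : SymmetricAlgebra.ι ℝ V γ * g = f - symAct (rootRefl γ) f) : dd γ f = g :=
  mul_left_cancel₀ (ι_ne_zero h) ((ι_mul_dd γ f).trans hg.symm)

/-- The twisted Leibniz rule. -/
theorem dd_mul {γ : V} (h : γ ≠ 0) (f g : SymmetricAlgebra ℝ V) :
    dd γ (f * g) = dd γ f * g + symAct (rootRefl γ) f * dd γ g := by
  refine dd_eq h ?_
  rw [map_mul]
  linear_combination g * ι_mul_dd γ f + symAct (rootRefl γ) f * ι_mul_dd γ g

theorem dd_algebraMap {γ : V} (h : γ ≠ 0) (c : ℝ) : dd γ (algebraMap ℝ _ c) = 0 :=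
  dd_eq h (by simp)

theorem dd_ι {γ : V} (h : γ ≠ 0) (v : V) :
    dd γ (SymmetricAlgebra.ι ℝ V v) = algebraMap ℝ _ (coPair v γ) := by
  refine dd_eq h ?_
  rw [symAct_ι, ← map_sub, rootRefl_apply, sub_sub_cancel, map_smul, mul_comm, Algebra.smul_def,
    coPair]

theorem dd_ι_mul {γ : V} (h : γ ≠ 0) (v : V) (f : SymmetricAlgebra ℝ V) :
    dd γ (SymmetricAlgebra.ι ℝ V v * f) =
      SymmetricAlgebra.ι ℝ V (rootRefl γ v) * dd γ f + coPair v γ • f := by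
  rw [dd_mul h, dd_ι h, symAct_ι, Algebra.smul_def, add_comm]

theorem dd_symAct {γ : V} (h : γ ≠ 0) (f : SymmetricAlgebra ℝ V) :
    dd γ (symAct (rootRefl γ) f) = -dd γ f := by
  refine dd_eq h ?_
  rw [← symAct_mul, rootRefl_mul_self, symAct_one]
  linear_combination -ι_mul_dd γ f

theorem dd_dd {γ : V} (h : γ ≠ 0) (f : SymmetricAlgebra ℝ V) : dd γ (dd γ f) = 0 := by
  have : symAct (rootRefl γ) (dd γ f) = dd γ f := by
    refine mul_left_cancel₀ (ι_ne_zero h) ?_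
    have := congrArg (symAct (rootRefl γ)) (ι_mul_dd γ f)
    rw [map_mul, symAct_ι, rootRefl_self, map_sub, ← symAct_mul, rootRefl_mul_self, symAct_one,
      map_neg] at this
    linear_combination -this - ι_mul_dd γ f
  refine dd_eq h ?_
  rw [this, mul_zero, sub_self]

theorem dd_mem_symDeg {γ : V} (h : γ ≠ 0) {n : ℕ} {f : SymmetricAlgebra ℝ V}
    (hf : f ∈ symDeg V (n + 1)) : dd γ f ∈ symDeg V n := by
  induction n generalizing f with
  | zero =>
    refine symDeg_succ_induction hf (fun v g hg => ?_) (fun f g hf hg => ?_)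
    · obtain ⟨c, rfl⟩ := mem_symDeg_zero.1 hg
      rw [dd_ι_mul h, dd_algebraMap h, mul_zero, zero_add]
      exact Submodule.smul_mem _ _ hg
    · rw [map_add]
      exact add_mem hf hg
  | succ n ih =>
    refine symDeg_succ_induction hf (fun v g hg => ?_) (fun f g hf hg => ?_)
    · rw [dd_ι_mul h]
      refine add_mem ?_ (Submodule.smul_mem _ _ hg)
      rw [add_comm]
      exact mul_mem_symDeg (ι_mem_symDeg _) (ih hg)
    · rw [map_add]
      exact add_mem hf hg

/-- The composite of the divided differences along a word. -/
def ddWord : List V → SymmetricAlgebra ℝ V →ₗ[ℝ] SymmetricAlgebra ℝ V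
  | [] => LinearMap.id
  | α :: L => dd α ∘ₗ ddWord L

@[simp] theorem ddWord_nil (f : SymmetricAlgebra ℝ V) : ddWord [] f = f := rfl

@[simp] theorem ddWord_cons (α : V) (L : List V) (f : SymmetricAlgebra ℝ V) :
    ddWord (α :: L) f = dd α (ddWord L f) := rfl

@[simp] theorem ddWord_append (L L' : List V) (f : SymmetricAlgebra ℝ V) :
    ddWord (L ++ L') f = ddWord L (ddWord L' f) := by
  induction L with
  | nil => rfl
  | cons α L ih => rw [List.cons_append, ddWord_cons, ih, ddWord_cons]

theorem ddWord_of_mem {L : List V} (hL : ∀ α ∈ L, α ≠ 0) {n : ℕ} {f : SymmetricAlgebra ℝ V}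
    (hf : f ∈ symDeg V n) :
    (n < L.length → ddWord L f = 0) ∧ (L.length ≤ n → ddWord L f ∈ symDeg V (n - L.length)) := by
  induction L with
  | nil => simpa using hf
  | cons α L ih =>
    rw [List.forall_mem_cons] at hL
    obtain ⟨ih1, ih2⟩ := ih hL.2
    rw [List.length_cons, ddWord_cons]
    refine ⟨fun h => ?_, fun h => dd_mem_symDeg hL.1 ?_⟩
    · rcases (Nat.lt_succ_iff.1 h).lt_or_eq with h | rfl
      · rw [ih1 h, map_zero]
      · have := ih2 le_rfl
        rw [Nat.sub_self] at this
        obtain ⟨c, hc⟩ := mem_symDeg_zero.1 this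
        rw [← hc, dd_algebraMap hL.1]
    · rw [show n - (L.length + 1) + 1 = n - L.length by omega]
      exact ih2 (by omega)

/-- The sum of `Ψ L'` over the words `L'` that arise from `L` by deleting a letter, weighted by the
pairing of `v` with the coroot of that letter, moved past the letters to its right. -/
def deletionSum (v : V) : List V → (List V → SymmetricAlgebra ℝ V) → SymmetricAlgebra ℝ V
  | [], _ => 0
  | α :: L, Ψ => coPair (prodRefl L v) α • Ψ L + deletionSum v L fun L' => Ψ (α :: L')

theorem map_deletionSum (T : SymmetricAlgebra ℝ V →ₗ[ℝ] SymmetricAlgebra ℝ V) (v : V) (L : List V)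
    (Ψ : List V → SymmetricAlgebra ℝ V) :
    T (deletionSum v L Ψ) = deletionSum v L fun L' => T (Ψ L') := by
  induction L generalizing Ψ with
  | nil => exact map_zero T
  | cons α L ih => rw [deletionSum, deletionSum, map_add, map_smul, ih]

/-- The commutation rule between divided differences along a word and multiplication by a linear
form. -/
theorem ddWord_ι_mul {L : List V} (hL : ∀ α ∈ L, α ≠ 0) (v : V) (f : SymmetricAlgebra ℝ V) :
    ddWord L (SymmetricAlgebra.ι ℝ V v * f) =
      SymmetricAlgebra.ι ℝ V (prodRefl L v) * ddWord L f +
        deletionSum v L fun L' => ddWord L' f := by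
  induction L with
  | nil => simp [deletionSum]
  | cons α L ih =>
    rw [List.forall_mem_cons] at hL
    rw [ddWord_cons, ih hL.2, map_add, dd_ι_mul hL.1, map_deletionSum, prodRefl_cons, deletionSum,
      ddWord_cons, add_assoc]
    rfl

namespace BasedRootSystem

variable {R : BasedRootSystem V}

theorem simple_ne_zero {α : V} (hα : α ∈ R.simple) : α ≠ 0 := ne_zero (R.simple_subset hα)

theorem word_ne_zero {L : List V} (hL : ∀ α ∈ L, α ∈ R.simple) : ∀ α ∈ L, α ≠ 0 :=
  fun α hα => simple_ne_zero (hL α hα)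

open Classical in
variable (R) in
/-- The inversions of `w`: the positive roots that `w` makes negative. -/
def invs (w : V ≃ₗᵢ[ℝ] V) : Finset V := R.posFinset.filter fun β => w β ∉ R.posRoots

theorem mem_invs {w : V ≃ₗᵢ[ℝ] V} {β : V} : β ∈ R.invs w ↔ β ∈ R.posRoots ∧ w β ∉ R.posRoots := by
  simp [invs]

open Classical in
theorem invs_cons {α : V} {L : List V} (h : R.IsReduced (α :: L)) :
    R.invs (prodRefl (α :: L)) = insert ((prodRefl L)⁻¹ α) (R.invs (prodRefl L)) := by
  have hL := List.forall_mem_cons.1 h.1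
  have hpos := inv_mem_posRoots_of_isReduced h
  have hmul : prodRefl L ((prodRefl L)⁻¹ α) = α := (prodRefl L).apply_symm_apply α
  have hinv : ∀ β, prodRefl L β = α → β = (prodRefl L)⁻¹ α := fun β hβ =>
    ((prodRefl L).symm_apply_eq.2 hβ.symm).symm
  ext β
  rw [Finset.mem_insert, mem_invs, mem_invs, prodRefl_cons]
  change β ∈ R.posRoots ∧ rootRefl α (prodRefl L β) ∉ R.posRoots ↔ _
  constructor
  · rintro ⟨hβ, hn⟩
    by_cases hp : prodRefl L β ∈ R.posRoots
    · left
      refine hinv β ?_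
      by_contra hne
      exact hn (rootRefl_mem_posRoots hL.1 hp hne)
    · exact Or.inr ⟨hβ, hp⟩
  · rintro (rfl | ⟨hβ, hn⟩)
    · refine ⟨hpos, ?_⟩
      rw [hmul, rootRefl_self]
      exact neg_notMem_posRoots (simple_mem_posRoots hL.1)
    · refine ⟨hβ, fun hp => ?_⟩
      have hm : -(prodRefl L β) ∈ R.posRoots :=
        (neg_mem_posRoots_iff (map_mem_roots (prodRefl_mem_group hL.2) hβ.1)).2 hn
      have hne : -(prodRefl L β) ≠ α := by
        intro he
        rw [← map_neg] at he
        rw [← hinv _ he] at hpos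
        exact neg_notMem_posRoots hβ hpos
      have := rootRefl_mem_posRoots hL.1 hm hne
      rw [map_neg] at this
      exact neg_notMem_posRoots hp this

/-- For a reduced word, deleting a letter amounts to multiplying by the reflection in an inversion,
and every inversion arises once. -/
theorem deletionSum_eq {L : List V} (hL : R.IsReduced L) (v : V)
    (Ψ : List V → SymmetricAlgebra ℝ V) (G : (V ≃ₗᵢ[ℝ] V) → SymmetricAlgebra ℝ V)
    (h : ∀ L' : List V, (∀ α ∈ L', α ∈ R.simple) → L'.length + 1 = L.length →
      Ψ L' = G (prodRefl L')) :
    deletionSum v L Ψ =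
      ∑ γ ∈ R.invs (prodRefl L), coPair v γ • G (prodRefl L * rootRefl γ) := by
  classical
  induction L generalizing Ψ G with
  | nil =>
    have : R.invs (prodRefl []) = ∅ := by
      ext β
      rw [mem_invs]
      simp
    rw [this]
    rfl
  | cons α L ih =>
    have hs := List.forall_mem_cons.1 hL.1
    have hmul : prodRefl L ((prodRefl L)⁻¹ α) = α := (prodRefl L).apply_symm_apply α
    have hnot : (prodRefl L)⁻¹ α ∉ R.invs (prodRefl L) := by
      rw [mem_invs, hmul]
      exact fun hc => hc.2 (simple_mem_posRoots hs.1)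
    rw [invs_cons hL, Finset.sum_insert hnot, deletionSum]
    congr 1
    · rw [h L hs.2 rfl, prodRefl_cons, rootRefl_map]
      have hc := coPair_map (prodRefl L) v ((prodRefl L)⁻¹ α)
      rw [hmul] at hc
      rw [hc]
      congr 2
      simp only [inv_inv, mul_assoc, mul_inv_cancel_left]
      rw [← mul_assoc, rootRefl_mul_self, one_mul]
    · rw [ih (isReduced_tail hL) _ (fun u => G (rootRefl α * u))]
      · simp [mul_assoc]
      · intro L' hL' hlen
        rw [h _ (List.forall_mem_cons.2 ⟨hs.1, hL'⟩) (by simp [← hlen]), prodRefl_cons]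

open Classical in
variable (R) in
/-- The divided difference operator of `w ∈ W`, the composite along a chosen reduced word; it is
zero for `w ∉ W`. -/
def ddGroup (w : V ≃ₗᵢ[ℝ] V) : SymmetricAlgebra ℝ V →ₗ[ℝ] SymmetricAlgebra ℝ V :=
  if h : w ∈ R.group then ddWord (exists_reduced h).choose else 0

theorem ddGroup_eq {w : V ≃ₗᵢ[ℝ] V} (hw : w ∈ R.group) :
    ∃ L, R.IsReduced L ∧ prodRefl L = w ∧ R.ddGroup w = ddWord L :=
  ⟨_, (exists_reduced hw).choose_spec.1, (exists_reduced hw).choose_spec.2, dif_pos hw⟩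

theorem ddWord_one {L : List V} (hL : ∀ α ∈ L, α ∈ R.simple) (h : L ≠ []) :
    ddWord L (1 : SymmetricAlgebra ℝ V) = 0 :=
  (ddWord_of_mem (word_ne_zero hL) (mem_symDeg_zero.2 ⟨1, map_one _⟩)).1
    (List.length_pos_iff.2 h)

/-- An operator that commutes with multiplication by linear forms up to a twist and kills `1`
is zero. -/
theorem eq_zero_of_twisted (w : V ≃ₗᵢ[ℝ] V) (T : SymmetricAlgebra ℝ V →ₗ[ℝ] SymmetricAlgebra ℝ V)
    (h1 : T 1 = 0) (h : ∀ v f, T (SymmetricAlgebra.ι ℝ V v * f) =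
      SymmetricAlgebra.ι ℝ V (w v) * T f) : T = 0 := by
  have key : ∀ f g, T (f * g) = symAct w f * T g := by
    intro f
    induction f using SymmetricAlgebra.induction with
    | algebraMap r => intro g; rw [AlgHom.commutes, ← Algebra.smul_def, ← Algebra.smul_def, map_smul]
    | ι v => intro g; rw [symAct_ι, h]
    | mul a b ha hb => intro g; rw [mul_assoc, ha, hb, map_mul, mul_assoc]
    | add a b ha hb => intro g; rw [add_mul, map_add, ha, hb, map_add, add_mul]
  ext f
  have := key f 1
  rw [mul_one, h1, mul_zero] at this
  rw [this]
  rfl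

open Classical in
/-- The divided difference along a word depends only on the product of the word if the word is
reduced, and is zero otherwise. -/
theorem ddWord_eq_ite (n : ℕ) (L : List V) (hL : ∀ α ∈ L, α ∈ R.simple) (hn : L.length = n) :
    ddWord L = if R.len (prodRefl L) = n then R.ddGroup (prodRefl L) else 0 := by
  induction n generalizing L with
  | zero =>
    obtain rfl := List.length_eq_zero_iff.1 hn
    rw [prodRefl_nil, len_one, if_pos rfl]
    obtain ⟨L, hL, h1, h2⟩ := ddGroup_eq (one_mem R.group)
    have := hL.2
    rw [h1, len_one] at this
    rw [h2, List.length_eq_zero_iff.1 this.symm]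
  | succ n ih =>
    -- Along reduced words, the commutation rule involves only the product of the word.
    have comm : ∀ L, R.IsReduced L → L.length = n + 1 → ∀ v f,
        ddWord L (SymmetricAlgebra.ι ℝ V v * f) =
          SymmetricAlgebra.ι ℝ V (prodRefl L v) * ddWord L f +
            ∑ γ ∈ R.invs (prodRefl L), coPair v γ •
              (if R.len (prodRefl L * rootRefl γ) = n then R.ddGroup (prodRefl L * rootRefl γ)
                else 0) f := by
      intro L hL hlen v f
      rw [ddWord_ι_mul (word_ne_zero hL.1), deletionSum_eq hL v _
        (fun u => (if R.len u = n then R.ddGroup u else 0) f)]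
      intro L' hL' hlen'
      rw [ih L' hL' (by omega)]
    split_ifs with hred
    · obtain ⟨L', hL', h1, h2⟩ := ddGroup_eq (prodRefl_mem_group hL)
      have hlen' : L'.length = n + 1 := by rw [← hL'.2, h1, hred]
      rw [h2, ← sub_eq_zero]
      refine eq_zero_of_twisted (prodRefl L) _ ?_ fun v f => ?_
      · rw [LinearMap.sub_apply, ddWord_one hL, ddWord_one hL'.1, sub_zero]
        · rintro rfl; simp at hlen'
        · rintro rfl; simp at hn
      · rw [LinearMap.sub_apply, LinearMap.sub_apply, comm L ⟨hL, hred.trans hn.symm⟩ hn,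
          comm L' hL' hlen', h1]
        ring
    · obtain _ | ⟨α, L⟩ := L
      · simp at hn
      rw [List.forall_mem_cons] at hL
      rw [List.length_cons, Nat.add_right_cancel_iff] at hn
      rw [prodRefl_cons] at hred
      have hw := prodRefl_mem_group hL.2
      have hL2 := ih L hL.2 hn
      rw [show ddWord (α :: L) = dd α ∘ₗ ddWord L from rfl]
      split_ifs at hL2 with hlen
      · have hneg : (prodRefl L)⁻¹ α ∉ R.posRoots := fun hp =>
          hred (by rw [len_rootRefl_mul hw hL.1 hp, hlen])
        have hl := len_rootRefl_mul_of_notMem hw hL.1 hneg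
        -- The word starts afresh with `α`, and the divided difference of `α` squares to zero.
        obtain ⟨L', hL', h1⟩ := exists_reduced (mul_mem (rootRefl_mem_group hL.1) hw)
        have hp : prodRefl (α :: L') = prodRefl L := by
          rw [prodRefl_cons, h1, ← mul_assoc, rootRefl_mul_self, one_mul]
        have h2 := ih (α :: L') (List.forall_mem_cons.2 ⟨hL.1, hL'.1⟩)
          (by rw [List.length_cons, ← hL'.2, h1]; omega)
        rw [hp, if_pos hlen, ← hL2] at h2
        rw [← h2]
        ext f
        exact dd_dd (simple_ne_zero hL.1) _
      · rw [hL2, LinearMap.comp_zero]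

open Classical in
/-- The Chevalley formula for divided differences. -/
theorem ddGroup_ι_mul {w : V ≃ₗᵢ[ℝ] V} (hw : w ∈ R.group) (v : V) (f : SymmetricAlgebra ℝ V) :
    R.ddGroup w (SymmetricAlgebra.ι ℝ V v * f) =
      SymmetricAlgebra.ι ℝ V (w v) * R.ddGroup w f +
        ∑ γ ∈ R.invs w with R.len (w * rootRefl γ) + 1 = R.len w,
          coPair v γ • R.ddGroup (w * rootRefl γ) f := by
  obtain ⟨L, hL, rfl, h⟩ := ddGroup_eq hw
  rw [h, ddWord_ι_mul (word_ne_zero hL.1), deletionSum_eq hL v _ (fun u =>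
    if R.len u + 1 = L.length then R.ddGroup u f else 0), Finset.sum_filter, hL.2]
  · simp only [smul_ite, smul_zero]
  · intro L' hL' hlen
    rw [ddWord_eq_ite _ L' hL' rfl]
    have : R.len (prodRefl L') = L'.length ↔ R.len (prodRefl L') + 1 = L.length := by omega
    simp only [this]
    split_ifs <;> rfl

end BasedRootSystem

namespace BasedRootSystem

variable {R : BasedRootSystem V}

/-! ### The dual basis of the coinvariant ring -/

variable (R) in
/-- An element of `Sym(V)` invariant under the reflection group. -/
def IsInv (h : SymmetricAlgebra ℝ V) : Prop := ∀ w ∈ R.group, symAct w h = h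

theorem dd_mul_of_symAct_eq {γ : V} (hγ : γ ≠ 0) {h : SymmetricAlgebra ℝ V}
    (hh : symAct (rootRefl γ) h = h) (q : SymmetricAlgebra ℝ V) :
    dd γ (q * h) = dd γ q * h := by
  refine dd_eq hγ ?_
  rw [map_mul, hh, ← mul_assoc, ι_mul_dd, sub_mul]

theorem ddWord_mul_of_isInv {L : List V} (hL : ∀ α ∈ L, α ∈ R.simple) {h : SymmetricAlgebra ℝ V}
    (hh : R.IsInv h) (q : SymmetricAlgebra ℝ V) : ddWord L (q * h) = ddWord L q * h := by
  induction L with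
  | nil => rfl
  | cons α L ih =>
    rw [List.forall_mem_cons] at hL
    rw [ddWord_cons, ih hL.2, ddWord_cons,
      dd_mul_of_symAct_eq (simple_ne_zero hL.1) (hh _ (rootRefl_mem_group hL.1))]

theorem constTerm_ddWord_of_mem_coinvIdeal {L : List V} (hL : ∀ α ∈ L, α ∈ R.simple)
    {f : SymmetricAlgebra ℝ V} (hf : f ∈ coinvIdeal R.group) : constTerm (ddWord L f) = 0 := by
  suffices ∀ q, constTerm (ddWord L (q * f)) = 0 by simpa using this 1
  refine Submodule.span_induction (p := fun f _ => ∀ q, constTerm (ddWord L (q * f)) = 0)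
    ?_ ?_ ?_ ?_ hf
  · rintro h ⟨hh, i, hi, hmem⟩ q
    rw [ddWord_mul_of_isInv hL hh, map_mul, constTerm_of_mem hi.ne' hmem, mul_zero]
  · simp
  · intro f g _ _ hf hg q
    rw [mul_add, map_add, map_add, hf, hg, add_zero]
  · intro a f _ hf q
    rw [smul_eq_mul, ← mul_assoc]
    exact hf _

theorem dd_mem_coinvIdeal {α : V} (hα : α ∈ R.simple)
    {f : SymmetricAlgebra ℝ V} (hf : f ∈ coinvIdeal R.group) : dd α f ∈ coinvIdeal R.group := by
  suffices ∀ q, dd α (q * f) ∈ coinvIdeal R.group by simpa using this 1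
  refine Submodule.span_induction (p := fun f _ => ∀ q, dd α (q * f) ∈ coinvIdeal R.group)
    ?_ ?_ ?_ ?_ hf
  · rintro h hh q
    rw [dd_mul_of_symAct_eq (simple_ne_zero hα) (hh.1 _ (rootRefl_mem_group hα))]
    exact Ideal.mul_mem_left _ _ (Ideal.subset_span hh)
  · simp
  · intro f g _ _ hf hg q
    rw [mul_add, map_add]
    exact add_mem (hf q) (hg q)
  · intro a f _ hf q
    rw [smul_eq_mul, ← mul_assoc]
    exact hf _

variable (R) in
/-- The functionals `f ↦ (∂_w f)(0)` on `Sym(V)`, for all `w ∈ W` at once. On the coinvariant ring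
they form the basis dual to the Schubert basis. -/
def dualMap : SymmetricAlgebra ℝ V →ₗ[ℝ] (R.group → ℝ) :=
  LinearMap.pi fun w => constTerm.toLinearMap ∘ₗ R.ddGroup w

theorem dualMap_apply (f : SymmetricAlgebra ℝ V) (w : R.group) :
    R.dualMap f w = constTerm (R.ddGroup w f) := rfl

theorem dualMap_of_mem_coinvIdeal {f : SymmetricAlgebra ℝ V} (hf : f ∈ coinvIdeal R.group) :
    R.dualMap f = 0 := by
  ext w
  obtain ⟨L, hL, -, h⟩ := ddGroup_eq w.2
  rw [dualMap_apply, h, constTerm_ddWord_of_mem_coinvIdeal hL.1 hf, Pi.zero_apply]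

theorem dualMap_apply_eq_zero {n : ℕ} {f : SymmetricAlgebra ℝ V} (hf : f ∈ symDeg V n)
    {w : R.group} (hw : R.len (w : V ≃ₗᵢ[ℝ] V) ≠ n) : R.dualMap f w = 0 := by
  obtain ⟨L, hL, h1, h⟩ := ddGroup_eq w.2
  have hlen := hL.2
  rw [h1] at hlen
  obtain ⟨h2, h3⟩ := ddWord_of_mem (word_ne_zero hL.1) hf
  rw [dualMap_apply, h]
  rcases lt_or_ge n L.length with hn | hn
  · rw [h2 hn, map_zero]
  · exact constTerm_of_mem (by omega) (h3 hn)

/-- A divided difference moves the dual functional of `w` to that of `w s_α`. -/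
theorem dualMap_dd {α : V} (hα : α ∈ R.simple) (f : SymmetricAlgebra ℝ V) (w : R.group) :
    ((w : V ≃ₗᵢ[ℝ] V) α ∈ R.posRoots →
      R.dualMap (dd α f) w = R.dualMap f (w * ⟨rootRefl α, rootRefl_mem_group hα⟩)) ∧
    ((w : V ≃ₗᵢ[ℝ] V) α ∉ R.posRoots → R.dualMap (dd α f) w = 0) := by
  obtain ⟨L, hL, h1, h⟩ := ddGroup_eq w.2
  have hL' : ∀ β ∈ L ++ [α], β ∈ R.simple := by
    intro β hβ
    rcases List.mem_append.1 hβ with hβ | hβ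
    · exact hL.1 β hβ
    · rw [List.mem_singleton.1 hβ]; exact hα
  have hlen := hL.2
  have key : ddWord L (dd α f) = ddWord (L ++ [α]) f := by simp
  rw [dualMap_apply, dualMap_apply, h, key, ddWord_eq_ite _ _ hL' rfl]
  simp only [prodRefl_append, prodRefl_cons, prodRefl_nil, mul_one, List.length_append,
    List.length_singleton, h1]
  rw [h1] at hlen
  refine ⟨fun hp => ?_, fun hp => ?_⟩
  · rw [len_mul_rootRefl hα hp, hlen, if_pos rfl]
    rfl
  · rw [if_neg, LinearMap.zero_apply, map_zero]
    have := len_mul_rootRefl_of_notMem w.2 hα hp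
    omega

variable (R) in
/-- The degree `n` part of the ideal of the invariants of positive degree, generated by products of
homogeneous factors. -/
def coinvIdealDeg (n : ℕ) : Submodule ℝ (SymmetricAlgebra ℝ V) :=
  Submodule.span ℝ {x | ∃ d m h q, 0 < d ∧ m + d = n ∧ h ∈ symDeg V d ∧ R.IsInv h ∧
    q ∈ symDeg V m ∧ x = q * h}

theorem coinvIdealDeg_le {n : ℕ} {f : SymmetricAlgebra ℝ V} (hf : f ∈ R.coinvIdealDeg n) :
    f ∈ coinvIdeal R.group := by
  induction hf using Submodule.span_induction with
  | mem x hx =>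
    obtain ⟨d, m, h, q, hd, -, hh, hinv, -, rfl⟩ := hx
    exact Ideal.mul_mem_left _ _ (Ideal.subset_span ⟨hinv, d, hd, hh⟩)
  | zero => exact zero_mem _
  | add f g _ _ hf hg => exact add_mem hf hg
  | smul c f _ hf =>
    rw [Algebra.smul_def]
    exact Ideal.mul_mem_left _ _ hf

theorem ι_mul_mem_coinvIdealDeg {n : ℕ} {f : SymmetricAlgebra ℝ V} (v : V)
    (hf : f ∈ R.coinvIdealDeg n) : SymmetricAlgebra.ι ℝ V v * f ∈ R.coinvIdealDeg (n + 1) := by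
  induction hf using Submodule.span_induction with
  | mem x hx =>
    obtain ⟨d, m, h, q, hd, rfl, hh, hinv, hq, rfl⟩ := hx
    exact Submodule.subset_span ⟨d, 1 + m, h, SymmetricAlgebra.ι ℝ V v * q, hd, by omega, hh, hinv,
      mul_mem_symDeg (ι_mem_symDeg v) hq, (mul_assoc _ _ _).symm⟩
  | zero => simp
  | add f g _ _ hf hg => rw [mul_add]; exact add_mem hf hg
  | smul c f _ hf => rw [mul_smul_comm]; exact Submodule.smul_mem _ _ hf

theorem symAct_mem_coinvIdealDeg {n : ℕ} {f : SymmetricAlgebra ℝ V} {w : V ≃ₗᵢ[ℝ] V}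
    (hw : w ∈ R.group) (hf : f ∈ R.coinvIdealDeg n) : symAct w f ∈ R.coinvIdealDeg n := by
  induction hf using Submodule.span_induction with
  | mem x hx =>
    obtain ⟨d, m, h, q, hd, hmd, hh, hinv, hq, rfl⟩ := hx
    exact Submodule.subset_span ⟨d, m, h, symAct w q, hd, hmd, hh, hinv, symAct_mem_symDeg w hq,
      by rw [map_mul, hinv w hw]⟩
  | zero => simp
  | add f g _ _ hf hg => rw [map_add]; exact add_mem hf hg
  | smul c f _ hf => rw [map_smul]; exact Submodule.smul_mem _ _ hf

/-- A homogeneous polynomial all of whose iterated divided differences have zero constant term lies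
in the ideal of the invariants of positive degree: it is congruent to each of its translates, hence
to their average. -/
theorem mem_coinvIdealDeg_of_word {n : ℕ} {f : SymmetricAlgebra ℝ V} (hf : f ∈ symDeg V n)
    (h : ∀ L : List V, (∀ α ∈ L, α ∈ R.simple) → L.length = n → constTerm (ddWord L f) = 0) :
    f ∈ R.coinvIdealDeg n := by
  induction n generalizing f with
  | zero =>
    obtain ⟨c, rfl⟩ := mem_symDeg_zero.1 hf
    have := h [] (by simp) rfl
    rw [ddWord_nil, AlgHom.commutes, Algebra.algebraMap_self_apply] at this
    rw [this, map_zero]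
    exact zero_mem _
  | succ n ih =>
    have hrefl : ∀ α ∈ R.simple, f - symAct (rootRefl α) f ∈ R.coinvIdealDeg (n + 1) := by
      intro α hα
      rw [← ι_mul_dd]
      refine ι_mul_mem_coinvIdealDeg α (ih (dd_mem_symDeg (simple_ne_zero hα) hf) fun L hL hn => ?_)
      have := h (L ++ [α]) ?_ (by simp [hn])
      · simpa using this
      · intro β hβ
        rcases List.mem_append.1 hβ with hβ | hβ
        · exact hL β hβ
        · rw [List.mem_singleton.1 hβ]; exact hα
    have hgroup : ∀ w ∈ R.group, f - symAct w f ∈ R.coinvIdealDeg (n + 1) := by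
      intro w hw
      rw [group_eq] at hw
      obtain ⟨L, hL, rfl⟩ := exists_word hw
      clear hw
      induction L with
      | nil => rw [prodRefl_nil, symAct_one, sub_self]; exact zero_mem _
      | cons α L ihL =>
        rw [List.forall_mem_cons] at hL
        have := add_mem (hrefl α hL.1)
          (symAct_mem_coinvIdealDeg (rootRefl_mem_group hL.1) (ihL hL.2))
        rwa [map_sub, sub_add_sub_cancel, ← symAct_mul] at this
    have : Fintype R.group := Fintype.ofFinite _
    have hsum : ∑ w : R.group, symAct (w : V ≃ₗᵢ[ℝ] V) f ∈ R.coinvIdealDeg (n + 1) := by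
      refine Submodule.subset_span ⟨n + 1, 0, _, 1, n.succ_pos, by omega,
        sum_mem fun w _ => symAct_mem_symDeg _ hf, fun u hu => ?_,
        mem_symDeg_zero.2 ⟨1, map_one _⟩, (one_mul _).symm⟩
      rw [map_sum]
      refine Fintype.sum_equiv (Equiv.mulLeft (⟨u, hu⟩ : R.group)) _ _ fun w => ?_
      rw [← symAct_mul]
      rfl
    have hall := add_mem (sum_mem fun w (_ : w ∈ (Finset.univ : Finset R.group)) =>
      hgroup w w.2) hsum
    rw [Finset.sum_sub_distrib, sub_add_cancel, Finset.sum_const, ← Nat.cast_smul_eq_nsmul ℝ]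
      at hall
    refine (Submodule.smul_mem_iff _ ?_).1 hall
    rw [Finset.card_univ]
    exact Nat.cast_ne_zero.2 Fintype.card_ne_zero

theorem mem_coinvIdealDeg {n : ℕ} {f : SymmetricAlgebra ℝ V} (hf : f ∈ symDeg V n)
    (h : R.dualMap f = 0) : f ∈ R.coinvIdealDeg n := by
  classical
  refine mem_coinvIdealDeg_of_word hf fun L hL hn => ?_
  rw [ddWord_eq_ite _ L hL rfl]
  split_ifs
  · exact congrFun h ⟨prodRefl L, prodRefl_mem_group hL⟩
  · rw [LinearMap.zero_apply, map_zero]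

theorem mem_coinvIdeal_iff {n : ℕ} {f : SymmetricAlgebra ℝ V} (hf : f ∈ symDeg V n) :
    f ∈ coinvIdeal R.group ↔ R.dualMap f = 0 :=
  ⟨dualMap_of_mem_coinvIdeal, fun h => coinvIdealDeg_le (mem_coinvIdealDeg hf h)⟩

/-! ### The dimension of the coinvariant ring -/

variable (R) in
/-- There is a linear form that is positive on the positive roots. -/
theorem exists_regular : ∃ φ : V →ₗ[ℝ] ℝ, ∀ β ∈ R.posRoots, 0 < φ β := by
  have hli : LinearIndependent ℝ (fun x : R.simple => (x : V)) := R.linearIndepOn_simple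
  obtain ⟨φ, hφ⟩ := ((Module.Basis.span hli).constr ℝ fun _ => (1 : ℝ)).exists_extend
  have h1 : ∀ α ∈ R.simple, φ α = 1 := by
    intro α hα
    have := LinearMap.congr_fun hφ (Module.Basis.span hli ⟨α, hα⟩)
    rw [Module.Basis.constr_basis] at this
    simpa [Module.Basis.span_apply] using this
  have key : ∀ x ∈ Submodule.span ℝ≥0 R.simple, 0 ≤ φ x ∧ (φ x = 0 → x = 0) := by
    intro x hx
    induction hx using Submodule.span_induction with
    | mem x hx => rw [h1 x hx]; simp
    | zero => simp
    | add x y _ _ hx hy =>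
      rw [map_add]
      refine ⟨add_nonneg hx.1 hy.1, fun h => ?_⟩
      rw [hx.2 (by linarith [hx.1, hy.1]), hy.2 (by linarith [hx.1, hy.1]), add_zero]
    | smul c x _ hx =>
      rw [NNReal.smul_def, map_smul, smul_eq_mul]
      refine ⟨mul_nonneg c.2 hx.1, fun h => ?_⟩
      rcases mul_eq_zero.1 h with h | h
      · rw [h, zero_smul]
      · rw [hx.2 h, smul_zero]
  exact ⟨φ, fun β hβ => (key β hβ.2).1.lt_of_ne fun h => ne_zero hβ.1 ((key β hβ.2).2 h.symm)⟩

theorem eq_of_regular {φ : V →ₗ[ℝ] ℝ} (hφ : ∀ β ∈ R.posRoots, 0 < φ β) {u w : R.group}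
    (h : ∀ v, φ ((u : V ≃ₗᵢ[ℝ] V) v) = φ ((w : V ≃ₗᵢ[ℝ] V) v)) : u = w := by
  have key : ((u * w⁻¹ : R.group) : V ≃ₗᵢ[ℝ] V) = 1 := by
    refine eq_one_of_len_eq_zero (u * w⁻¹).2 (len_eq_zero fun β hβ => ?_)
    by_contra hn
    have hx : φ (((u * w⁻¹ : R.group) : V ≃ₗᵢ[ℝ] V) β) = φ β := by
      change φ ((u : V ≃ₗᵢ[ℝ] V) ((w : V ≃ₗᵢ[ℝ] V).symm β)) = φ β
      rw [h, LinearIsometryEquiv.apply_symm_apply]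
    have := hφ _ ((neg_mem_posRoots_iff (map_mem_roots (u * w⁻¹).2 hβ.1)).2 hn)
    rw [map_neg, hx] at this
    linarith [hφ β hβ]
  exact mul_inv_eq_one.1 (Subtype.ext key)

/-- Evaluation of polynomials at the `W`-orbit of a point, the point being a linear form on `V`. -/
def orbitEval (R : BasedRootSystem V) (φ : V →ₗ[ℝ] ℝ) :
    SymmetricAlgebra ℝ V →ₐ[ℝ] (R.group → ℝ) :=
  AlgHom.pi fun w => (SymmetricAlgebra.lift φ).comp (symAct (w : V ≃ₗᵢ[ℝ] V))

theorem orbitEval_apply (φ : V →ₗ[ℝ] ℝ) (f : SymmetricAlgebra ℝ V) (w : R.group) :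
    R.orbitEval φ f w = SymmetricAlgebra.lift φ (symAct (w : V ≃ₗᵢ[ℝ] V) f) := rfl

theorem orbitEval_surjective {φ : V →ₗ[ℝ] ℝ} (hφ : ∀ β ∈ R.posRoots, 0 < φ β) :
    Function.Surjective (R.orbitEval φ) := by
  classical
  have : Fintype R.group := Fintype.ofFinite _
  have single : ∀ w : R.group, ∃ f, R.orbitEval φ f = Pi.single w 1 := by
    intro w
    have hsep : ∀ u : R.group, ∃ v, u ≠ w →
        φ ((u : V ≃ₗᵢ[ℝ] V) v) ≠ φ ((w : V ≃ₗᵢ[ℝ] V) v) := by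
      intro u
      by_cases huw : u = w
      · exact ⟨0, fun h => absurd huw h⟩
      · by_contra! hc
        exact huw (eq_of_regular hφ fun v => (hc v).2)
    choose v hv using hsep
    set f : SymmetricAlgebra ℝ V := ∏ u ∈ Finset.univ.erase w,
      (SymmetricAlgebra.ι ℝ V (v u) - algebraMap ℝ _ (φ ((u : V ≃ₗᵢ[ℝ] V) (v u)))) with hf
    have hval : ∀ x : R.group, R.orbitEval φ f x = ∏ u ∈ Finset.univ.erase w,
        (φ ((x : V ≃ₗᵢ[ℝ] V) (v u)) - φ ((u : V ≃ₗᵢ[ℝ] V) (v u))) := by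
      intro x
      rw [orbitEval_apply, hf, map_prod, map_prod]
      refine Finset.prod_congr rfl fun u _ => ?_
      rw [map_sub, map_sub, symAct_ι, SymmetricAlgebra.lift_ι_apply, AlgHom.commutes,
        AlgHom.commutes, Algebra.algebraMap_self_apply]
    have hne : R.orbitEval φ f w ≠ 0 := by
      rw [hval, Finset.prod_ne_zero_iff]
      intro u hu
      exact sub_ne_zero.2 (hv u (Finset.ne_of_mem_erase hu)).symm
    refine ⟨(R.orbitEval φ f w)⁻¹ • f, ?_⟩
    ext x
    rw [map_smul, Pi.smul_apply, smul_eq_mul]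
    by_cases hx : x = w
    · rw [hx, Pi.single_eq_same, inv_mul_cancel₀ hne]
    · rw [Pi.single_eq_of_ne hx, hval x, Finset.prod_eq_zero
        (Finset.mem_erase.2 ⟨hx, Finset.mem_univ x⟩) (sub_self _), mul_zero]
  choose f hf using single
  intro g
  refine ⟨∑ w, g w • f w, ?_⟩
  rw [map_sum]
  ext x
  simp [hf, Finset.sum_apply, Pi.single_apply]

open Classical in
variable (R) in
/-- The projection of functions on `W` to the functions supported on the elements of length `n`. -/
def lenProj (n : ℕ) : (R.group → ℝ) →ₗ[ℝ] (R.group → ℝ) :=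
  LinearMap.pi fun w => if R.len (w : V ≃ₗᵢ[ℝ] V) = n then LinearMap.proj w else 0

theorem lenProj_dualMap {n : ℕ} {f : SymmetricAlgebra ℝ V} (hf : f ∈ symDeg V n) (k : ℕ) :
    R.lenProj k (R.dualMap f) = if k = n then R.dualMap f else 0 := by
  ext w
  rw [lenProj, LinearMap.pi_apply]
  split_ifs with h1 h2 h2
  · rfl
  · exact dualMap_apply_eq_zero hf (h1 ▸ h2)
  · exact (dualMap_apply_eq_zero hf (h2 ▸ h1)).symm
  · rfl

/-- A homogeneous partial section of a linear map on `Sym(V)`. -/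
theorem exists_section {W : Type*} [AddCommGroup W] [Module ℝ W]
    (T : SymmetricAlgebra ℝ V →ₗ[ℝ] W) (n : ℕ) :
    ∃ σ : W →ₗ[ℝ] SymmetricAlgebra ℝ V, (∀ g, σ g ∈ symDeg V n) ∧
      ∀ f ∈ symDeg V n, T (σ (T f)) = T f := by
  obtain ⟨g, hg⟩ := LinearMap.exists_rightInverse_of_surjective
    (T.domRestrict (symDeg V n)).rangeRestrict (LinearMap.range_rangeRestrict _)
  obtain ⟨g', hg'⟩ := g.exists_extend
  refine ⟨(symDeg V n).subtype ∘ₗ g', fun x => (g' x).2, fun f hf => ?_⟩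
  have h1 := LinearMap.congr_fun hg' ((T.domRestrict (symDeg V n)).rangeRestrict ⟨f, hf⟩)
  have h2 := congrArg Subtype.val
    (LinearMap.congr_fun hg ((T.domRestrict (symDeg V n)).rangeRestrict ⟨f, hf⟩))
  simp only [LinearMap.comp_apply] at h1 h2 ⊢
  have h3 : g' (T f) = g ((T.domRestrict (symDeg V n)).rangeRestrict ⟨f, hf⟩) := h1
  rw [h3]
  exact h2

variable (R) in
/-- The functionals `f ↦ (∂_w f)(0)` are linearly independent. Evaluation at a free orbit shows that
the coinvariant ring has dimension at least the order of the group: modulo the invariants of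
positive degree, which are constant on the orbit, every polynomial is a combination of lifts of
elements of the coinvariant ring. -/
theorem range_dualMap : LinearMap.range R.dualMap = ⊤ := by
  classical
  have : Fintype R.group := Fintype.ofFinite _
  obtain ⟨φ, hφ⟩ := R.exists_regular
  choose σ hσ1 hσ2 using exists_section R.dualMap
  let Ψ : (R.group → ℝ) →ₗ[ℝ] (R.group → ℝ) := ∑ n ∈ Finset.range (R.posFinset.card + 1),
    (R.orbitEval φ).toLinearMap ∘ₗ σ n ∘ₗ R.lenProj n
  have hΨ : ∀ n, ∀ f ∈ symDeg V n, Ψ (R.dualMap f) = R.orbitEval φ (σ n (R.dualMap f)) := by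
    intro n f hf
    simp only [Ψ, LinearMap.sum_apply, LinearMap.comp_apply, lenProj_dualMap hf,
      AlgHom.toLinearMap_apply]
    by_cases hn : n ∈ Finset.range (R.posFinset.card + 1)
    · rw [Finset.sum_eq_single_of_mem n hn, if_pos rfl]
      intro k _ hk
      rw [if_neg hk, map_zero, map_zero]
    · have h0 : R.dualMap f = 0 := by
        ext w
        refine dualMap_apply_eq_zero hf fun h => hn ?_
        rw [Finset.mem_range, ← h, Nat.lt_succ_iff]
        exact Finset.card_filter_le _ _
      simp [h0]
  have key : ∀ n, ∀ f ∈ symDeg V n,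
      R.orbitEval φ f ∈ (LinearMap.range R.dualMap).map Ψ := by
    intro n
    induction n using Nat.strong_induction_on with
    | _ n ih =>
      intro f hf
      have hker : f - σ n (R.dualMap f) ∈ R.coinvIdealDeg n :=
        mem_coinvIdealDeg (sub_mem hf (hσ1 n _)) (by rw [map_sub, hσ2 n f hf, sub_self])
      have hrest : ∀ g ∈ R.coinvIdealDeg n,
          R.orbitEval φ g ∈ (LinearMap.range R.dualMap).map Ψ := by
        intro g hg
        induction hg using Submodule.span_induction with
        | mem x hx =>
          obtain ⟨d, m, h, q, hd, hmd, -, hinv, hq, rfl⟩ := hx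
          have : R.orbitEval φ (q * h) = SymmetricAlgebra.lift φ h • R.orbitEval φ q := by
            ext w
            rw [Pi.smul_apply, orbitEval_apply, orbitEval_apply, map_mul, map_mul, hinv w w.2,
              smul_eq_mul, mul_comm]
          rw [this]
          exact Submodule.smul_mem _ _ (ih m (by omega) q hq)
        | zero => rw [map_zero]; exact zero_mem _
        | add f g _ _ hf hg => rw [map_add]; exact add_mem hf hg
        | smul c f _ hf => rw [map_smul]; exact Submodule.smul_mem _ _ hf
      have := add_mem (hrest _ hker)
        (Submodule.mem_map_of_mem (f := Ψ) (LinearMap.mem_range_self R.dualMap f))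
      rwa [hΨ n f hf, map_sub, sub_add_cancel] at this
  have htop : (LinearMap.range R.dualMap).map Ψ = ⊤ := by
    rw [eq_top_iff]
    rintro g -
    obtain ⟨f, rfl⟩ := orbitEval_surjective hφ g
    have hf : f ∈ ⨆ n, symDeg V n := iSup_symDeg V ▸ Submodule.mem_top
    refine Submodule.iSup_induction (symDeg V)
      (motive := fun f => R.orbitEval φ f ∈ (LinearMap.range R.dualMap).map Ψ) hf key ?_ ?_
    · rw [map_zero]; exact zero_mem _
    · intro f g hf hg; rw [map_add]; exact add_mem hf hg
  have hle := Submodule.finrank_map_le Ψ (LinearMap.range R.dualMap)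
  rw [htop, finrank_top] at hle
  exact Submodule.eq_top_of_finrank_eq (le_antisymm (Submodule.finrank_le _) hle)

theorem exists_dualMap_eq {n : ℕ} {g : R.group → ℝ}
    (hg : ∀ w : R.group, R.len (w : V ≃ₗᵢ[ℝ] V) ≠ n → g w = 0) :
    ∃ f ∈ symDeg V n, R.dualMap f = g := by
  obtain ⟨f, rfl⟩ := LinearMap.range_eq_top.1 R.range_dualMap g
  have hproj : R.lenProj n (R.dualMap f) = R.dualMap f := by
    ext w
    rw [lenProj, LinearMap.pi_apply]
    split_ifs with h
    · rfl
    · exact (hg w h).symm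
  have hf : f ∈ ⨆ n, symDeg V n := iSup_symDeg V ▸ Submodule.mem_top
  rw [← hproj]
  change R.lenProj n (R.dualMap f) ∈ (symDeg V n).map R.dualMap
  clear hproj hg
  refine Submodule.iSup_induction (symDeg V)
    (motive := fun f => R.lenProj n (R.dualMap f) ∈ (symDeg V n).map R.dualMap) hf ?_ ?_ ?_
  · intro k f hf
    rw [lenProj_dualMap hf]
    split_ifs with h
    · exact ⟨f, h ▸ hf, rfl⟩
    · exact zero_mem _
  · rw [map_zero, map_zero]; exact zero_mem _
  · intro f g hf hg; rw [map_add, map_add]; exact add_mem hf hg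

end BasedRootSystem

namespace BasedRootSystem

variable {R : BasedRootSystem V}

/-! ### Minimal coset representatives and the orbit of a dominant root -/

variable (R) in
/-- A dominant root `θ` whose stabilizer in `W` is `W_Θ` and whose orbit consists of all roots. -/
structure IsDominantRoot (Θ : Set V) (θ : V) : Prop where
  subset : Θ ⊆ R.simple
  mem : θ ∈ R.roots
  inner_eq_zero : ∀ α ∈ Θ, inner ℝ θ α = 0
  inner_pos : ∀ α ∈ R.simple, α ∉ Θ → 0 < inner ℝ θ α
  transitive : ∀ β ∈ R.roots, ∃ w ∈ R.group, w θ = β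

variable (R) in
/-- `w` is the element of minimal length of its coset `w W_Θ`. -/
def IsMinRep (Θ : Set V) (w : V ≃ₗᵢ[ℝ] V) : Prop := ∀ α ∈ Θ, w α ∈ R.posRoots

variable {Θ : Set V} {θ : V}

theorem IsDominantRoot.inner_nonneg (h : R.IsDominantRoot Θ θ) {x : V}
    (hx : x ∈ Submodule.span ℝ≥0 R.simple) :
    0 ≤ inner ℝ θ x ∧ (inner ℝ θ x = 0 → x ∈ Submodule.span ℝ≥0 Θ) := by
  induction hx using Submodule.span_induction with
  | mem x hx =>
    by_cases hΘ : x ∈ Θ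
    · exact ⟨(h.inner_eq_zero x hΘ).ge, fun _ => Submodule.subset_span hΘ⟩
    · have := h.inner_pos x hx hΘ
      exact ⟨this.le, fun h0 => absurd h0 this.ne'⟩
  | zero => simp
  | add x y _ _ hx hy =>
    rw [inner_add_right]
    refine ⟨add_nonneg hx.1 hy.1, fun h0 => add_mem (hx.2 ?_) (hy.2 ?_)⟩ <;>
      linarith [hx.1, hy.1]
  | smul c x _ hx =>
    rw [NNReal.smul_def, inner_smul_right]
    refine ⟨mul_nonneg c.2 hx.1, fun h0 => ?_⟩
    rcases mul_eq_zero.1 h0 with h0 | h0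
    · rw [h0, zero_smul]; exact zero_mem _
    · rw [← NNReal.smul_def]; exact Submodule.smul_mem _ c (hx.2 h0)

theorem IsDominantRoot.mem_posRoots_of_inner_pos (h : R.IsDominantRoot Θ θ) {β : V}
    (hβ : β ∈ R.roots) (hpos : 0 < inner ℝ θ β) : β ∈ R.posRoots := by
  refine (mem_posRoots_or hβ).resolve_right fun hn => ?_
  have := (h.inner_nonneg hn.2).1
  rw [inner_neg_right] at this
  linarith

theorem IsMinRep.map_mem_posRoots {w : V ≃ₗᵢ[ℝ] V} (hmin : R.IsMinRep Θ w)
    (h : R.IsDominantRoot Θ θ) (hw : w ∈ R.group) {β : V} (hβ : β ∈ R.posRoots)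
    (h0 : inner ℝ θ β = 0) : w β ∈ R.posRoots := by
  refine ⟨map_mem_roots hw hβ.1, ?_⟩
  have := (h.inner_nonneg hβ.2).2 h0
  clear h0 hβ
  induction this using Submodule.span_induction with
  | mem x hx => exact (hmin x hx).2
  | zero => simp
  | add x y _ _ hx hy => rw [map_add]; exact add_mem hx hy
  | smul c x _ hx =>
    rw [NNReal.smul_def, map_smul, ← NNReal.smul_def]
    exact Submodule.smul_mem _ c hx

theorem IsDominantRoot.eq_of_isMinRep (h : R.IsDominantRoot Θ θ) {u w : R.group}
    (hu : R.IsMinRep Θ (u : V ≃ₗᵢ[ℝ] V)) (hw : R.IsMinRep Θ (w : V ≃ₗᵢ[ℝ] V))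
    (huw : (u : V ≃ₗᵢ[ℝ] V) θ = (w : V ≃ₗᵢ[ℝ] V) θ) : u = w := by
  refine inv_mul_eq_one.1 (Subtype.ext (eq_one_of_len_eq_zero (u⁻¹ * w).2
    (len_eq_zero fun β hβ => ?_)))
  have hroot := map_mem_roots (u⁻¹ * w).2 hβ.1
  have hmul : (u : V ≃ₗᵢ[ℝ] V) (((u⁻¹ * w : R.group) : V ≃ₗᵢ[ℝ] V) β) = (w : V ≃ₗᵢ[ℝ] V) β :=
    (u : V ≃ₗᵢ[ℝ] V).apply_symm_apply _
  have hinner : inner ℝ θ (((u⁻¹ * w : R.group) : V ≃ₗᵢ[ℝ] V) β) = inner ℝ θ β := by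
    rw [← (u : V ≃ₗᵢ[ℝ] V).inner_map_map, hmul, huw, LinearIsometryEquiv.inner_map_map]
  rcases (h.inner_nonneg hβ.2).1.lt_or_eq with hpos | h0
  · exact h.mem_posRoots_of_inner_pos hroot (hinner ▸ hpos)
  · by_contra hn
    have hn' := (neg_mem_posRoots_iff hroot).2 hn
    have hu' := hu.map_mem_posRoots h u.2 hn' (by rw [inner_neg_right, hinner, ← h0, neg_zero])
    rw [map_neg, hmul] at hu'
    exact neg_notMem_posRoots (hw.map_mem_posRoots h w.2 hβ h0.symm) hu'

theorem IsDominantRoot.exists_isMinRep (h : R.IsDominantRoot Θ θ) {a : V} (ha : a ∈ R.roots) :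
    ∃ w : R.group, R.IsMinRep Θ (w : V ≃ₗᵢ[ℝ] V) ∧ (w : V ≃ₗᵢ[ℝ] V) θ = a := by
  obtain ⟨u, hu, hua⟩ := h.transitive a ha
  obtain ⟨w, hw, hmin⟩ := Set.exists_min_image {w : R.group | (w : V ≃ₗᵢ[ℝ] V) θ = a}
    (fun w => R.len (w : V ≃ₗᵢ[ℝ] V)) (Set.toFinite _) ⟨⟨u, hu⟩, hua⟩
  refine ⟨w, fun α hα => ?_, hw⟩
  by_contra hn
  have hlen := len_mul_rootRefl_of_notMem w.2 (h.subset hα) hn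
  have := hmin (w * ⟨rootRefl α, rootRefl_mem_group (h.subset hα)⟩) (by
    change (w : V ≃ₗᵢ[ℝ] V) (rootRefl α θ) = a
    rw [rootRefl_eq_self (h.inner_eq_zero α hα)]
    exact hw)
  change R.len (w : V ≃ₗᵢ[ℝ] V) ≤ R.len ((w : V ≃ₗᵢ[ℝ] V) * rootRefl α) at this
  omega

open Classical in
/-- The level of `w θ` counts the inversions of `w` not orthogonal to `θ`. -/
theorem IsDominantRoot.lev_eq (h : R.IsDominantRoot Θ θ) {w : V ≃ₗᵢ[ℝ] V} (hw : w ∈ R.group) :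
    R.lev (w θ) = ((R.invs w).filter fun β => inner ℝ θ β ≠ 0).card := by
  have hw1 : ∀ x, w (w⁻¹ x) = x := w.apply_symm_apply
  have hw2 : ∀ x, w⁻¹ (w x) = x := w.symm_apply_apply
  refine Finset.card_nbij' (fun γ => -(w⁻¹ γ)) (fun β => -(w β)) ?_ ?_ ?_ ?_
  · intro γ hγ
    simp only [Finset.coe_filter, Set.mem_ofPred_eq, mem_posFinset, mem_invs] at hγ ⊢
    have hin : inner ℝ (w θ) γ = inner ℝ θ (w⁻¹ γ) := by
      rw [← w.inner_map_map θ, hw1]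
    rw [hin] at hγ
    have hpos : 0 < inner ℝ θ (-(w⁻¹ γ)) := by rw [inner_neg_right]; linarith [hγ.2]
    refine ⟨⟨h.mem_posRoots_of_inner_pos
      (neg_mem_roots (map_mem_roots (inv_mem hw) hγ.1.1)) hpos, ?_⟩, hpos.ne'⟩
    rw [map_neg, hw1]
    exact neg_notMem_posRoots hγ.1
  · intro β hβ
    simp only [Finset.coe_filter, Set.mem_ofPred_eq, mem_posFinset, mem_invs] at hβ ⊢
    refine ⟨(neg_mem_posRoots_iff (map_mem_roots hw hβ.1.1.1)).2 hβ.1.2, ?_⟩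
    rw [inner_neg_right, w.inner_map_map, neg_lt_zero]
    exact (h.inner_nonneg hβ.1.1.2).1.lt_of_ne' hβ.2
  · intro γ _
    simp
  · intro β _
    simp

theorem len_eq_card_invs (w : V ≃ₗᵢ[ℝ] V) : R.len w = (R.invs w).card := rfl

theorem IsDominantRoot.lev_le_len (h : R.IsDominantRoot Θ θ) {w : V ≃ₗᵢ[ℝ] V}
    (hw : w ∈ R.group) : R.lev (w θ) ≤ R.len w := by
  classical
  rw [h.lev_eq hw]
  exact Finset.card_filter_le _ _

theorem IsDominantRoot.isMinRep_iff (h : R.IsDominantRoot Θ θ) {w : V ≃ₗᵢ[ℝ] V}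
    (hw : w ∈ R.group) : R.IsMinRep Θ w ↔ R.lev (w θ) = R.len w := by
  classical
  rw [h.lev_eq hw, len_eq_card_invs, Finset.card_filter_eq_iff]
  refine ⟨fun hmin β hβ h0 => ?_, fun hall α hα => ?_⟩
  · rw [mem_invs] at hβ
    exact hβ.2 (hmin.map_mem_posRoots h hw hβ.1 h0)
  · by_contra hn
    exact hall α (mem_invs.2 ⟨simple_mem_posRoots (h.subset hα), hn⟩) (h.inner_eq_zero α hα)

/-! ### The ring of relative coinvariants as a space of functions on the roots -/

variable (R) in
/-- The map `dualMap` on the coinvariant ring. -/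
def coinvDualMap : CoinvRing R.group →ₗ[ℝ] (R.group → ℝ) where
  toFun x := R.dualMap (Function.surjInv Ideal.Quotient.mk_surjective x)
  map_add' x y := by
    rw [← map_add, ← sub_eq_zero, ← map_sub]
    refine dualMap_of_mem_coinvIdeal (Ideal.Quotient.eq.1 ?_)
    simp only [map_add, Function.surjInv_eq Ideal.Quotient.mk_surjective]
  map_smul' c x := by
    rw [RingHom.id_apply, ← map_smul, ← sub_eq_zero, ← map_sub]
    refine dualMap_of_mem_coinvIdeal (Ideal.Quotient.eq.1 ?_)
    have : ∀ f, Ideal.Quotient.mk (coinvIdeal R.group) (c • f) =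
      c • Ideal.Quotient.mk (coinvIdeal R.group) f := fun f => rfl
    simp only [this, Function.surjInv_eq Ideal.Quotient.mk_surjective]

theorem coinvDualMap_mk (f : SymmetricAlgebra ℝ V) :
    R.coinvDualMap (Ideal.Quotient.mk (coinvIdeal R.group) f) = R.dualMap f := by
  change R.dualMap _ = _
  rw [← sub_eq_zero, ← map_sub]
  refine dualMap_of_mem_coinvIdeal (Ideal.Quotient.eq.1 ?_)
  exact Function.surjInv_eq Ideal.Quotient.mk_surjective _

theorem mem_relDeg {i : ℕ} {x : R.RelCoinv Θ} : x ∈ R.relDeg Θ i ↔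
    ∃ f ∈ symDeg V i, Ideal.Quotient.mk (coinvIdeal R.group) f = x := Iff.rfl

theorem mul_mem_relDeg {i j : ℕ} {x y : R.RelCoinv Θ} (hx : x ∈ R.relDeg Θ i)
    (hy : y ∈ R.relDeg Θ j) : x * y ∈ R.relDeg Θ (i + j) := by
  obtain ⟨f, hf, hfx⟩ := mem_relDeg.1 hx
  obtain ⟨g, hg, hgy⟩ := mem_relDeg.1 hy
  exact mem_relDeg.2 ⟨f * g, mul_mem_symDeg hf hg, by rw [map_mul, hfx, hgy]; rfl⟩

theorem sub_symAct_mem (hΘ : Θ ⊆ R.simple) {x : R.RelCoinv Θ} {f : SymmetricAlgebra ℝ V}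
    (hf : Ideal.Quotient.mk (coinvIdeal R.group) f = x) {α : V} (hα : α ∈ Θ) :
    f - symAct (rootRefl α) f ∈ coinvIdeal R.group := by
  have := x.2 ⟨rootRefl α, rootRefl_mem_group (hΘ hα)⟩ (rootRefl_mem_reflGroup hα)
  rw [← hf] at this
  exact Ideal.Quotient.eq.1 this.symm

/-- On the ring of `W_Θ`-invariants, only the functionals of minimal coset representatives are
nonzero. -/
theorem coinvDualMap_eq_zero (hΘ : Θ ⊆ R.simple) (x : R.RelCoinv Θ) {w : R.group}
    (hw : ¬ R.IsMinRep Θ (w : V ≃ₗᵢ[ℝ] V)) : R.coinvDualMap x w = 0 := by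
  obtain ⟨f, hf⟩ := Ideal.Quotient.mk_surjective (x : CoinvRing R.group)
  simp only [IsMinRep, not_forall] at hw
  obtain ⟨α, hα, hn⟩ := hw
  have hs := hΘ hα
  rw [← hf, coinvDualMap_mk]
  have hmem := dd_mem_coinvIdeal hs (sub_symAct_mem hΘ hf hα)
  rw [map_sub, dd_symAct (simple_ne_zero hs), sub_neg_eq_add] at hmem
  have hzero := dualMap_of_mem_coinvIdeal hmem
  rw [map_add, ← two_smul ℝ, smul_eq_zero_iff_right two_ne_zero] at hzero
  set s : R.group := ⟨rootRefl α, rootRefl_mem_group hs⟩ with hsdef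
  have hss : w * s * s = w := by
    rw [mul_assoc, show s * s = 1 from Subtype.ext (rootRefl_mul_self α), mul_one]
  have hpos : ((w * s : R.group) : V ≃ₗᵢ[ℝ] V) α ∈ R.posRoots := by
    change (w : V ≃ₗᵢ[ℝ] V) (rootRefl α α) ∈ _
    rw [rootRefl_self, map_neg]
    exact (neg_mem_posRoots_iff (map_mem_roots w.2 (R.simple_subset hs))).2 hn
  have := (dualMap_dd hs f (w * s)).1 hpos
  rw [hss, hzero] at this
  exact this.symm

theorem eq_zero_of_coinvDualMap {i : ℕ} {x : R.RelCoinv Θ} (hx : x ∈ R.relDeg Θ i)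
    (h : R.coinvDualMap x = 0) : x = 0 := by
  obtain ⟨f, hf, hfx⟩ := mem_relDeg.1 hx
  rw [← hfx, coinvDualMap_mk] at h
  refine Subtype.ext ?_
  rw [← hfx]
  exact Ideal.Quotient.eq_zero_iff_mem.2 ((mem_coinvIdeal_iff hf).2 h)

theorem coinvDualMap_eq_zero_of_len {i : ℕ} {x : R.RelCoinv Θ} (hx : x ∈ R.relDeg Θ i)
    {w : R.group} (hw : R.len (w : V ≃ₗᵢ[ℝ] V) ≠ i) : R.coinvDualMap x w = 0 := by
  obtain ⟨f, hf, hfx⟩ := mem_relDeg.1 hx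
  rw [← hfx, coinvDualMap_mk]
  exact dualMap_apply_eq_zero hf hw

/-- A class fixed by the generators of `W_Θ` is fixed by `W_Θ`. -/
theorem mem_relCoinv_of_generators {x : CoinvRing R.group} (hΘ : Θ ⊆ R.simple)
    (h : ∀ α (hα : α ∈ Θ), coinvAct R.group ⟨rootRefl α, rootRefl_mem_group (hΘ hα)⟩ x = x) :
    x ∈ R.RelCoinv Θ := by
  rintro ⟨w, hwg⟩ hw
  change w ∈ reflGroup Θ at hw
  obtain ⟨L, hL, rfl⟩ := exists_word hw
  obtain ⟨f, rfl⟩ := Ideal.Quotient.mk_surjective x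
  change Ideal.Quotient.mk (coinvIdeal R.group) (symAct (prodRefl L) f) = _
  clear hw hwg
  induction L with
  | nil => rw [prodRefl_nil, symAct_one]
  | cons α L ih =>
    rw [List.forall_mem_cons] at hL
    have h1 := h α hL.1
    change Ideal.Quotient.mk (coinvIdeal R.group) (symAct (rootRefl α) f) = _ at h1
    rw [prodRefl_cons, symAct_mul, ← h1, Ideal.Quotient.eq, ← map_sub]
    exact coinvIdeal_le_comap R.group ⟨rootRefl α, rootRefl_mem_group (hΘ hL.1)⟩
      (Ideal.Quotient.eq.1 (ih hL.2))

theorem exists_coinvDualMap_eq (hΘ : Θ ⊆ R.simple) {i : ℕ} {g : R.group → ℝ}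
    (hg : ∀ w : R.group, R.len (w : V ≃ₗᵢ[ℝ] V) ≠ i → g w = 0)
    (hmin : ∀ w : R.group, ¬ R.IsMinRep Θ (w : V ≃ₗᵢ[ℝ] V) → g w = 0) :
    ∃ x ∈ R.relDeg Θ i, R.coinvDualMap x = g := by
  obtain ⟨f, hf, rfl⟩ := exists_dualMap_eq hg
  have hx : Ideal.Quotient.mk (coinvIdeal R.group) f ∈ R.RelCoinv Θ := by
    refine mem_relCoinv_of_generators hΘ fun α hα => ?_
    have hs := hΘ hα
    change Ideal.Quotient.mk (coinvIdeal R.group) (symAct (rootRefl α) f) = _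
    rw [eq_comm, Ideal.Quotient.eq, ← ι_mul_dd]
    refine Ideal.mul_mem_left _ _ ?_
    have hzero : R.dualMap (dd α f) = 0 := by
      ext w
      by_cases hp : (w : V ≃ₗᵢ[ℝ] V) α ∈ R.posRoots
      · rw [(dualMap_dd hs f w).1 hp]
        refine hmin _ fun hm => ?_
        have := hm α hα
        change (w : V ≃ₗᵢ[ℝ] V) (rootRefl α α) ∈ _ at this
        rw [rootRefl_self, map_neg] at this
        exact neg_notMem_posRoots hp this
      · exact (dualMap_dd hs f w).2 hp
    cases i with
    | zero =>
      obtain ⟨c, rfl⟩ := mem_symDeg_zero.1 hf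
      rw [dd_algebraMap (simple_ne_zero hs)]
      exact zero_mem _
    | succ n => exact (mem_coinvIdeal_iff (dd_mem_symDeg (simple_ne_zero hs) hf)).2 hzero
  exact ⟨⟨_, hx⟩, mem_relDeg.2 ⟨f, hf, rfl⟩, coinvDualMap_mk f⟩

open Classical in
/-- The Chevalley formula for multiplication by the class of a linear form. -/
theorem coinvDualMap_mul {v : V} {l : R.RelCoinv Θ}
    (hl : Ideal.Quotient.mk (coinvIdeal R.group) (SymmetricAlgebra.ι ℝ V v) = l)
    (x : R.RelCoinv Θ) (w : R.group) (F : V → ℝ)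
    (hF : ∀ γ (hγ : γ ∈ R.posRoots), R.coinvDualMap x
      (w * ⟨rootRefl γ, rootRefl_mem_group_of_mem_posRoots hγ⟩) = F γ) :
    R.coinvDualMap ((l * x : R.RelCoinv Θ) : CoinvRing R.group) w =
      ∑ γ ∈ R.invs w with R.len ((w : V ≃ₗᵢ[ℝ] V) * rootRefl γ) + 1 = R.len (w : V ≃ₗᵢ[ℝ] V),
        coPair v γ * F γ := by
  obtain ⟨f, hf⟩ := Ideal.Quotient.mk_surjective (x : CoinvRing R.group)
  have hmul : ((l * x : R.RelCoinv Θ) : CoinvRing R.group) =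
      Ideal.Quotient.mk (coinvIdeal R.group) (SymmetricAlgebra.ι ℝ V v * f) := by
    rw [map_mul, hl, hf]; rfl
  rw [hmul, coinvDualMap_mk, dualMap_apply, ddGroup_ι_mul w.2, map_add, map_mul,
    SymmetricAlgebra.algebraMapInv_ι, zero_mul, zero_add, map_sum]
  refine Finset.sum_congr rfl fun γ hγ => ?_
  rw [Finset.mem_filter, mem_invs] at hγ
  rw [map_smul, smul_eq_mul, ← hF γ hγ.1.1, ← hf, coinvDualMap_mk]
  rfl

open Classical in
variable (R) in
/-- The value at a root `a = w θ` of the function attached to an element of the ring of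
`W_Θ`-invariants: the functional of the minimal coset representative `w`. It is zero on vectors that
are not roots. -/
def rootFun (Θ : Set V) (θ : V) : R.RelCoinv Θ →ₗ[ℝ] (V → ℝ) :=
  LinearMap.pi fun a =>
    if h : ∃ w : R.group, R.IsMinRep Θ (w : V ≃ₗᵢ[ℝ] V) ∧ (w : V ≃ₗᵢ[ℝ] V) θ = a then
      LinearMap.proj h.choose ∘ₗ R.coinvDualMap ∘ₗ (R.RelCoinv Θ).val.toLinearMap
    else 0

theorem rootFun_apply (h : R.IsDominantRoot Θ θ) (x : R.RelCoinv Θ) {w : R.group}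
    (hw : R.IsMinRep Θ (w : V ≃ₗᵢ[ℝ] V)) :
    R.rootFun Θ θ x ((w : V ≃ₗᵢ[ℝ] V) θ) = R.coinvDualMap x w := by
  have hex : ∃ u : R.group, R.IsMinRep Θ (u : V ≃ₗᵢ[ℝ] V) ∧
      (u : V ≃ₗᵢ[ℝ] V) θ = (w : V ≃ₗᵢ[ℝ] V) θ := ⟨w, hw, rfl⟩
  rw [rootFun, LinearMap.pi_apply, dif_pos hex]
  have := h.eq_of_isMinRep hex.choose_spec.1 hw hex.choose_spec.2
  change R.coinvDualMap x hex.choose = _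
  rw [this]

theorem rootFun_of_notMem (h : R.IsDominantRoot Θ θ) (x : R.RelCoinv Θ) {a : V}
    (ha : a ∉ R.roots) : R.rootFun Θ θ x a = 0 := by
  rw [rootFun, LinearMap.pi_apply, dif_neg]
  · rfl
  · rintro ⟨w, -, rfl⟩
    exact ha (map_mem_roots w.2 h.mem)

theorem rootFun_eq_zero (h : R.IsDominantRoot Θ θ) {i : ℕ} {x : R.RelCoinv Θ}
    (hx : x ∈ R.relDeg Θ i) {a : V} (ha : R.lev a ≠ i) : R.rootFun Θ θ x a = 0 := by
  by_cases hroot : a ∈ R.roots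
  · obtain ⟨w, hw, rfl⟩ := h.exists_isMinRep hroot
    rw [rootFun_apply h x hw]
    exact coinvDualMap_eq_zero_of_len hx (((h.isMinRep_iff w.2).1 hw) ▸ ha)
  · exact rootFun_of_notMem h x hroot

theorem eq_zero_of_rootFun (h : R.IsDominantRoot Θ θ) {i : ℕ} {x : R.RelCoinv Θ}
    (hx : x ∈ R.relDeg Θ i) (h0 : ∀ a ∈ R.roots, R.rootFun Θ θ x a = 0) : x = 0 := by
  refine eq_zero_of_coinvDualMap hx ?_
  ext w
  by_cases hw : R.IsMinRep Θ (w : V ≃ₗᵢ[ℝ] V)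
  · rw [← rootFun_apply h x hw, h0 _ (map_mem_roots w.2 h.mem), Pi.zero_apply]
  · exact coinvDualMap_eq_zero h.subset x hw

theorem exists_rootFun_eq (h : R.IsDominantRoot Θ θ) {i : ℕ} {g : V → ℝ}
    (hg : ∀ a, R.lev a ≠ i → g a = 0) :
    ∃ x ∈ R.relDeg Θ i, ∀ a ∈ R.roots, R.rootFun Θ θ x a = g a := by
  classical
  have hex : ∃ x ∈ R.relDeg Θ i, R.coinvDualMap x = fun w : R.group =>
      if R.IsMinRep Θ (w : V ≃ₗᵢ[ℝ] V) then g ((w : V ≃ₗᵢ[ℝ] V) θ) else 0 := by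
    refine exists_coinvDualMap_eq h.subset (fun w hw => ?_) (fun w hw => if_neg hw)
    split_ifs with hmin
    · exact hg _ (((h.isMinRep_iff w.2).1 hmin) ▸ hw)
    · rfl
  obtain ⟨x, hx, hxg⟩ := hex
  refine ⟨x, hx, fun a ha => ?_⟩
  obtain ⟨w, hw, rfl⟩ := h.exists_isMinRep ha
  rw [rootFun_apply h x hw, hxg]
  exact if_pos hw

open Classical in
variable (R) in
/-- The positive roots `γ` whose reflection lowers the level of `a` by one. -/
def downRefls (a : V) : Finset V :=
  R.posFinset.filter fun γ => inner ℝ a γ < 0 ∧ R.lev (rootRefl γ a) + 1 = R.lev a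

theorem mem_downRefls {a γ : V} : γ ∈ R.downRefls a ↔
    γ ∈ R.posRoots ∧ inner ℝ a γ < 0 ∧ R.lev (rootRefl γ a) + 1 = R.lev a := by
  simp [downRefls]

/-- The Chevalley formula in terms of roots: multiplication by the class of `c θ`. -/
theorem rootFun_mul (h : R.IsDominantRoot Θ θ) {c : ℝ} {l : R.RelCoinv Θ}
    (hl : Ideal.Quotient.mk (coinvIdeal R.group) (SymmetricAlgebra.ι ℝ V (c • θ)) = l)
    (x : R.RelCoinv Θ) {a : V} (ha : a ∈ R.roots) :
    R.rootFun Θ θ (l * x) a =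
      c * ∑ γ ∈ R.downRefls a, -coPair a γ * R.rootFun Θ θ x (rootRefl γ a) := by
  classical
  obtain ⟨w, hw, rfl⟩ := h.exists_isMinRep ha
  have hw1 : ∀ y, (w : V ≃ₗᵢ[ℝ] V) ((w : V ≃ₗᵢ[ℝ] V)⁻¹ y) = y := (w : V ≃ₗᵢ[ℝ] V).apply_symm_apply
  have hw2 : ∀ y, (w : V ≃ₗᵢ[ℝ] V)⁻¹ ((w : V ≃ₗᵢ[ℝ] V) y) = y := (w : V ≃ₗᵢ[ℝ] V).symm_apply_apply
  have hlev := (h.isMinRep_iff w.2).1 hw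
  have hconj : ∀ β, ((w : V ≃ₗᵢ[ℝ] V) * rootRefl β) θ =
      rootRefl (-((w : V ≃ₗᵢ[ℝ] V) β)) ((w : V ≃ₗᵢ[ℝ] V) θ) := by
    intro β
    rw [rootRefl_neg, rootRefl_map]
    change _ = (w : V ≃ₗᵢ[ℝ] V) (rootRefl β ((w : V ≃ₗᵢ[ℝ] V)⁻¹ ((w : V ≃ₗᵢ[ℝ] V) θ)))
    rw [hw2]
    rfl
  set F : V → ℝ := fun γ => if R.IsMinRep Θ ((w : V ≃ₗᵢ[ℝ] V) * rootRefl γ) then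
    R.rootFun Θ θ x (((w : V ≃ₗᵢ[ℝ] V) * rootRefl γ) θ) else 0 with hF
  have hFeq : ∀ γ (hγ : γ ∈ R.posRoots), R.coinvDualMap x
      (w * ⟨rootRefl γ, rootRefl_mem_group_of_mem_posRoots hγ⟩) = F γ := by
    intro γ hγ
    have hcoe : ((w * ⟨rootRefl γ, rootRefl_mem_group_of_mem_posRoots hγ⟩ : R.group) :
        V ≃ₗᵢ[ℝ] V) = (w : V ≃ₗᵢ[ℝ] V) * rootRefl γ := rfl
    by_cases hmin : R.IsMinRep Θ ((w : V ≃ₗᵢ[ℝ] V) * rootRefl γ)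
    · have hF1 : F γ = _ := if_pos hmin
      rw [← hcoe] at hmin
      rw [hF1, ← hcoe]
      exact (rootFun_apply h x hmin).symm
    · have hF1 : F γ = _ := if_neg hmin
      rw [← hcoe] at hmin
      rw [hF1]
      exact coinvDualMap_eq_zero h.subset x hmin
  rw [rootFun_apply h _ hw, coinvDualMap_mul hl x w F hFeq, Finset.mul_sum,
    ← Finset.sum_filter_of_ne (p := fun γ => R.IsMinRep Θ ((w : V ≃ₗᵢ[ℝ] V) * rootRefl γ))]
  swap
  · intro γ _ hne
    by_contra hmin
    exact hne (by rw [hF]; simp only [if_neg hmin, mul_zero])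
  refine Finset.sum_nbij' (fun β => -((w : V ≃ₗᵢ[ℝ] V) β)) (fun γ => -((w : V ≃ₗᵢ[ℝ] V)⁻¹ γ))
    ?_ ?_ ?_ ?_ ?_
  · intro β hβ
    simp only [Finset.mem_filter, mem_invs] at hβ
    obtain ⟨⟨⟨hβ, hneg⟩, hlen⟩, hmin⟩ := hβ
    rw [mem_downRefls, ← hconj, hlev,
      (h.isMinRep_iff (mul_mem w.2 (rootRefl_mem_group_of_mem_posRoots hβ))).1 hmin]
    refine ⟨(neg_mem_posRoots_iff (map_mem_roots w.2 hβ.1)).2 hneg, ?_, hlen⟩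
    rw [inner_neg_right, LinearIsometryEquiv.inner_map_map, neg_lt_zero]
    exact (h.inner_nonneg hβ.2).1.lt_of_ne fun h0 =>
      hneg (hw.map_mem_posRoots h w.2 hβ h0.symm)
  · intro γ hγ
    rw [mem_downRefls] at hγ
    obtain ⟨hγ, hin, hl⟩ := hγ
    simp only [Finset.mem_filter, mem_invs]
    have hpos : 0 < inner ℝ θ (-((w : V ≃ₗᵢ[ℝ] V)⁻¹ γ)) := by
      rw [← (w : V ≃ₗᵢ[ℝ] V).inner_map_map, map_neg, hw1, inner_neg_right]
      linarith
    have hβ := h.mem_posRoots_of_inner_pos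
      (neg_mem_roots (map_mem_roots (inv_mem w.2) hγ.1)) hpos
    have hneg : (w : V ≃ₗᵢ[ℝ] V) (-((w : V ≃ₗᵢ[ℝ] V)⁻¹ γ)) ∉ R.posRoots := by
      rw [map_neg, hw1]
      exact neg_notMem_posRoots hγ
    have hmem := mul_mem w.2 (rootRefl_mem_group_of_mem_posRoots hβ)
    have h1 := len_mul_rootRefl_lt w.2 hβ hneg
    have h2 := h.lev_le_len hmem
    have h3 := hconj (-((w : V ≃ₗᵢ[ℝ] V)⁻¹ γ))
    rw [map_neg, hw1, neg_neg] at h3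
    rw [h.isMinRep_iff hmem]
    rw [h3] at h2 ⊢
    rw [hlev] at hl
    exact ⟨⟨⟨hβ, hneg⟩, by omega⟩, by omega⟩
  · intro β _
    simp
  · intro γ _
    simp
  · intro β hβ
    rw [Finset.mem_filter] at hβ
    simp only [hF, if_pos hβ.2, hconj]
    have : coPair ((w : V ≃ₗᵢ[ℝ] V) θ) (-((w : V ≃ₗᵢ[ℝ] V) β)) = -coPair θ β := by
      rw [← coPair_map (w : V ≃ₗᵢ[ℝ] V) θ β]
      simp [coPair, neg_div]
    rw [this, neg_neg, ← mul_assoc]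
    congr 1
    simp only [coPair, inner_smul_left, RCLike.conj_to_real]
    ring

end BasedRootSystem

namespace BasedRootSystem

variable {R : BasedRootSystem V} {Θ : Set V} {θ : V}

/-! ### The middle levels of the roots -/

open Classical in
theorem card_inner_ne_zero_map {w : V ≃ₗᵢ[ℝ] V} (hw : w ∈ R.group) (a : V) :
    (R.posFinset.filter fun γ => inner ℝ (w a) γ ≠ 0).card =
      (R.posFinset.filter fun γ => inner ℝ a γ ≠ 0).card := by
  rw [group_eq] at hw
  obtain ⟨L, hL, rfl⟩ := exists_word hw
  clear hw
  induction L with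
  | nil => rfl
  | cons α L ih =>
    rw [List.forall_mem_cons] at hL
    rw [← ih hL.2]
    have := card_filter_rootRefl hL.1 fun γ => inner ℝ (prodRefl L a) γ ≠ 0
    simp only [inner_neg_right, neg_ne_zero, Nat.add_right_cancel_iff] at this
    rw [← this, prodRefl_cons]
    simp only [← inner_rootRefl]
    rfl

theorem lev_add_lev_neg (a : V) [DecidablePred fun γ => inner ℝ a γ ≠ 0] :
    R.lev a + R.lev (-a) = (R.posFinset.filter fun γ => inner ℝ a γ ≠ 0).card := by
  classical
  have hu : R.posFinset.filter (fun γ => inner ℝ a γ ≠ 0) =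
      (R.posFinset.filter fun γ => inner ℝ a γ < 0) ∪
        R.posFinset.filter fun γ => inner ℝ (-a) γ < 0 := by
    rw [← Finset.filter_or]
    refine Finset.filter_congr fun γ _ => ?_
    rw [inner_neg_left, neg_lt_zero, ne_iff_lt_or_gt]
  rw [hu, Finset.card_union_of_disjoint]
  · rfl
  · refine Finset.disjoint_filter.2 fun γ _ h1 h2 => ?_
    rw [inner_neg_left] at h2
    linarith

/-- The levels of a root and of its negative have a constant odd sum `2 m + 1`, and the roots of
level `m` are the simple roots: a simple root exceeds its negative by a single reflection, and every
other positive root is lowered to a simple root by reflections that raise the level. -/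
theorem IsDominantRoot.exists_middle (h : R.IsDominantRoot Θ θ) :
    ∃ m, (∀ a ∈ R.roots, R.lev a + R.lev (-a) = 2 * m + 1) ∧
      ∀ a ∈ R.roots, R.lev a = m ↔ a ∈ R.simple := by
  classical
  obtain ⟨α₀, hα₀, -⟩ := exists_simple_conj h.mem
  have hconst : ∀ a ∈ R.roots, R.lev a + R.lev (-a) = R.lev θ + R.lev (-θ) := by
    intro a ha
    obtain ⟨w, hw, rfl⟩ := h.transitive a ha
    rw [lev_add_lev_neg, lev_add_lev_neg, card_inner_ne_zero_map hw]
  have hneg : ∀ α ∈ R.simple, R.lev (-α) = R.lev α + 1 := by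
    intro α hα
    rw [← lev_rootRefl hα (inner_self_pos (R.simple_subset hα)), rootRefl_self]
  have hsum : ∀ a ∈ R.roots, R.lev a + R.lev (-a) = 2 * R.lev α₀ + 1 := by
    intro a ha
    have h1 := hconst a ha
    have h2 := hconst α₀ (R.simple_subset hα₀)
    have h3 := hneg α₀ hα₀
    omega
  have hsimple : ∀ α ∈ R.simple, R.lev α = R.lev α₀ := by
    intro α hα
    have h1 := hsum α (R.simple_subset hα)
    have h2 := hneg α hα
    omega
  have hpos : ∀ β ∈ R.posRoots, R.lev β ≤ R.lev α₀ ∧ (R.lev β = R.lev α₀ → β ∈ R.simple) := by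
    refine posRoots_induction (fun α hα => ⟨(hsimple α hα).le, fun _ => hα⟩) ?_
    intro β _ α _ _ hl ih
    have := ih.1
    exact ⟨by omega, fun _ => by omega⟩
  refine ⟨R.lev α₀, hsum, fun a ha => ⟨fun hl => ?_, hsimple a⟩⟩
  rcases mem_posRoots_or ha with hp | hp
  · exact (hpos a hp).2 hl
  · have h1 := (hpos _ hp).1
    have h2 := hsum a ha
    omega

/-! ### The intersection form on functions on the roots -/

variable (R) in
/-- The roots as a finite set. -/
def rootFinset : Finset V := R.finite_roots.toFinset

@[simp] theorem mem_rootFinset {a : V} : a ∈ R.rootFinset ↔ a ∈ R.roots := by simp [rootFinset]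

variable (R) in
/-- The simple roots as a finite set. -/
def simpleFinset : Finset V := (R.finite_roots.subset R.simple_subset).toFinset

@[simp] theorem mem_simpleFinset {a : V} : a ∈ R.simpleFinset ↔ a ∈ R.simple := by
  simp [simpleFinset]

variable (R) in
/-- The bilinear form on functions on the roots that pairs the values at opposite roots. -/
def rootPair (g h : V → ℝ) : ℝ := ∑ a ∈ R.rootFinset, g a * h (-a)

theorem coPair_neg_left (v γ : V) : coPair (-v) γ = -coPair v γ := by
  simp [coPair, neg_div]

theorem coPair_rootRefl (a γ : V) : coPair (rootRefl γ a) γ = -coPair a γ := by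
  simp [coPair, inner_rootRefl, rootRefl_self, neg_div]

theorem mem_downRefls_neg {r : ℕ} (hr : ∀ a ∈ R.roots, R.lev a + R.lev (-a) = r) {a γ : V}
    (ha : a ∈ R.roots) (hγ : γ ∈ R.downRefls a) : γ ∈ R.downRefls (-(rootRefl γ a)) := by
  rw [mem_downRefls] at hγ ⊢
  obtain ⟨h1, h2, h3⟩ := hγ
  have h4 := hr a ha
  have h5 := hr _ (R.rootRefl_mem γ h1.1 a ha)
  refine ⟨h1, ?_, ?_⟩
  · rwa [inner_neg_left, inner_rootRefl, rootRefl_self, inner_neg_right, neg_neg]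
  · rw [map_neg, rootRefl_rootRefl]
    omega

section

variable {c : ℝ} {l : R.RelCoinv Θ}

/-- Multiplication by the class of a multiple of `θ` is self-adjoint. -/
theorem rootPair_mul_comm (h : R.IsDominantRoot Θ θ) {r : ℕ}
    (hr : ∀ a ∈ R.roots, R.lev a + R.lev (-a) = r)
    (hl : Ideal.Quotient.mk (coinvIdeal R.group) (SymmetricAlgebra.ι ℝ V (c • θ)) = l)
    (x y : R.RelCoinv Θ) :
    R.rootPair (R.rootFun Θ θ (l * x)) (R.rootFun Θ θ y) =
      R.rootPair (R.rootFun Θ θ x) (R.rootFun Θ θ (l * y)) := by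
  have hL : R.rootPair (R.rootFun Θ θ (l * x)) (R.rootFun Θ θ y) =
      ∑ a ∈ R.rootFinset, ∑ γ ∈ R.downRefls a,
        c * (-coPair a γ * R.rootFun Θ θ x (rootRefl γ a)) * R.rootFun Θ θ y (-a) := by
    refine Finset.sum_congr rfl fun a ha => ?_
    rw [rootFun_mul h hl x (mem_rootFinset.1 ha), Finset.mul_sum, Finset.sum_mul]
  have hR : R.rootPair (R.rootFun Θ θ x) (R.rootFun Θ θ (l * y)) =
      ∑ b ∈ R.rootFinset, ∑ γ ∈ R.downRefls (-b),
        R.rootFun Θ θ x b * (c * (-coPair (-b) γ * R.rootFun Θ θ y (rootRefl γ (-b)))) := by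
    refine Finset.sum_congr rfl fun b hb => ?_
    rw [rootFun_mul h hl y (neg_mem_roots (mem_rootFinset.1 hb)), Finset.mul_sum, Finset.mul_sum]
  rw [hL, hR, Finset.sum_sigma', Finset.sum_sigma']
  refine Finset.sum_nbij' (fun p => ⟨rootRefl p.2 p.1, p.2⟩) (fun p => ⟨rootRefl p.2 p.1, p.2⟩)
    ?_ ?_ ?_ ?_ ?_
  · rintro ⟨a, γ⟩ hp
    rw [Finset.mem_sigma, mem_rootFinset] at hp ⊢
    exact ⟨R.rootRefl_mem γ (mem_downRefls.1 hp.2).1.1 a hp.1, mem_downRefls_neg hr hp.1 hp.2⟩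
  · rintro ⟨b, γ⟩ hp
    rw [Finset.mem_sigma, mem_rootFinset] at hp ⊢
    refine ⟨R.rootRefl_mem γ (mem_downRefls.1 hp.2).1.1 b hp.1, ?_⟩
    have := mem_downRefls_neg hr (neg_mem_roots hp.1) hp.2
    rwa [map_neg, neg_neg] at this
  · rintro ⟨a, γ⟩ _
    simp [rootRefl_rootRefl]
  · rintro ⟨a, γ⟩ _
    simp [rootRefl_rootRefl]
  · rintro ⟨a, γ⟩ _
    simp only [coPair_neg_left, coPair_rootRefl, map_neg, rootRefl_rootRefl, neg_neg]
    ring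

theorem inner_simple_nonpos {α α' : V} (hα : α ∈ R.simple) (hα' : α' ∈ R.simple) (hne : α' ≠ α) :
    inner ℝ α α' ≤ 0 := by
  by_contra! hpos
  obtain ⟨φ, h1, h0⟩ := R.exists_coord hα
  have := R.coord_nonneg h1 h0 (rootRefl_mem_posRoots hα (simple_mem_posRoots hα') hne).2
  rw [rootRefl_apply, map_sub, map_smul, h1, h0 α' hα' hne, smul_eq_mul, mul_one,
    real_inner_comm] at this
  have := div_pos (mul_pos two_pos hpos) (inner_self_pos (R.simple_subset hα))
  linarith

/-- If the reflection in a positive root `γ ≠ α` takes `-α` to a simple root `α'`, then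
`k γ = α + α'` with `k` at most `-⟨α, α'^∨⟩`. -/
theorem coPair_le_of_rootRefl_neg {N : ℝ} (hN : ∀ β ∈ R.roots, inner ℝ β β = N) {α γ : V}
    (hα : α ∈ R.simple) (hγ : γ ∈ R.posRoots) (hne : γ ≠ α) (hpos : 0 < coPair α γ)
    (hs : rootRefl γ (-α) ∈ R.simple) :
    rootRefl γ (-α) ≠ α ∧ coPair α γ ≤ -(2 * inner ℝ α (rootRefl γ (-α)) / N) := by
  have hk : coPair α γ • γ = α + rootRefl γ (-α) := by
    rw [map_neg, rootRefl_apply, neg_sub, add_sub_cancel, coPair]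
  set α' := rootRefl γ (-α) with hα'
  set k := coPair α γ with hkdef
  have hne' : α' ≠ α := by
    intro he
    rw [he, ← two_smul ℝ] at hk
    have hγα : γ = (k⁻¹ * 2) • α := by rw [mul_smul, ← hk, smul_smul, inv_mul_cancel₀ hpos.ne',
      one_smul]
    rcases R.reduced α (R.simple_subset hα) _ (hγα ▸ hγ.1) with h1 | h1
    · exact hne (by rw [hγα, h1, one_smul])
    · have : 0 < k⁻¹ * 2 := by positivity
      linarith
  refine ⟨hne', ?_⟩
  have hN0 : 0 < N := hN γ hγ.1 ▸ inner_self_pos hγ.1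
  have hNα := hN α (R.simple_subset hα)
  set t := -(2 * inner ℝ α α' / N) with ht
  have hinner : 2 * inner ℝ α α' = -t * N := by rw [ht]; field_simp
  -- The squared length of `k γ = α + α'`.
  have hk2 : k ^ 2 = 2 - t := by
    have h1 : inner ℝ (k • γ) (k • γ) = k ^ 2 * N := by
      rw [inner_smul_left, inner_smul_right, hN γ hγ.1, RCLike.conj_to_real]
      ring
    have h2 : inner ℝ (α + α') (α + α') = (2 - t) * N := by
      rw [real_inner_add_add_self, hNα, hN α' (R.simple_subset hs), hinner]
      ring
    rw [hk, h2] at h1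
    exact (mul_right_cancel₀ hN0.ne' h1).symm
  -- The `α`-coordinate of the positive root `s_α γ` is nonnegative.
  have ht1 : 1 ≤ t := by
    obtain ⟨φ, h1, h0⟩ := R.exists_coord hα
    have hc := R.coord_nonneg h1 h0 (rootRefl_mem_posRoots hα hγ hne).2
    have hrefl : k • rootRefl α γ = (t - 1) • α + α' := by
      rw [← map_smul, hk, map_add, rootRefl_self, rootRefl_apply α α', real_inner_comm, hinner, hNα,
        mul_div_assoc, div_self hN0.ne', mul_one]
      module
    have hφ := congrArg φ hrefl
    rw [map_smul, map_add, map_smul, h1, h0 α' hs hne', smul_eq_mul, smul_eq_mul] at hφ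
    nlinarith [mul_nonneg hpos.le hc]
  nlinarith

/-- The form `⟨x, l x⟩` on the middle degree dominates the form `|∑ |x_α| α|²`, so that it is
positive definite by the linear independence of the simple roots. -/
theorem eq_zero_of_rootPair_nonpos (h : R.IsDominantRoot Θ θ) (hc : 0 < c) {m : ℕ}
    (hr : ∀ a ∈ R.roots, R.lev a + R.lev (-a) = 2 * m + 1)
    (hm : ∀ a ∈ R.roots, R.lev a = m ↔ a ∈ R.simple)
    (hl : Ideal.Quotient.mk (coinvIdeal R.group) (SymmetricAlgebra.ι ℝ V (c • θ)) = l)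
    {x : R.RelCoinv Θ} (hx : x ∈ R.relDeg Θ m)
    (h0 : R.rootPair (R.rootFun Θ θ x) (R.rootFun Θ θ (l * x)) ≤ 0) : x = 0 := by
  classical
  set g := R.rootFun Θ θ x with hg
  set N : ℝ := inner ℝ θ θ with hNdef
  have hN : ∀ β ∈ R.roots, inner ℝ β β = N := by
    intro β hβ
    obtain ⟨w, -, rfl⟩ := h.transitive β hβ
    exact w.inner_map_map θ θ
  have hN0 : 0 < N := inner_self_pos h.mem
  have hsupp : R.rootPair g (R.rootFun Θ θ (l * x)) =
      ∑ α ∈ R.simpleFinset, g α * R.rootFun Θ θ (l * x) (-α) := by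
    refine (Finset.sum_subset (fun α hα => ?_) fun a ha hn => ?_).symm
    · exact mem_rootFinset.2 (R.simple_subset (mem_simpleFinset.1 hα))
    · rw [mem_simpleFinset, ← hm a (mem_rootFinset.1 ha)] at hn
      rw [hg, rootFun_eq_zero h hx hn, zero_mul]
  have hbound : ∀ α ∈ R.simpleFinset,
      c * ∑ α' ∈ R.simpleFinset, 2 * inner ℝ α α' / N * (|g α| * |g α'|) ≤
        g α * R.rootFun Θ θ (l * x) (-α) := by
    intro α hαF
    have hα := mem_simpleFinset.1 hαF
    have hroot := R.simple_subset hα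
    have hself : coPair α α = 2 := by
      rw [coPair, mul_div_assoc, div_self (inner_self_pos hroot).ne', mul_one]
    have hlevα := (hm α hroot).2 hα
    have hlev : R.lev (-α) = m + 1 := by have := hr α hroot; omega
    have hmem : α ∈ R.downRefls (-α) := by
      rw [mem_downRefls, inner_neg_left, neg_lt_zero, map_neg, rootRefl_self, neg_neg, hlevα, hlev]
      exact ⟨simple_mem_posRoots hα, inner_self_pos hroot, rfl⟩
    have hother : ∀ γ ∈ (R.downRefls (-α)).erase α, γ ∈ R.posRoots ∧ 0 < coPair α γ ∧
        rootRefl γ (-α) ∈ R.simple ∧ rootRefl γ (-α) ≠ α ∧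
        coPair α γ ≤ -(2 * inner ℝ α (rootRefl γ (-α)) / N) := by
      intro γ hγ
      rw [Finset.mem_erase, mem_downRefls, inner_neg_left, neg_lt_zero, hlev] at hγ
      obtain ⟨hne, hγp, hin, hl⟩ := hγ
      have hpos : 0 < coPair α γ := div_pos (mul_pos two_pos hin) (inner_self_pos hγp.1)
      have hs : rootRefl γ (-α) ∈ R.simple :=
        (hm _ (R.rootRefl_mem γ hγp.1 _ (neg_mem_roots hroot))).1 (by omega)
      exact ⟨hγp, hpos, hs, coPair_le_of_rootRefl_neg hN hα hγp hne hpos hs⟩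
    have hinj : Set.InjOn (fun γ => rootRefl γ (-α)) ((R.downRefls (-α)).erase α : Finset V) := by
      intro γ hγ γ' hγ' he
      obtain ⟨h1, h2, -⟩ := hother γ hγ
      obtain ⟨h1', h2', -⟩ := hother γ' hγ'
      have hk : ∀ γ, coPair α γ • γ = α + rootRefl γ (-α) := by
        intro γ
        rw [map_neg, rootRefl_apply, neg_sub, add_sub_cancel, coPair]
      have hkk : coPair α γ • γ = coPair α γ' • γ' := by
        rw [hk, hk]
        exact congrArg _ he
      have hγγ' : γ' = ((coPair α γ')⁻¹ * coPair α γ) • γ := by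
        rw [mul_smul, hkk, smul_smul, inv_mul_cancel₀ h2'.ne', one_smul]
      rcases R.reduced γ h1.1 _ (hγγ' ▸ h1'.1) with hr1 | hr1
      · rw [hγγ', hr1, one_smul]
      · have : 0 < (coPair α γ')⁻¹ * coPair α γ := by positivity
        linarith
    have hsum : ∑ γ ∈ (R.downRefls (-α)).erase α,
        -(2 * inner ℝ α (rootRefl γ (-α)) / N) * (|g α| * |g (rootRefl γ (-α))|) ≤
        ∑ α' ∈ R.simpleFinset.erase α, -(2 * inner ℝ α α' / N) * (|g α| * |g α'|) := by
      rw [← Finset.sum_image (f := fun α' => -(2 * inner ℝ α α' / N) * (|g α| * |g α'|)) hinj]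
      refine Finset.sum_le_sum_of_subset_of_nonneg ?_ ?_
      · intro α' hα'
        obtain ⟨γ, hγ, rfl⟩ := Finset.mem_image.1 hα'
        obtain ⟨-, -, h3, h4, -⟩ := hother γ hγ
        exact Finset.mem_erase.2 ⟨h4, mem_simpleFinset.2 h3⟩
      · intro α' hα' _
        rw [Finset.mem_erase, mem_simpleFinset] at hα'
        have := inner_simple_nonpos hα hα'.2 hα'.1
        refine mul_nonneg (neg_nonneg.2 (div_nonpos_of_nonpos_of_nonneg (by linarith) hN0.le)) ?_
        positivity
    have hterm : -(∑ γ ∈ (R.downRefls (-α)).erase α,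
        -(2 * inner ℝ α (rootRefl γ (-α)) / N) * (|g α| * |g (rootRefl γ (-α))|)) ≤
        ∑ γ ∈ (R.downRefls (-α)).erase α, g α * (coPair α γ * g (rootRefl γ (-α))) := by
      rw [← Finset.sum_neg_distrib]
      refine Finset.sum_le_sum fun γ hγ => ?_
      obtain ⟨-, h2, -, -, h5⟩ := hother γ hγ
      have h6 : -(|g α| * |g (rootRefl γ (-α))|) ≤ g α * g (rootRefl γ (-α)) := by
        rw [← abs_mul]; exact neg_abs_le _
      have h7 := mul_nonneg (abs_nonneg (g α)) (abs_nonneg (g (rootRefl γ (-α))))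
      nlinarith [mul_le_mul_of_nonneg_left h6 h2.le, mul_le_mul_of_nonneg_right h5 h7]
    rw [rootFun_mul h hl x (neg_mem_roots hroot), ← mul_assoc, mul_comm (g α) c, mul_assoc]
    refine mul_le_mul_of_nonneg_left ?_ hc.le
    rw [← Finset.add_sum_erase _ _ hmem, ← Finset.add_sum_erase _ _ hαF, map_neg, rootRefl_self,
      neg_neg, coPair_neg_left, hself, hN α hroot, mul_div_assoc, div_self hN0.ne', mul_one,
      abs_mul_abs_self, mul_add, Finset.mul_sum]
    simp only [coPair_neg_left, neg_neg, neg_mul, Finset.sum_neg_distrib] at hsum hterm ⊢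
    linarith
  set v : V := ∑ α ∈ R.simpleFinset, |g α| • α with hv
  have hvv : ∑ α ∈ R.simpleFinset, c * ∑ α' ∈ R.simpleFinset,
      2 * inner ℝ α α' / N * (|g α| * |g α'|) = 2 * c / N * inner ℝ v v := by
    rw [hv, sum_inner, Finset.mul_sum]
    refine Finset.sum_congr rfl fun α _ => ?_
    rw [inner_sum, Finset.mul_sum, Finset.mul_sum]
    refine Finset.sum_congr rfl fun α' _ => ?_
    rw [inner_smul_left, inner_smul_right, RCLike.conj_to_real]
    ring
  have hle := Finset.sum_le_sum hbound
  rw [hvv, ← hsupp] at hle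
  have hv0 : v = 0 := by
    rw [← real_inner_self_nonpos]
    have hcN : 0 < 2 * c / N := by positivity
    have := hle.trans h0
    exact nonpos_of_mul_nonpos_right this hcN
  refine eq_zero_of_rootFun h hx fun a ha => ?_
  by_cases hs : a ∈ R.simple
  · obtain ⟨φ, h1, h2⟩ := R.exists_coord hs
    have hφ := congrArg φ hv0
    rw [hv, map_sum, map_zero, Finset.sum_eq_single_of_mem a (mem_simpleFinset.2 hs), map_smul, h1,
      smul_eq_mul, mul_one, abs_eq_zero] at hφ
    · exact hφ
    · intro b hb hne
      rw [map_smul, h2 b (mem_simpleFinset.1 hb) hne, smul_zero]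
  · exact rootFun_eq_zero h hx fun he => hs ((hm a ha).1 he)

/-! ### Lefschetz elements -/

theorem pow_mul_mem_relDeg (hl : l ∈ R.relDeg Θ 1) {i : ℕ} {x : R.RelCoinv Θ}
    (hx : x ∈ R.relDeg Θ i) (k : ℕ) : l ^ k * x ∈ R.relDeg Θ (i + k) := by
  induction k with
  | zero => simpa using hx
  | succ k ih =>
    rw [pow_succ', mul_assoc, show i + (k + 1) = 1 + (i + k) by omega]
    exact mul_mem_relDeg hl ih

/-- The degree `i` part of the ring of relative coinvariants is the space of functions on the roots
of level `i`. -/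
def relDegEquiv (h : R.IsDominantRoot Θ θ) (i : ℕ) :
    R.relDeg Θ i ≃ₗ[ℝ] ({a : R.roots // R.lev (a : V) = i} → ℝ) :=
  LinearEquiv.ofBijective
    ((LinearMap.funLeft ℝ ℝ fun a : {a : R.roots // R.lev (a : V) = i} => (a : V)) ∘ₗ
      R.rootFun Θ θ ∘ₗ (R.relDeg Θ i).subtype) <| by
    constructor
    · refine (injective_iff_map_eq_zero _).2 fun x hx => Subtype.ext ?_
      refine eq_zero_of_rootFun h x.2 fun a ha => ?_
      by_cases hi : R.lev a = i
      · exact congrFun hx ⟨⟨a, ha⟩, hi⟩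
      · exact rootFun_eq_zero h x.2 hi
    · classical
      intro g
      obtain ⟨x, hx, hxg⟩ := exists_rootFun_eq h (i := i) (g := fun a =>
        if ha : ∃ ha : a ∈ R.roots, R.lev a = i then g ⟨⟨a, ha.1⟩, ha.2⟩ else 0)
        (fun a ha => dif_neg fun hc => ha hc.2)
      refine ⟨⟨x, hx⟩, funext fun a => ?_⟩
      exact (hxg a.1 a.1.2).trans (dif_pos ⟨a.1.2, a.2⟩)

theorem finrank_relDeg_eq (h : R.IsDominantRoot Θ θ) {r i : ℕ}
    (hr : ∀ a ∈ R.roots, R.lev a + R.lev (-a) = r) (hi : i ≤ r) :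
    Module.finrank ℝ (R.relDeg Θ i) = Module.finrank ℝ (R.relDeg Θ (r - i)) := by
  have : Finite R.roots := R.finite_roots
  have hneg : Function.Bijective fun a : {a : R.roots // R.lev (a : V) = i} =>
      (⟨⟨-(a : V), neg_mem_roots a.1.2⟩, by
        have := hr a a.1.2
        have := a.2
        change R.lev (-(a : V)) = r - i
        omega⟩ : {a : R.roots // R.lev (a : V) = r - i}) := by
    constructor
    · intro a b hab
      have := congrArg (fun x : {a : R.roots // R.lev (a : V) = r - i} => (x : V)) hab
      exact Subtype.ext (Subtype.ext (neg_injective this))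
    · intro b
      refine ⟨⟨⟨-(b : V), neg_mem_roots b.1.2⟩, ?_⟩, Subtype.ext (Subtype.ext (neg_neg _))⟩
      have := hr b b.1.2
      have := b.2
      change R.lev (-(b : V)) = i
      omega
  have : Fintype {a : R.roots // R.lev (a : V) = i} := Fintype.ofFinite _
  have : Fintype {a : R.roots // R.lev (a : V) = r - i} := Fintype.ofFinite _
  rw [(relDegEquiv h i).finrank_eq, (relDegEquiv h (r - i)).finrank_eq,
    Module.finrank_fintype_fun_eq_card, Module.finrank_fintype_fun_eq_card,
    Fintype.card_of_bijective hneg]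

theorem isTopDegree_relDeg (h : R.IsDominantRoot Θ θ) {r : ℕ}
    (hr : ∀ a ∈ R.roots, R.lev a + R.lev (-a) = r) : IsTopDegree (R.relDeg Θ) r := by
  classical
  constructor
  · have h0 : R.lev θ = 0 := by
      refine Finset.card_eq_zero.2 (Finset.filter_eq_empty_iff.2 fun β hβ => ?_)
      exact ((h.inner_nonneg (mem_posFinset.1 hβ).2).1).not_gt
    obtain ⟨x, hx, hxg⟩ := exists_rootFun_eq h (i := r) (g := fun a => if R.lev a = r then 1 else 0)
      (fun a ha => if_neg ha)
    intro hbot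
    rw [hbot, Submodule.mem_bot] at hx
    have := hxg (-θ) (neg_mem_roots h.mem)
    have hlev := hr θ h.mem
    rw [hx, map_zero, if_pos (by omega)] at this
    exact zero_ne_one this
  · intro i hi
    rw [eq_bot_iff]
    intro x hx
    refine eq_zero_of_rootFun h hx fun a ha => rootFun_eq_zero h hx ?_
    have := hr a ha
    omega

theorem _root_.IsTopDegree.eq {A : Type*} [CommRing A] [Algebra ℝ A] {𝒜 : ℕ → Submodule ℝ A}
    {r s : ℕ} (hr : IsTopDegree 𝒜 r) (hs : IsTopDegree 𝒜 s) : r = s := by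
  rcases lt_trichotomy r s with hlt | heq | hlt
  · exact absurd (hr.2 s hlt) hs.1
  · exact heq
  · exact absurd (hs.2 r hlt) hr.1

/-- Multiplication by a Lefschetz element is injective below the middle degree, and hence so is
multiplication by every element of which it is a multiple. -/
theorem hasWeakLefschetz_of_isLefschetzElement {l' : R.RelCoinv Θ} (hl : l ∈ R.relDeg Θ 1)
    (hl' : l' = c • l) (h : IsLefschetzElement (R.relDeg Θ) l') :
    HasWeakLefschetz (R.relDeg Θ) l := by
  obtain ⟨r, hr, -, hbij⟩ := h
  refine ⟨r, hr, hl, fun i hi => ⟨fun x hx => ?_, fun x hx y hy hxy => ?_⟩⟩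
  · simpa [add_comm] using mul_mem_relDeg hl hx
  · refine (hbij i hi.le).injOn hx hy ?_
    obtain ⟨k, hk⟩ : ∃ k, r - 2 * i = k + 1 := ⟨r - 2 * i - 1, by omega⟩
    change l * x = l * y at hxy
    rw [hk, pow_succ, mul_assoc, mul_assoc, hl', smul_mul_assoc, smul_mul_assoc, hxy]

/-- With `y = l ^ (m - i) x`, the equation `l ^ (2 m + 1 - 2 i) x = 0` gives `⟨y, l y⟩ = 0`, hence
`y = 0`, hence `x = 0` when `l` is injective below degree `m`. -/
theorem isLefschetzElement_of_hasWeakLefschetz (h : R.IsDominantRoot Θ θ) (hc : 0 < c)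
    (hl : Ideal.Quotient.mk (coinvIdeal R.group) (SymmetricAlgebra.ι ℝ V (c • θ)) = l)
    (hweak : HasWeakLefschetz (R.relDeg Θ) l) : IsLefschetzElement (R.relDeg Θ) l := by
  obtain ⟨m, hr, hm⟩ := h.exists_middle
  have htop := isTopDegree_relDeg h hr
  obtain ⟨r, hr', hl1, hweak⟩ := hweak
  obtain rfl := htop.eq hr'
  refine ⟨2 * m + 1, htop, hl1, fun i hi => ?_⟩
  have him : i ≤ m := by omega
  have hpair : ∀ k, ∀ x y : R.RelCoinv Θ,
      R.rootPair (R.rootFun Θ θ (l ^ k * x)) (R.rootFun Θ θ y) =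
        R.rootPair (R.rootFun Θ θ x) (R.rootFun Θ θ (l ^ k * y)) := by
    intro k
    induction k with
    | zero => simp
    | succ k ih =>
      intro x y
      rw [pow_succ', mul_assoc, rootPair_mul_comm h hr hl, ih, ← mul_assoc, mul_comm _ l]
  have hpow : ∀ k, ∀ x ∈ R.relDeg Θ i, i + k ≤ m → l ^ k * x = 0 → x = 0 := by
    intro k
    induction k with
    | zero => intro x _ _ hx0; simpa using hx0
    | succ k ih =>
      intro x hx hk hx0
      refine ih x hx (by omega) ?_
      refine (hweak (i + k) (by omega)).2 (pow_mul_mem_relDeg hl1 hx k) (zero_mem _) ?_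
      change l * (l ^ k * x) = l * 0
      rw [← mul_assoc, ← pow_succ', hx0, mul_zero]
  have hker : ∀ x ∈ R.relDeg Θ i, l ^ (2 * m + 1 - 2 * i) * x = 0 → x = 0 := by
    intro x hx hx0
    refine hpow (m - i) x hx (by omega) ?_
    have hy := pow_mul_mem_relDeg hl1 hx (m - i)
    rw [Nat.add_sub_cancel' him] at hy
    refine eq_zero_of_rootPair_nonpos h hc hr hm hl hy (le_of_eq ?_)
    rw [hpair, ← mul_assoc, ← mul_assoc, ← pow_succ, ← pow_add,
      show m - i + 1 + (m - i) = 2 * m + 1 - 2 * i by omega, hx0, map_zero]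
    simp [rootPair]
  have hmaps : ∀ x ∈ R.relDeg Θ i,
      LinearMap.mulLeft ℝ (l ^ (2 * m + 1 - 2 * i)) x ∈ R.relDeg Θ (2 * m + 1 - i) := by
    intro x hx
    have := pow_mul_mem_relDeg hl1 hx (2 * m + 1 - 2 * i)
    rwa [show i + (2 * m + 1 - 2 * i) = 2 * m + 1 - i by omega] at this
  have : Finite R.roots := R.finite_roots
  have : FiniteDimensional ℝ (R.relDeg Θ i) := (relDegEquiv h i).symm.finiteDimensional
  have : FiniteDimensional ℝ (R.relDeg Θ (2 * m + 1 - i)) :=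
    (relDegEquiv h (2 * m + 1 - i)).symm.finiteDimensional
  have hinj : ∀ x ∈ R.relDeg Θ i, ∀ y ∈ R.relDeg Θ i,
      l ^ (2 * m + 1 - 2 * i) * x = l ^ (2 * m + 1 - 2 * i) * y → x = y := by
    intro x hx y hy hxy
    exact sub_eq_zero.1 (hker _ (sub_mem hx hy) (by rw [mul_sub, sub_eq_zero, hxy]))
  have hinj' : Function.Injective
      ((LinearMap.mulLeft ℝ (l ^ (2 * m + 1 - 2 * i))).restrict hmaps) := fun x y hxy =>
    Subtype.ext (hinj x x.2 y y.2 (congrArg Subtype.val hxy))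
  have hsurj := (LinearMap.injective_iff_surjective_of_finrank_eq_finrank
    (finrank_relDeg_eq h hr (by omega))).1 hinj'
  refine ⟨hmaps, fun x hx y hy hxy => hinj x hx y hy hxy, fun y hy => ?_⟩
  obtain ⟨x, hx⟩ := hsurj ⟨y, hy⟩
  exact ⟨x, x.2, congrArg Subtype.val hx⟩

end

end BasedRootSystem

namespace BasedRootSystem

variable {R : BasedRootSystem V} {Θ : Set V} {θ : V}

/-! ### The class of the half sum of the roots -/

theorem inner_eq_zero_of_rootRefl_eq {α v : V} (hα : α ≠ 0) (h : rootRefl α v = v) :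
    inner ℝ v α = 0 := by
  rw [rootRefl_apply, sub_eq_self, smul_eq_zero_iff_left hα, div_eq_zero_iff] at h
  rcases h with h | h
  · linarith
  · exact absurd (inner_self_eq_zero.1 h) hα

theorem eq_zero_of_inner_simple {v : V} (hv : v ∈ Submodule.span ℝ R.simple)
    (h : ∀ α ∈ R.simple, inner ℝ v α = 0) : v = 0 := by
  have : ∀ x ∈ Submodule.span ℝ R.simple, inner ℝ v x = 0 := by
    intro x hx
    induction hx using Submodule.span_induction with
    | mem x hx => exact h x hx
    | zero => simp
    | add x y _ _ hx hy => rw [inner_add_right, hx, hy, add_zero]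
    | smul c x _ hx => rw [inner_smul_right, hx, mul_zero]
  exact inner_self_eq_zero.1 (this v hv)

theorem roots_subset_span {β : V} (hβ : β ∈ R.roots) : β ∈ Submodule.span ℝ R.simple := by
  have hle : ∀ x ∈ Submodule.span ℝ≥0 R.simple, x ∈ Submodule.span ℝ R.simple := fun x hx =>
    Submodule.span_le_restrictScalars ℝ≥0 ℝ R.simple hx
  rcases mem_posRoots_or hβ with h | h
  · exact hle _ h.2
  · exact neg_mem_iff.1 (hle _ h.2)

/-- When `Θ` omits a single simple root, the half sum of the positive roots outside the span of `Θ`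
is a positive multiple of the dominant root orthogonal to `Θ`. -/
theorem IsDominantRoot.exists_relRhoVec_eq (h : R.IsDominantRoot Θ θ) {δ : V} (hδ : δ ∈ R.simple)
    (hδΘ : δ ∉ Θ) (hall : ∀ α ∈ R.simple, α ≠ δ → α ∈ Θ) :
    ∃ c : ℝ, 0 < c ∧ R.relRhoVec Θ = c • θ := by
  have hfin : (R.relPosRoots Θ).Finite := R.finite_roots.subset fun x hx => hx.1.1
  have hρ : R.relRhoVec Θ = (1 / 2 : ℝ) • ∑ γ ∈ hfin.toFinset, γ := by
    rw [relRhoVec, finsum_mem_eq_finite_toFinset_sum _ hfin]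
  have hθδ := h.inner_pos δ hδ hδΘ
  set c : ℝ := inner ℝ (R.relRhoVec Θ) δ / inner ℝ θ δ with hc
  have heq : R.relRhoVec Θ = c • θ := by
    rw [← sub_eq_zero]
    refine eq_zero_of_inner_simple (sub_mem ?_ (Submodule.smul_mem _ _ (roots_subset_span h.mem)))
      fun α hα => ?_
    · rw [hρ]
      exact Submodule.smul_mem _ _ (sum_mem fun γ hγ =>
        roots_subset_span ((Set.Finite.mem_toFinset hfin).1 hγ).1.1)
    · rw [inner_sub_left, inner_smul_left, RCLike.conj_to_real]
      by_cases hne : α = δ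
      · rw [hne, hc, div_mul_cancel₀ _ hθδ.ne', sub_self]
      · have hαΘ := hall α hα hne
        rw [h.inner_eq_zero α hαΘ, mul_zero, sub_zero]
        exact inner_eq_zero_of_rootRefl_eq (simple_ne_zero hα) (R.rootRefl_relRhoVec h.subset hαΘ)
  refine ⟨c, ?_, heq⟩
  have hδmem : δ ∈ R.relPosRoots Θ := by
    refine ⟨simple_mem_posRoots hδ, fun hs => ?_⟩
    have : ∀ x ∈ Submodule.span ℝ Θ, inner ℝ θ x = 0 := by
      intro x hx
      induction hx using Submodule.span_induction with
      | mem x hx => exact h.inner_eq_zero x hx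
      | zero => simp
      | add x y _ _ hx hy => rw [inner_add_right, hx, hy, add_zero]
      | smul c x _ hx => rw [inner_smul_right, hx, mul_zero]
    exact hθδ.ne' (this δ hs)
  have hpos : 0 < inner ℝ θ (R.relRhoVec Θ) := by
    rw [hρ, inner_smul_right, inner_sum]
    refine mul_pos (by norm_num) (Finset.sum_pos' (fun γ hγ => ?_)
      ⟨δ, (Set.Finite.mem_toFinset hfin).2 hδmem, hθδ⟩)
    exact (h.inner_nonneg ((Set.Finite.mem_toFinset hfin).1 hγ).1.2).1
  rw [heq, inner_smul_right] at hpos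
  exact (pos_iff_pos_of_mul_pos hpos).2 (inner_self_pos h.mem)

theorem relRho_mem_relDeg (hΘ : Θ ⊆ R.simple) : R.relRho hΘ ∈ R.relDeg Θ 1 :=
  mem_relDeg.2 ⟨_, ι_mem_symDeg _, rfl⟩

/-- When `Θ` omits a single simple root, the degree one part of the ring of `W_Θ`-invariants is
spanned by the class of the half sum of the roots. -/
theorem IsDominantRoot.exists_eq_smul_relRho (h : R.IsDominantRoot Θ θ) {δ : V}
    (hδ : δ ∈ R.simple) (hδΘ : δ ∉ Θ) (hall : ∀ α ∈ R.simple, α ≠ δ → α ∈ Θ)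
    {l : R.RelCoinv Θ} (hl : l ∈ R.relDeg Θ 1) : ∃ c : ℝ, l = c • R.relRho h.subset := by
  obtain ⟨f, hf, hfl⟩ := mem_relDeg.1 hl
  rw [symDeg, pow_one] at hf
  obtain ⟨v, rfl⟩ := hf
  have hperp : ∀ α ∈ Θ, inner ℝ v α = 0 := by
    intro α hα
    have hα0 := simple_ne_zero (h.subset hα)
    have hmem := sub_symAct_mem h.subset hfl hα
    rw [← ι_mul_dd, dd_ι hα0] at hmem
    have h1 := dd_mem_coinvIdeal (h.subset hα) hmem
    rw [dd_ι_mul hα0, dd_algebraMap hα0, mul_zero, zero_add] at h1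
    have h2 := constTerm_ddWord_of_mem_coinvIdeal (L := []) (by simp) h1
    rw [ddWord_nil, map_smul, AlgHom.commutes, Algebra.algebraMap_self_apply, smul_eq_mul,
      coPair, coPair, mul_div_assoc 2 (inner ℝ α α),
      div_self (inner_self_pos (R.simple_subset (h.subset hα))).ne'] at h2
    have h3 := (mul_eq_zero.1 h2).resolve_left (by norm_num)
    rcases div_eq_zero_iff.1 h3 with h3 | h3
    · linarith
    · exact absurd (inner_self_eq_zero.1 h3) hα0
  obtain ⟨c, hc, hρ⟩ := h.exists_relRhoVec_eq hδ hδΘ hall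
  have hθδ := h.inner_pos δ hδ hδΘ
  set c' : ℝ := inner ℝ v δ / (c * inner ℝ θ δ) with hc'
  have hu : ∀ α ∈ R.simple, inner ℝ (v - c' • R.relRhoVec Θ) α = 0 := by
    intro α hα
    rw [hρ, inner_sub_left, inner_smul_left, inner_smul_left, RCLike.conj_to_real,
      RCLike.conj_to_real]
    by_cases hne : α = δ
    · rw [hne, hc', div_mul_cancel₀ _ (mul_pos hc hθδ).ne', sub_self]
    · have hαΘ := hall α hα hne
      rw [hperp α hαΘ, h.inner_eq_zero α hαΘ, mul_zero, mul_zero, sub_zero]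
  have hinv : R.IsInv (SymmetricAlgebra.ι ℝ V (v - c' • R.relRhoVec Θ)) := by
    intro w hw
    rw [group_eq] at hw
    obtain ⟨L, hL, rfl⟩ := exists_word hw
    clear hw
    rw [symAct_ι]
    congr 1
    induction L with
    | nil => rfl
    | cons α L ih =>
      rw [List.forall_mem_cons] at hL
      rw [prodRefl_cons]
      change rootRefl α (prodRefl L _) = _
      rw [ih hL.2, rootRefl_eq_self (hu α hL.1)]
  refine ⟨c', Subtype.ext ?_⟩
  have hmem : SymmetricAlgebra.ι ℝ V v -
      SymmetricAlgebra.ι ℝ V (c' • R.relRhoVec Θ) ∈ coinvIdeal R.group := by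
    rw [← map_sub]
    exact Ideal.subset_span ⟨hinv, 1, one_pos, ι_mem_symDeg _⟩
  rw [← hfl, Ideal.Quotient.eq.2 hmem, map_smul]
  rfl

/-- When the dominant root orthogonal to `Θ` exists and `Θ` omits a single simple root, the weak
Lefschetz property, the strong one, and the Lefschetz property of the half sum are equivalent. -/
theorem IsDominantRoot.lefschetz_iff (h : R.IsDominantRoot Θ θ) {δ : V} (hδ : δ ∈ R.simple)
    (hδΘ : δ ∉ Θ) (hall : ∀ α ∈ R.simple, α ≠ δ → α ∈ Θ) (hΘ : Θ ⊆ R.simple) :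
    (HasStrongLefschetz (R.relDeg Θ) ↔ HasWeakLefschetz (R.relDeg Θ) (R.relRho hΘ)) ∧
      (IsLefschetzElement (R.relDeg Θ) (R.relRho hΘ) ↔
        HasWeakLefschetz (R.relDeg Θ) (R.relRho hΘ)) := by
  obtain ⟨c, hc, hρ⟩ := h.exists_relRhoVec_eq hδ hδΘ hall
  have hweak : HasWeakLefschetz (R.relDeg Θ) (R.relRho hΘ) →
      IsLefschetzElement (R.relDeg Θ) (R.relRho hΘ) := by
    refine isLefschetzElement_of_hasWeakLefschetz h hc ?_
    rw [← hρ]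
    rfl
  have hstrong : ∀ l, IsLefschetzElement (R.relDeg Θ) l →
      HasWeakLefschetz (R.relDeg Θ) (R.relRho hΘ) := by
    intro l hl
    obtain ⟨c', hc'⟩ := h.exists_eq_smul_relRho hδ hδΘ hall hl.choose_spec.2.1
    exact hasWeakLefschetz_of_isLefschetzElement (relRho_mem_relDeg hΘ) hc' hl
  exact ⟨⟨fun ⟨l, hl⟩ => hstrong l hl, fun hw => ⟨_, hweak hw⟩⟩, hstrong _, hweak⟩

end BasedRootSystem

namespace BasedRootSystem

variable {R : BasedRootSystem V} {Θ : Set V} {θ : V}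

/-! ### Angles between simple roots -/

theorem eq_of_rootRefl_eq {β γ : V} (hβ : β ∈ R.posRoots) (hγ : γ ∈ R.posRoots)
    (h : rootRefl β = rootRefl γ) : β = γ := by
  have h1 : β - coPair β γ • γ = -β := by
    rw [← rootRefl_self, h]
    exact (rootRefl_apply γ β).symm
  have h2 : β = (2⁻¹ * coPair β γ) • γ := by
    rw [mul_smul, eq_inv_smul_iff₀ two_ne_zero, two_smul]
    nth_rw 2 [← neg_neg β]
    rw [← h1]
    abel
  rcases R.reduced γ hγ.1 _ (h2 ▸ hβ.1) with hc | hc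
  · rw [h2, hc, one_smul]
  · rw [h2, hc, neg_one_smul] at hβ
    exact absurd hβ (neg_notMem_posRoots hγ)

theorem coeff_eq_of_simple {α β : V} (hα : α ∈ R.simple) (hβ : β ∈ R.simple) (hne : α ≠ β)
    {x y x' y' : ℝ} (h : x • α + y • β = x' • α + y' • β) : x = x' ∧ y = y' := by
  obtain ⟨φ, h1, h0⟩ := R.exists_coord hα
  obtain ⟨ψ, h1', h0'⟩ := R.exists_coord hβ
  have hφ := congrArg φ h
  have hψ := congrArg ψ h
  simp only [map_add, map_smul, h1, h0 β hβ hne.symm, h1', h0' α hα hne, smul_eq_mul, mul_one,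
    mul_zero, add_zero, zero_add] at hφ hψ
  exact ⟨hφ, hψ⟩

theorem coPair_nonpos {α β : V} (hα : α ∈ R.simple) (hβ : β ∈ R.simple) (hne : α ≠ β) :
    coPair α β ≤ 0 := by
  have := inner_simple_nonpos hα hβ hne.symm
  exact div_nonpos_of_nonpos_of_nonneg (by linarith) (inner_self_pos (R.simple_subset hβ)).le

/-- The formula for a reflection in terms of the coroot. -/
theorem rootRefl_eq_coPair (γ x : V) : rootRefl γ x = x - coPair x γ • γ := rootRefl_apply γ x

theorem rootRefl_rootRefl_eq (β γ : V) :
    rootRefl (rootRefl β γ) = rootRefl β * rootRefl γ * rootRefl β := by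
  rw [rootRefl_map, rootRefl_inv]

theorem coPair_of_orderOf_eq_two {α β : V} (hα : α ∈ R.simple) (hβ : β ∈ R.simple) (hne : α ≠ β)
    (h : orderOf (rootRefl α * rootRefl β) = 2) : coPair α β = 0 := by
  have hpow := pow_orderOf_eq_one (rootRefl α * rootRefl β)
  rw [h] at hpow
  have h1 : rootRefl (rootRefl β α) = rootRefl α := by
    rw [rootRefl_rootRefl_eq, ← mul_left_inj (rootRefl α), rootRefl_mul_self,
      ← mul_right_inj (rootRefl α), mul_one, ← mul_left_inj (rootRefl α), rootRefl_mul_self]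
    simpa [pow_succ, mul_assoc, rootRefl_mul_self] using congrArg (· * (1 : V ≃ₗᵢ[ℝ] V)) hpow
  have h2 := eq_of_rootRefl_eq (rootRefl_mem_posRoots hβ (simple_mem_posRoots hα) hne)
    (simple_mem_posRoots hα) h1
  rw [coPair, inner_eq_zero_of_rootRefl_eq (simple_ne_zero hβ) h2, mul_zero, zero_div]

variable (R) in
/-- Two vectors are conjugate under the reflection group. -/
def IsConj (a b : V) : Prop := ∃ w ∈ R.group, w a = b

theorem IsConj.symm {a b : V} (h : R.IsConj a b) : R.IsConj b a := by
  obtain ⟨w, hw, rfl⟩ := h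
  exact ⟨w⁻¹, inv_mem hw, w.symm_apply_apply a⟩

theorem IsConj.trans {a b c : V} (h : R.IsConj a b) (h' : R.IsConj b c) : R.IsConj a c := by
  obtain ⟨w, hw, rfl⟩ := h
  obtain ⟨u, hu, rfl⟩ := h'
  exact ⟨u * w, mul_mem hu hw, rfl⟩

/-- Reflections whose product has order three satisfy the braid relation. -/
theorem rootRefl_eq_of_pow_three {α β : V} (h : (rootRefl α * rootRefl β) ^ 3 = 1) :
    rootRefl (rootRefl α β) = rootRefl (rootRefl β α) := by
  rw [rootRefl_rootRefl_eq, rootRefl_rootRefl_eq, ← rootRefl_inv β, ← rootRefl_inv α]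
  refine (mul_inv_eq_one.1 (Eq.trans ?_ h))
  simp [pow_succ, mul_assoc, mul_inv_rev, rootRefl_inv]

/-- The relation of length five, for reflections whose product has order five. -/
theorem rootRefl_eq_of_pow_five {α β : V} (h : (rootRefl α * rootRefl β) ^ 5 = 1) :
    rootRefl (rootRefl α (rootRefl β α)) = rootRefl (rootRefl β (rootRefl α β)) := by
  simp only [rootRefl_rootRefl_eq]
  refine (mul_inv_eq_one.1 (Eq.trans ?_ h))
  simp [pow_succ, mul_assoc, mul_inv_rev, rootRefl_inv]

/-- The equality of the roots `s_α β` and `s_β α` gives the pairing and the conjugacy. -/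
theorem of_orderOf_eq_three {α β : V} (hα : α ∈ R.simple) (hβ : β ∈ R.simple) (hne : α ≠ β)
    (h : orderOf (rootRefl α * rootRefl β) = 3) : coPair α β = -1 ∧ R.IsConj α β := by
  have h1 := rootRefl_eq_of_pow_three (h ▸ pow_orderOf_eq_one (rootRefl α * rootRefl β))
  have h2 := eq_of_rootRefl_eq (rootRefl_mem_posRoots hα (simple_mem_posRoots hβ) hne.symm)
    (rootRefl_mem_posRoots hβ (simple_mem_posRoots hα) hne) h1
  refine ⟨?_, rootRefl α * rootRefl β,
    mul_mem (rootRefl_mem_group hα) (rootRefl_mem_group hβ), ?_⟩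
  · rw [rootRefl_eq_coPair, rootRefl_eq_coPair] at h2
    have h3 : (-coPair β α) • α + (1 : ℝ) • β = (1 : ℝ) • α + (-coPair α β) • β := by
      rw [neg_smul, neg_smul, one_smul, one_smul, ← sub_eq_add_neg, ← h2]
      abel
    linarith [(coeff_eq_of_simple hα hβ hne h3).2]
  · change rootRefl α (rootRefl β α) = β
    rw [← h2, rootRefl_rootRefl]

/-- When the product of two simple reflections has order five, the pairing is minus the golden ratio:
with `a` and `b` the two pairings, the equality of the roots `s_α s_β α` and `s_β s_α β` gives `a = b`
and `a ^ 2 + a - 1 = 0`, and `a` is the negative root of this equation. -/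
theorem of_orderOf_eq_five {α β : V} (hα : α ∈ R.simple) (hβ : β ∈ R.simple) (hne : α ≠ β)
    (h : orderOf (rootRefl α * rootRefl β) = 5) :
    coPair α β = -Real.goldenRatio ∧ R.IsConj α β := by
  have h1 := rootRefl_eq_of_pow_five (h ▸ pow_orderOf_eq_one (rootRefl α * rootRefl β))
  have hα0 := inner_self_pos (R.simple_subset hα)
  have hβ0 := inner_self_pos (R.simple_subset hβ)
  have hin : inner ℝ α β ≠ 0 := by
    intro h0
    have h2 : rootRefl β α = α := rootRefl_eq_self h0
    have h3 : (rootRefl α * rootRefl β) ^ 2 = 1 := by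
      have := rootRefl_rootRefl_eq β α
      rw [h2] at this
      calc _ = rootRefl α * (rootRefl β * rootRefl α * rootRefl β) := by
            simp only [pow_two, mul_assoc]
        _ = 1 := by rw [← this, rootRefl_mul_self]
    have := orderOf_dvd_of_pow_eq_one h3
    rw [h] at this
    omega
  have ha : coPair α β ≠ 0 := div_ne_zero (mul_ne_zero two_ne_zero hin) hβ0.ne'
  have hb : coPair β α ≠ 0 :=
    div_ne_zero (mul_ne_zero two_ne_zero (by rwa [real_inner_comm])) hα0.ne'
  have hne1 : rootRefl β α ≠ α := fun h0 =>
    hin (inner_eq_zero_of_rootRefl_eq (simple_ne_zero hβ) h0)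
  have hne2 : rootRefl α β ≠ β := fun h0 =>
    hin (by rw [real_inner_comm]; exact inner_eq_zero_of_rootRefl_eq (simple_ne_zero hα) h0)
  have h2 := eq_of_rootRefl_eq
    (rootRefl_mem_posRoots hα (rootRefl_mem_posRoots hβ (simple_mem_posRoots hα) hne) hne1)
    (rootRefl_mem_posRoots hβ (rootRefl_mem_posRoots hα (simple_mem_posRoots hβ) hne.symm) hne2) h1
  have hconj : R.IsConj α β := by
    refine ⟨rootRefl α * rootRefl β * (rootRefl α * rootRefl β), ?_, ?_⟩
    · have := mul_mem (rootRefl_mem_group hα)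
        (rootRefl_mem_group hβ)
      exact mul_mem this this
    · change rootRefl α (rootRefl β (rootRefl α (rootRefl β α))) = β
      rw [h2, rootRefl_rootRefl, rootRefl_rootRefl]
  have e1 : rootRefl α (rootRefl β α) =
      (coPair α β * coPair β α - 1) • α + (-coPair α β) • β := by
    rw [rootRefl_eq_coPair β α, map_sub, map_smul, rootRefl_self, rootRefl_eq_coPair α β]
    module
  have e2 : rootRefl β (rootRefl α β) =
      (-coPair β α) • α + (coPair α β * coPair β α - 1) • β := by
    rw [rootRefl_eq_coPair α β, map_sub, map_smul, rootRefl_self, rootRefl_eq_coPair β α]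
    module
  rw [e1, e2] at h2
  obtain ⟨h3, h4⟩ := coeff_eq_of_simple hα hβ hne h2
  have hab : coPair α β = coPair β α := by linarith
  have hle := coPair_nonpos hα hβ hne
  have hlt := lt_of_le_of_ne hle ha
  rw [← hab] at h3
  refine ⟨?_, hconj⟩
  have hroots : (coPair α β + Real.goldenRatio) * (coPair α β + Real.goldenConj) = 0 := by
    linear_combination h3 + coPair α β * Real.goldenRatio_add_goldenConj +
      Real.goldenRatio_mul_goldenConj
  rcases mul_eq_zero.1 hroots with h5 | h5
  · linarith
  · linarith [Real.goldenConj_neg]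

end BasedRootSystem

namespace BasedRootSystem

variable {R : BasedRootSystem V} {Θ : Set V}

/-! ### Roots in coordinates -/

section Coordinates

variable {ι D : Type*} [CommRing D]

/-- The bilinear form with Gram matrix `C` on coordinate vectors over `D`. -/
def gramForm [Fintype ι] (C : Matrix ι ι D) (u v : ι → D) : D := ∑ i, ∑ j, u i * C i j * v j

/-- The vector with coordinates `u` with respect to the family `e`. The coordinates are taken in a
ring `D` of exact numbers, mapped to the reals by `val`. -/
def comb [Fintype ι] (val : D →+* ℝ) (e : ι → V) (u : ι → D) : V := ∑ i, val (u i) • e i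

/-- The enumeration `e` of the simple roots has Cartan matrix `C`, and all simple roots are conjugate
to each other. -/
structure HasCartanMatrix (R : BasedRootSystem V) (val : D →+* ℝ) (e : ι ≃ R.simple)
    (C : Matrix ι ι D) : Prop where
  coPair_eq : ∀ i j, coPair (e i : V) (e j : V) = val (C i j)
  isConj : ∀ i j, R.IsConj (e i : V) (e j : V)

variable {val : D →+* ℝ} {e : ι ≃ R.simple} {C : Matrix ι ι D}

namespace HasCartanMatrix

theorem isConj_of_mem (h : HasCartanMatrix R val e C) {β γ : V} (hβ : β ∈ R.roots)
    (hγ : γ ∈ R.roots) : R.IsConj β γ := by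
  obtain ⟨α, hα, u, hu, rfl⟩ := exists_simple_conj hβ
  obtain ⟨α', hα', u', hu', rfl⟩ := exists_simple_conj hγ
  have h1 : R.IsConj α (u α) := ⟨u, R.group_eq ▸ hu, rfl⟩
  have h2 : R.IsConj α' (u' α') := ⟨u', R.group_eq ▸ hu', rfl⟩
  have h3 := h.isConj (e.symm ⟨α, hα⟩) (e.symm ⟨α', hα'⟩)
  simp only [Equiv.apply_symm_apply] at h3
  exact h1.symm.trans (h3.trans h2)

theorem inner_self_eq (h : HasCartanMatrix R val e C) {β γ : V} (hβ : β ∈ R.roots)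
    (hγ : γ ∈ R.roots) : inner ℝ β β = inner ℝ γ γ := by
  obtain ⟨w, -, rfl⟩ := h.isConj_of_mem hβ hγ
  exact (w.inner_map_map β β).symm

theorem inner_simple (h : HasCartanMatrix R val e C) {β : V} (hβ : β ∈ R.roots) (i j : ι) :
    inner ℝ (e i : V) (e j : V) = val (C i j) * (inner ℝ β β / 2) := by
  have hj := R.simple_subset (e j).2
  have := inner_self_pos hj
  rw [← h.coPair_eq, coPair, h.inner_self_eq hβ hj]
  field_simp

variable [Fintype ι]

theorem inner_comb (h : HasCartanMatrix R val e C) {β : V} (hβ : β ∈ R.roots) (u v : ι → D) :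
    inner ℝ (comb val (fun i => (e i : V)) u) (comb val (fun i => (e i : V)) v) =
      val (gramForm C u v) * (inner ℝ β β / 2) := by
  simp only [comb, sum_inner, inner_sum, inner_smul_left, inner_smul_right, h.inner_simple hβ]
  simp only [Finset.mul_sum]
  rw [Finset.sum_comm]
  simp only [gramForm, map_sum, map_mul, Finset.sum_mul]
  refine Finset.sum_congr rfl fun i _ => Finset.sum_congr rfl fun j _ => ?_
  simp only [conj_trivial]
  ring

/-- Reflecting a root in a root, in coordinates. -/
theorem comb_mem_roots (h : HasCartanMatrix R val e C) {b g t : ι → D}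
    (hb : comb val (fun i => (e i : V)) b ∈ R.roots)
    (hg : comb val (fun i => (e i : V)) g ∈ R.roots)
    (ht : ∀ i, t i = g i - gramForm C g b * b i) :
    comb val (fun i => (e i : V)) t ∈ R.roots := by
  have key : comb val (fun i => (e i : V)) t = rootRefl (comb val (fun i => (e i : V)) b)
      (comb val (fun i => (e i : V)) g) := by
    have h0 := inner_self_pos hb
    have h1 : coPair (comb val (fun i => (e i : V)) g) (comb val (fun i => (e i : V)) b) =
        val (gramForm C g b) := by
      rw [coPair, h.inner_comb hb g b]
      field_simp
    rw [rootRefl_eq_coPair, h1]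
    simp only [comb, ht, map_sub, map_mul, sub_smul, Finset.sum_sub_distrib, Finset.smul_sum,
      mul_smul]
  rw [key]
  exact R.rootRefl_mem _ hb _ hg

variable [DecidableEq ι]

theorem comb_single (i : ι) : comb val (fun i => (e i : V)) (Pi.single i 1) = e i := by
  rw [comb, Finset.sum_eq_single i]
  · simp
  · intro j _ hj
    simp [hj]
  · simp

theorem comb_single_mem (i : ι) : comb val (fun i => (e i : V)) (Pi.single i 1) ∈ R.roots := by
  rw [comb_single]
  exact R.simple_subset (e i).2

/-- A root orthogonal to all simple roots but one, with positive pairing with the remaining one, is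
the dominant root. -/
theorem isDominantRoot_comb (h : HasCartanMatrix R val e C) {t : ι → D} {d : ι}
    (ht : comb val (fun i => (e i : V)) t ∈ R.roots) (hΘ : Θ ⊆ R.simple)
    (hd : ∀ i, (e i : V) ∈ Θ ↔ i ≠ d)
    (h0 : ∀ i, i ≠ d → gramForm C t (Pi.single i 1) = 0)
    (hpos : 0 < val (gramForm C t (Pi.single d 1))) :
    IsDominantRoot R Θ (comb val (fun i => (e i : V)) t) where
  subset := hΘ
  mem := ht
  inner_eq_zero α hα := by
    obtain ⟨i, hi⟩ := e.surjective ⟨α, hΘ hα⟩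
    obtain rfl : (e i : V) = α := congrArg Subtype.val hi
    rw [← comb_single (val := val) i, h.inner_comb ht, h0 i ((hd i).1 hα), map_zero, zero_mul]
  inner_pos α hα hαΘ := by
    obtain ⟨i, hi⟩ := e.surjective ⟨α, hα⟩
    obtain rfl : (e i : V) = α := congrArg Subtype.val hi
    obtain rfl : i = d := not_not.1 fun hne => hαΘ ((hd i).2 hne)
    rw [← comb_single (val := val) i, h.inner_comb ht]
    exact mul_pos hpos (half_pos (inner_self_pos ht))
  transitive β hβ := h.isConj_of_mem ht hβ

theorem lefschetz_iff [FiniteDimensional ℝ V] (h : HasCartanMatrix R val e C) {t : ι → D} {d : ι}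
    (ht : comb val (fun i => (e i : V)) t ∈ R.roots) (hΘ : Θ ⊆ R.simple)
    (hd : ∀ i, (e i : V) ∈ Θ ↔ i ≠ d)
    (h0 : ∀ i, i ≠ d → gramForm C t (Pi.single i 1) = 0)
    (hpos : 0 < val (gramForm C t (Pi.single d 1))) :
    (HasStrongLefschetz (R.relDeg Θ) ↔ HasWeakLefschetz (R.relDeg Θ) (R.relRho hΘ)) ∧
      (IsLefschetzElement (R.relDeg Θ) (R.relRho hΘ) ↔
        HasWeakLefschetz (R.relDeg Θ) (R.relRho hΘ)) := by
  refine (h.isDominantRoot_comb ht hΘ hd h0 hpos).lefschetz_iff (δ := e d) (e d).2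
    (fun hm => (hd d).1 hm rfl) (fun α hα hne => ?_) hΘ
  obtain ⟨i, hi⟩ := e.surjective ⟨α, hα⟩
  obtain rfl : (e i : V) = α := congrArg Subtype.val hi
  exact (hd i).2 fun hid => hne (hid ▸ rfl)

end HasCartanMatrix

end Coordinates

end BasedRootSystem

namespace BasedRootSystem

variable {R : BasedRootSystem V} {Θ : Set V}

/-! ### Cartan matrices from Coxeter matrices -/

section Cartan

variable {ι D : Type*} [CommRing D] [DecidableEq ι] {val : D →+* ℝ} {M : CoxeterMatrix ι}

/-- The Cartan matrix, with respect to roots of equal length, of a Coxeter matrix with off-diagonal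
entries `2`, `3`, `5`. The element `g` stands for the golden ratio. -/
def cartanOf (M : CoxeterMatrix ι) (g : D) : Matrix ι ι D := fun i j =>
  if i = j then 2 else if M i j = 3 then -1 else if M i j = 5 then -g else 0

/-- The Coxeter graph is given as connected by a map `p` that moves each vertex to itself or to a
neighbour, and of which an iterate is constant. -/
theorem hasCartanMatrix_cartanOf {e : ι ≃ R.simple} {g : D}
    (he : ∀ i j, orderOf (rootRefl (e i : V) * rootRefl (e j : V)) = M i j)
    (hM : ∀ i j, i ≠ j → M i j = 2 ∨ M i j = 3 ∨ M i j = 5)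
    (hg : ∀ i j, M i j = 5 → val g = Real.goldenRatio)
    (p : ι → ι) (hp : ∀ i, i = p i ∨ M i (p i) = 3 ∨ M i (p i) = 5) (k : ℕ)
    (hk : ∀ i j, p^[k] i = p^[k] j) :
    HasCartanMatrix R val e (cartanOf M g) where
  coPair_eq i j := by
    have hi := inner_self_pos (R.simple_subset (e i).2)
    by_cases hij : i = j
    · subst hij
      rw [cartanOf, if_pos rfl, coPair, mul_div_assoc, div_self hi.ne', mul_one, map_ofNat]
    · have hne : (e i : V) ≠ e j := fun h => hij (e.injective (Subtype.ext h))
      rcases hM i j hij with h | h | h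
      · simp [cartanOf, hij, h, coPair_of_orderOf_eq_two (e i).2 (e j).2 hne ((he i j).trans h)]
      · simp [cartanOf, hij, h, (of_orderOf_eq_three (e i).2 (e j).2 hne ((he i j).trans h)).1]
      · simp [cartanOf, hij, h, (of_orderOf_eq_five (e i).2 (e j).2 hne ((he i j).trans h)).1,
          hg i j h]
  isConj := by
    have h1 : ∀ i, R.IsConj (e i : V) (e (p i) : V) := by
      intro i
      by_cases hi : i = p i
      · rw [← hi]
        exact ⟨1, one_mem _, rfl⟩
      · have hne : (e i : V) ≠ e (p i) := fun h => hi (e.injective (Subtype.ext h))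
        rcases (hp i).resolve_left hi with h | h
        · exact (of_orderOf_eq_three (e i).2 (e _).2 hne ((he _ _).trans h)).2
        · exact (of_orderOf_eq_five (e i).2 (e _).2 hne ((he _ _).trans h)).2
    have h2 : ∀ k i, R.IsConj (e i : V) (e (p^[k] i) : V) := by
      intro k
      induction k with
      | zero => exact fun i => ⟨1, one_mem _, rfl⟩
      | succ k ih =>
        intro i
        rw [Function.iterate_succ_apply]
        exact (h1 i).trans (ih (p i))
    exact fun i j => (h2 k i).trans (hk i j ▸ (h2 k j).symm)

end Cartan

/-! ### Maximal proper subdiagrams -/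

section Subdiagram

variable {n : ℕ} {M : CoxeterMatrix (Fin (n + 1))} {M' : CoxeterMatrix (Fin n)}
  {d : Fin (n + 1)}

/-- The simple roots other than the one at `d` form a set of the type of the subdiagram. -/
theorem exists_subdiagram (hsub : ∀ i j, M (d.succAbove i) (d.succAbove j) = M' i j)
    (hR : HasCoxeterType M R.simple) : ∃ Θ, Θ ⊆ R.simple ∧ HasCoxeterType M' Θ := by
  obtain ⟨e, he⟩ := hR
  have hinj : Function.Injective fun i => (e (d.succAbove i) : V) :=
    Subtype.val_injective.comp (e.injective.comp Fin.succAbove_right_injective)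
  refine ⟨Set.range fun i => (e (d.succAbove i) : V), ?_, Equiv.ofInjective _ hinj, fun i j => ?_⟩
  · rintro _ ⟨i, rfl⟩
    exact (e _).2
  · rw [← hsub, ← he]
    rfl

/-- If no embedding of the diagram `M'` into `M` meets the vertex `d`, then a set of simple roots of
type `M'` consists of all simple roots but the one at `d`. -/
theorem mem_iff_of_hasCoxeterType
    (hemb : ∀ g : Fin n → Fin (n + 1), (∀ i j, M (g i) (g j) = M' i j) → ∀ i, g i ≠ d)
    {e : Fin (n + 1) ≃ R.simple}
    (he : ∀ i j, orderOf (rootRefl (e i : V) * rootRefl (e j : V)) = M i j)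
    (hΘ : Θ ⊆ R.simple) (hT : HasCoxeterType M' Θ) (i : Fin (n + 1)) : (e i : V) ∈ Θ ↔ i ≠ d := by
  obtain ⟨f, hf⟩ := hT
  let g : Fin n → Fin (n + 1) := fun i => e.symm ⟨f i, hΘ (f i).2⟩
  have heg : ∀ i, (e (g i) : V) = f i := fun i => by simp [g]
  have hgd : ∀ i, g i ≠ d := hemb g fun i j => by rw [← he, heg, heg, hf]
  have hg : Function.Injective g := fun i j hij =>
    f.injective (Subtype.ext (by rw [← heg, ← heg, hij]))
  have himage : Finset.univ.image g = Finset.univ.erase d := by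
    refine Finset.eq_of_subset_of_card_le (fun x hx => ?_) ?_
    · obtain ⟨j, -, rfl⟩ := Finset.mem_image.1 hx
      exact Finset.mem_erase.2 ⟨hgd j, Finset.mem_univ _⟩
    · rw [Finset.card_image_of_injective _ hg, Finset.card_erase_of_mem (Finset.mem_univ _)]
      simp
  constructor
  · rintro hi rfl
    refine hgd (f.symm ⟨e i, hi⟩) (e.injective (Subtype.ext ?_))
    rw [heg, Equiv.apply_symm_apply]
  · intro hi
    have : i ∈ Finset.univ.image g := himage ▸ Finset.mem_erase.2 ⟨hi, Finset.mem_univ _⟩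
    obtain ⟨j, -, rfl⟩ := Finset.mem_image.1 this
    rw [heg]
    exact (f j).2

end Subdiagram

/-! ### The diagrams `E₈` and `H₄` -/

open CoxeterMatrix HasCartanMatrix

/-- Equality to a constant is decidable entrywise; this form is found below quantifiers. -/
instance {ι : Type*} (M : CoxeterMatrix ι) (i j : ι) (k : ℕ) : Decidable (M i j = k) :=
  Nat.decEq _ _

set_option synthInstance.maxSize 1000 in
set_option synthInstance.maxHeartbeats 200000 in
/-- Since `E₇` has a branch point with arms of lengths `1`, `2`, `3`, it lies in `E₈` in only one
way. -/
theorem E₈_embedding (g : Fin 7 → Fin 8) (hg : ∀ i j, E₈ (g i) (g j) = E₇ i j) (i : Fin 7) :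
    g i ≠ 7 := by
  have hne : ∀ i j, E₇ i j ≠ 1 → g i ≠ g j := fun i j hij h =>
    hij (by rw [← hg, h, E₈.diagonal])
  -- The branch point `a`, its neighbours `b`, `c`, `d`, the second vertex `x` of the arm of `c`, and
  -- the vertices `y`, `z` that follow `d`.
  have key : ∀ a b, E₈ a b = 3 → ∀ c, E₈ a c = 3 → c ≠ b → ∀ d, E₈ a d = 3 → d ≠ b → d ≠ c →
      ∀ x, E₈ c x = 3 → x ≠ a → ∀ y, E₈ d y = 3 → y ≠ a → ∀ z, E₈ y z = 3 → z ≠ d →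
      a ≠ 7 ∧ b ≠ 7 ∧ c ≠ 7 ∧ d ≠ 7 ∧ x ≠ 7 ∧ y ≠ 7 ∧ z ≠ 7 := by
    decide +kernel
  obtain ⟨h3, h1, h2, h4, h0, h5, h6⟩ := key (g 3) (g 1) (hg _ _) (g 2) (hg _ _)
    (hne _ _ (by decide)) (g 4) (hg _ _) (hne _ _ (by decide)) (hne _ _ (by decide)) (g 0) (hg _ _)
    (hne _ _ (by decide)) (g 5) (hg _ _) (hne _ _ (by decide)) (g 6) (hg _ _) (hne _ _ (by decide))
  fin_cases i <;> assumption

/-- The edge labelled five is at one end of `H₄`, so that `H₃` misses the other end. -/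
theorem H₄_embedding (g : Fin 3 → Fin 4) (hg : ∀ i j, H₄ (g i) (g j) = H₃ i j) (i : Fin 3) :
    g i ≠ 0 := by
  have key : ∀ a b, H₄ a b = 3 → ∀ c, H₄ b c = 5 → a ≠ 0 ∧ b ≠ 0 ∧ c ≠ 0 := by decide +kernel
  obtain ⟨h0, h1, h2⟩ := key (g 0) (g 1) (hg _ _) (g 2) (hg _ _)
  fin_cases i <;> assumption

/-- The coordinates of the highest root of `E₈`. -/
def highestE₈ : Fin 8 → ℤ := ![2, 3, 4, 6, 5, 4, 3, 2]

/-- A chain of roots starting from the simple roots, in which each root is the sum of two earlier ones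
and so the reflection of one of them in the other. -/
theorem comb_highestE₈_mem {e : Fin 8 ≃ R.simple}
    (h : HasCartanMatrix R (Int.castRingHom ℝ) e (cartanOf E₈ 0)) :
    comb (Int.castRingHom ℝ) (fun i => (e i : V)) highestE₈ ∈ R.roots := by
  have h1 : comb (Int.castRingHom ℝ) (fun i => (e i : V)) ![0, 0, 0, 1, 1, 0, 0, 0] ∈ R.roots :=
    h.comb_mem_roots (comb_single_mem 3) (comb_single_mem 4) (by decide +kernel)
  have h2 : comb (Int.castRingHom ℝ) (fun i => (e i : V)) ![0, 0, 1, 1, 1, 0, 0, 0] ∈ R.roots :=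
    h.comb_mem_roots h1 (comb_single_mem 2) (by decide +kernel)
  have h3 : comb (Int.castRingHom ℝ) (fun i => (e i : V)) ![0, 0, 1, 1, 1, 1, 0, 0] ∈ R.roots :=
    h.comb_mem_roots h2 (comb_single_mem 5) (by decide +kernel)
  have h4 : comb (Int.castRingHom ℝ) (fun i => (e i : V)) ![0, 1, 1, 1, 1, 1, 0, 0] ∈ R.roots :=
    h.comb_mem_roots h3 (comb_single_mem 1) (by decide +kernel)
  have h5 : comb (Int.castRingHom ℝ) (fun i => (e i : V)) ![0, 1, 1, 2, 1, 1, 0, 0] ∈ R.roots :=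
    h.comb_mem_roots h4 (comb_single_mem 3) (by decide +kernel)
  have h6 : comb (Int.castRingHom ℝ) (fun i => (e i : V)) ![0, 1, 1, 2, 1, 1, 1, 0] ∈ R.roots :=
    h.comb_mem_roots h5 (comb_single_mem 6) (by decide +kernel)
  have h7 : comb (Int.castRingHom ℝ) (fun i => (e i : V)) ![0, 1, 1, 2, 2, 1, 1, 0] ∈ R.roots :=
    h.comb_mem_roots h6 (comb_single_mem 4) (by decide +kernel)
  have h8 : comb (Int.castRingHom ℝ) (fun i => (e i : V)) ![1, 1, 1, 2, 2, 1, 1, 0] ∈ R.roots :=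
    h.comb_mem_roots h7 (comb_single_mem 0) (by decide +kernel)
  have h9 : comb (Int.castRingHom ℝ) (fun i => (e i : V)) ![1, 1, 1, 2, 2, 1, 1, 1] ∈ R.roots :=
    h.comb_mem_roots h8 (comb_single_mem 7) (by decide +kernel)
  have h10 : comb (Int.castRingHom ℝ) (fun i => (e i : V)) ![1, 2, 2, 4, 3, 2, 2, 1] ∈ R.roots :=
    h.comb_mem_roots h9 h6 (by decide +kernel)
  have h11 : comb (Int.castRingHom ℝ) (fun i => (e i : V)) ![1, 2, 2, 4, 3, 3, 2, 1] ∈ R.roots :=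
    h.comb_mem_roots h10 (comb_single_mem 5) (by decide +kernel)
  have h12 : comb (Int.castRingHom ℝ) (fun i => (e i : V)) ![1, 2, 3, 4, 3, 3, 2, 1] ∈ R.roots :=
    h.comb_mem_roots h11 (comb_single_mem 2) (by decide +kernel)
  exact h.comb_mem_roots h12 h9 (by decide +kernel)

/-- The ring `ℤ[φ]`, where `φ ^ 2 = 1 + φ`. -/
abbrev GoldenInt := QuadraticAlgebra ℤ 1 1

/-- The embedding of `ℤ[φ]` in the reals that maps `φ` to the golden ratio. -/
def goldenVal : GoldenInt →+* ℝ :=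
  (QuadraticAlgebra.lift ⟨Real.goldenRatio, by
    rw [← pow_two, Real.goldenRatio_sq, one_smul, one_smul, add_comm]⟩ :
    GoldenInt →ₐ[ℤ] ℝ).toRingHom

theorem goldenVal_apply (z : GoldenInt) : goldenVal z = z.re + z.im * Real.goldenRatio := by
  simp [goldenVal]

/-- The coordinates of the dominant root of `H₄`. -/
def dominantH₄ : Fin 4 → GoldenInt := ![⟨0, 2⟩, ⟨1, 3⟩, ⟨2, 4⟩, ⟨2, 3⟩]

/-- A chain of roots starting from the simple roots, in which each root is the reflection of an
earlier one in an earlier one. -/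
theorem comb_dominantH₄_mem {e : Fin 4 ≃ R.simple}
    (h : HasCartanMatrix R goldenVal e (cartanOf H₄ ⟨0, 1⟩)) :
    comb goldenVal (fun i => (e i : V)) dominantH₄ ∈ R.roots := by
  have h1 : comb goldenVal (fun i => (e i : V)) ![0, 0, ⟨0, 1⟩, 1] ∈ R.roots :=
    h.comb_mem_roots (comb_single_mem 2) (comb_single_mem 3) (by decide +kernel)
  have h2 : comb goldenVal (fun i => (e i : V)) ![0, 1, ⟨1, 1⟩, ⟨0, 1⟩] ∈ R.roots :=
    h.comb_mem_roots h1 (comb_single_mem 1) (by decide +kernel)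
  have h3 : comb goldenVal (fun i => (e i : V)) ![1, 1, ⟨1, 1⟩, ⟨0, 1⟩] ∈ R.roots :=
    h.comb_mem_roots h2 (comb_single_mem 0) (by decide +kernel)
  have h4 : comb goldenVal (fun i => (e i : V)) ![1, 1, ⟨1, 1⟩, ⟨1, 1⟩] ∈ R.roots :=
    h.comb_mem_roots h3 (comb_single_mem 3) (by decide +kernel)
  have h5 : comb goldenVal (fun i => (e i : V)) ![1, ⟨1, 1⟩, ⟨1, 1⟩, ⟨1, 1⟩] ∈ R.roots :=
    h.comb_mem_roots (comb_single_mem 1) h4 (by decide +kernel)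
  have h6 : comb goldenVal (fun i => (e i : V)) ![⟨1, 1⟩, ⟨2, 2⟩, ⟨2, 3⟩, ⟨1, 3⟩] ∈ R.roots :=
    h.comb_mem_roots h5 h3 (by decide +kernel)
  exact h.comb_mem_roots h3 h6 (by decide +kernel)

end BasedRootSystem

end

open BasedRootSystem CoxeterMatrix

theorem mainTheorem7 {V : Type*} [NormedAddCommGroup V] [InnerProductSpace ℝ V]
    [FiniteDimensional ℝ V] (R : BasedRootSystem V) :
    (HasCoxeterType CoxeterMatrix.E₈ R.simple →
      (∃ Θ, Θ ⊆ R.simple ∧ HasCoxeterType CoxeterMatrix.E₇ Θ) ∧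
      ∀ (Θ : Set V) (hΘ : Θ ⊆ R.simple), HasCoxeterType CoxeterMatrix.E₇ Θ →
        (HasStrongLefschetz (R.relDeg Θ) ↔ HasWeakLefschetz (R.relDeg Θ) (R.relRho hΘ)) ∧
        (IsLefschetzElement (R.relDeg Θ) (R.relRho hΘ) ↔
          HasWeakLefschetz (R.relDeg Θ) (R.relRho hΘ))) ∧
    (HasCoxeterType CoxeterMatrix.H₄ R.simple →
      (∃ Θ, Θ ⊆ R.simple ∧ HasCoxeterType CoxeterMatrix.H₃ Θ) ∧
      ∀ (Θ : Set V) (hΘ : Θ ⊆ R.simple), HasCoxeterType CoxeterMatrix.H₃ Θ →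
        (HasStrongLefschetz (R.relDeg Θ) ↔ HasWeakLefschetz (R.relDeg Θ) (R.relRho hΘ)) ∧
        (IsLefschetzElement (R.relDeg Θ) (R.relRho hΘ) ↔
          HasWeakLefschetz (R.relDeg Θ) (R.relRho hΘ))) := by
  have hE : ∀ i j : Fin 7, E₈ (Fin.succAbove 7 i) (Fin.succAbove 7 j) = E₇ i j := by
    intro i j
    fin_cases i <;> fin_cases j <;> rfl
  have hH : ∀ i j : Fin 3, H₄ (Fin.succAbove 0 i) (Fin.succAbove 0 j) = H₃ i j := by
    intro i j
    fin_cases i <;> fin_cases j <;> rfl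
  refine ⟨fun hR => ⟨exists_subdiagram (d := 7) hE hR, fun Θ hΘ hT => ?_⟩,
    fun hR => ⟨exists_subdiagram (d := 0) hH hR, fun Θ hΘ hT => ?_⟩⟩
  · obtain ⟨e, he⟩ := hR
    -- The list of vertices sends each vertex to its neighbour on the way to the vertex `0`.
    have h : HasCartanMatrix R (Int.castRingHom ℝ) e (cartanOf E₈ 0) :=
      hasCartanMatrix_cartanOf he (by decide +kernel)
        (fun i j h => absurd h ((by decide +kernel : ∀ i j, E₈ i j ≠ 5) i j))
        ![0, 3, 0, 2, 3, 4, 5, 6] (by decide +kernel) 6 (by decide +kernel)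
    refine h.lefschetz_iff (comb_highestE₈_mem h) hΘ
      (mem_iff_of_hasCoxeterType E₈_embedding he hΘ hT) (by decide +kernel) ?_
    rw [show gramForm (cartanOf E₈ 0) highestE₈ (Pi.single 7 1) = 1 by decide +kernel, map_one]
    exact one_pos
  · obtain ⟨e, he⟩ := hR
    have h : HasCartanMatrix R goldenVal e (cartanOf H₄ ⟨0, 1⟩) :=
      hasCartanMatrix_cartanOf he (by decide +kernel)
        (fun i j _ => by rw [goldenVal_apply]; simp)
        ![0, 0, 1, 2] (by decide +kernel) 3 (by decide +kernel)
    refine h.lefschetz_iff (comb_dominantH₄_mem h) hΘ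
      (mem_iff_of_hasCoxeterType H₄_embedding he hΘ hT) (by decide +kernel) ?_
    rw [show gramForm (cartanOf H₄ ⟨0, 1⟩) dominantH₄ (Pi.single 0 1) = ⟨-1, 1⟩ by decide +kernel,
      goldenVal_apply]
    have := Real.one_lt_goldenRatio
    push_cast
    linarith
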